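/- Let $(X,g)$ be an oriented Riemannian $4$-manifold with a spin structure, and suppose that $g$ is anti self-dual and Einstein with scalar curvature $24\Lambda$, where $\Lambda\neq 0$ is constant. Let $\mathbb S'\to X$ be the complex rank-$2$ spinor bundle associated to the spin structure by the representation $(A,B)\mapsto {}^tB^{-1}$ of $Spin(4)=SU(2)\times SU(2)$, where $(A,B)$ acts on $$\mathbb R^4\cong\mathbb M=\Big\{\tfrac1{\sqrt2}\begin{pmatrix}x^0+ix^3&x^1+ix^2\\-x^1+ix^2&x^0-ix^3\end{pmatrix}\Big\}$$ by $Y\mapsto AYB^{-1}$; thus $\mathbb S\otimes\mathbb S'\cong\mathbb CTX$, with $\mathbb S$ the bundle associated to $(A,B)\mapsto A$. The orientation is such that $\Psi'_{A'B'C'D'}\epsilon_{AB}\epsilon_{CD}$ is the self-dual part of the Weyl tensor (anti self-duality says that it vanishes), that is, the volume form is $e_{abcd}=\epsilon_{AC}\epsilon_{BD}\epsilon_{A'D'}\epsilon_{B'C'}-\epsilon_{AD}\epsilon_{BC}\epsilon_{A'C'}\epsilon_{B'D'}$. Let $\delta\pi^{A'}=d\pi^{A'}+\Gamma_{cB'}{}^{A'}\pi^{B'}\theta^c$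 be the covariant differential of the tautological section for the connection on $\mathbb S'$ induced by the Levi-Civita connection, and let $$\tilde\tau=\epsilon_{A'B'}\pi^{A'}\delta\pi^{B'}$$ on $\mathbb S'\setminus\{0\}$. Give $\mathbb S'\setminus\{0\}$ the complex structure $\mathbb I$ whose $(0,1)$-vectors at $\pi$ are spanned by the $(0,1)$-vectors of the fibre and the horizontal lifts of the vectors $\xi^A\pi^{A'}$, $\xi\in\mathbb S_x$. Give $\mathbb P(\mathbb S')$ the complex structure for which the projection $p\colon\mathbb S'\setminus\{0\}\to\mathbb P(\mathbb S')$ is holomorphic, and let $K=K_{\mathbb P(\mathbb S')}$ be its canonical bundle. Finally, let $L\to\mathbb P(\mathbb S')$ be the tautological line bundle, so that $L\setminus\{0\}=\mathbb S'\setminus\{0\}$. Then $\tilde\tau\wedge d\tilde\tau$ descends to a nowhere-zero section of $(\mathbb S'\setminus\{0\})^{\otimes(-4)}\otimes(K\setminus\{0\})$: there is a nowhere-zero section $\kappa$ of $L^{\otimes(-4)}\otimes K$ over $\mathbb P(\mathbb S')$ such that for every $q\in\mathbb P(\mathbb S')$ and every $0\neq\pi\in L_q$, $$(\tilde\tau\wedge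 d\tilde\tau)_\pi=(dp_\pi)^*\big(\kappa_q(\pi\otimes\pi\otimes\pi\otimes\pi)\big).$$ Moreover, contraction with $\kappa$ is an isomorphism of holomorphic line bundles $L^{\otimes4}\cong K$: it is bijective on each fibre, and for every smooth nowhere-zero local section $\sigma$ of $L$ the section $\kappa(\sigma^{\otimes4})$ of $K$ is smooth and satisfies $\bar\partial\big(\kappa(\sigma^{\otimes4})\big)=0$ exactly at the points where $\bar\partial\sigma=0$. In this sense $\kappa$ makes $L$ a fourth root $K^{1/4}$ of $K$ and gives an isomorphism $\mathbb S'\setminus\{0\}\cong K_{\mathbb P(\mathbb S')}^{1/4}\setminus\{0\}$. -/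

import Mathlib

open Set Bundle Matrix
open scoped Manifold ContDiff TensorProduct LinearAlgebra.Projectivization

noncomputable section

/-! ### Complex-valued differential forms on a smooth manifold without boundary -/

namespace DiffForm

variable {E : Type*} [NormedAddCommGroup E] [NormedSpace ℝ E] {H : Type*} [TopologicalSpace H]
  (I : ModelWithCorners ℝ E H) {M : Type*} [TopologicalSpace M] [ChartedSpace H M]

/-- The local expression of the `k`-form `α` in the preferred chart at `x`. -/
def inChart {k : ℕ} (α : ∀ x : M, TangentSpace I x [⋀^Fin k]→L[ℝ] ℂ) (x : M) (y : E) :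
    E [⋀^Fin k]→L[ℝ] ℂ :=
  (α ((extChartAt I x).symm y)).compContinuousLinearMap
    (mfderiv 𝓘(ℝ, E) I (extChartAt I x).symm y)

/-- `α` is smooth near `x`. -/
def SmoothAt {k : ℕ} (α : ∀ x : M, TangentSpace I x [⋀^Fin k]→L[ℝ] ℂ) (x : M) : Prop :=
  ContDiffAt ℝ ∞ (inChart I α x) (extChartAt I x x)

/-- The exterior derivative, computed at each point in the preferred chart at that point. -/
def d {k : ℕ} (α : ∀ x : M, TangentSpace I x [⋀^Fin k]→L[ℝ] ℂ) (x : M) :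
    TangentSpace I x [⋀^Fin (k + 1)]→L[ℝ] ℂ :=
  (extDeriv (inChart I α x) (extChartAt I x x)).compContinuousLinearMap
    (mfderiv I 𝓘(ℝ, E) (extChartAt I x) x)

/-- A complex-valued alternating `k`-form on a real vector space is of type `(k, 0)` with respect
to the complex structure `J` when it is complex linear in each argument. -/
def IsTypeK0 {V : Type*} [AddCommGroup V] [Module ℝ V] [TopologicalSpace V] (J : V →L[ℝ] V)
    {k : ℕ} (α : V [⋀^Fin k]→L[ℝ] ℂ) : Prop :=
  ∀ (v : Fin k → V) (j : Fin k), α (Function.update v j (J (v j))) = Complex.I * α v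

/-- The space of `(k, 0)`-forms. -/
def typeK0 {V : Type*} [AddCommGroup V] [Module ℝ V] [TopologicalSpace V] (J : V →L[ℝ] V)
    (k : ℕ) : Submodule ℂ (V [⋀^Fin k]→L[ℝ] ℂ) where
  carrier := {α | IsTypeK0 J α}
  add_mem' {α β} ha hb v j := by
    simp only [ContinuousAlternatingMap.add_apply, ha v j, hb v j, mul_add]
  zero_mem' v j := by simp
  smul_mem' c α ha v j := by
    simp only [ContinuousAlternatingMap.smul_apply, ha v j, smul_eq_mul]
    ring

/-- The wedge product of a `1`-form and a `2`-form. -/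
def wedge₁₂ {V : Type*} [NormedAddCommGroup V] [NormedSpace ℝ V]
    (t : V [⋀^Fin 1]→L[ℝ] ℂ) (w : V [⋀^Fin 2]→L[ℝ] ℂ) : V [⋀^Fin 3]→L[ℝ] ℂ :=
  ContinuousAlternatingMap.alternatizeUncurryFin
    (((ContinuousLinearMap.toSpanSingleton ℂ w).restrictScalars ℝ).comp
      ((ContinuousAlternatingMap.ofSubsingleton ℝ V ℂ (0 : Fin 1)).symm t))

lemma wedge₁₂_apply {V : Type*} [NormedAddCommGroup V] [NormedSpace ℝ V]
    (t : V [⋀^Fin 1]→L[ℝ] ℂ) (w : V [⋀^Fin 2]→L[ℝ] ℂ) (x y z : V) :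
    wedge₁₂ t w ![x, y, z] = t ![x] * w ![y, z] - t ![y] * w ![x, z] + t ![z] * w ![x, y] := by
  have e (a : V) : (fun _ : Fin 1 => a) = ![a] := by ext i; simp
  have h0 : (0 : Fin 3).removeNth ![x, y, z] = ![y, z] := by
    ext i; fin_cases i <;> rfl
  have h1 : (1 : Fin 3).removeNth ![x, y, z] = ![x, z] := by
    ext i; fin_cases i <;> rfl
  have h2 : (2 : Fin 3).removeNth ![x, y, z] = ![x, y] := by
    ext i; fin_cases i <;> rfl
  simp [wedge₁₂, ContinuousAlternatingMap.alternatizeUncurryFin_apply, Fin.sum_univ_three, h0, h1,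
    h2, e]
  ring

end DiffForm

/-! ### Spin(4), the space `𝕄` and the spinor representations -/

namespace Spin4

/-- `Spin(4) = SU(2) × SU(2)`. -/
abbrev Grp : Type := specialUnitaryGroup (Fin 2) ℂ × specialUnitaryGroup (Fin 2) ℂ

/-- The matrices `q a`, for which `x ↦ (√2)⁻¹ • ∑ a, x a • q a` identifies `ℝ⁴` with the space `𝕄`
of matrices `(√2)⁻¹ (x⁰ + i x³, x¹ + i x²; -x¹ + i x², x⁰ - i x³)`; the squared length is
`2 det`. -/
def q : Fin 4 → Matrix (Fin 2) (Fin 2) ℂ :=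
  ![!![1, 0; 0, 1], !![0, 1; -1, 0], !![0, Complex.I; Complex.I, 0],
    !![Complex.I, 0; 0, -Complex.I]]

/-- The real coordinates `x a = Re tr (e_aᴴ Y)` in the orthonormal basis `e_a = (√2)⁻¹ • q a` of
`𝕄` of the image `Y = L (e_b)` of a basis vector under a complex linear `L`. -/
def coeff (a b : Fin 4) (L : Matrix (Fin 2) (Fin 2) ℂ → Matrix (Fin 2) (Fin 2) ℂ) : ℝ :=
  (1 / 2) * (trace ((q a)ᴴ * L (q b))).re

/-- The double covering `Spin(4) → SO(4)`, `(A, B) · Y = A Y B⁻¹`. -/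
def toSO4 (u : Grp) : Matrix (Fin 4) (Fin 4) ℝ :=
  Matrix.of fun a b => coeff a b fun Y =>
    (u.1 : Matrix (Fin 2) (Fin 2) ℂ) * Y * ((u.2⁻¹ : specialUnitaryGroup (Fin 2) ℂ) :
      Matrix (Fin 2) (Fin 2) ℂ)

/-- The representation `(A, B) ↦ ᵗB⁻¹ = conj B` on `ℂ²`, which defines the bundle `𝕊'`. -/
def rhoMinus (u : Grp) : Matrix (Fin 2) (Fin 2) ℂ := (u.2 : Matrix (Fin 2) (Fin 2) ℂ).map star

/-- The conjugate-linear structure map `(a, b) ↦ (conj b, -conj a)` of `ℂ²`. -/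
def sigma (z : Fin 2 → ℂ) : Fin 2 → ℂ := ![star (z 1), -star (z 0)]

/-- The matrix `ε`. -/
def eps : Matrix (Fin 2) (Fin 2) ℂ := !![0, 1; -1, 0]

/-- The skew form `ε_{A'B'} z^{A'} w^{B'}`. -/
def skew (z w : Fin 2 → ℂ) : ℂ := ∑ A, ∑ B, eps A B * z A * w B

/-- Lowering an index, `z_{B'} = z^{A'} ε_{A'B'}`. -/
def lower (z : Fin 2 → ℂ) : Fin 2 → ℂ := fun B => ∑ A, z A * eps A B

/-- `‖π‖² = (σπ)_{A'} π^{A'}`. -/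
def normSq (z : Fin 2 → ℂ) : ℂ := ∑ A, lower (sigma z) A * z A

/-- The matrix `I_{B'}^{A'}` (row `B'`, column `A'`) determined by `π`. -/
def acsMatrix (z : Fin 2 → ℂ) : Matrix (Fin 2) (Fin 2) ℂ :=
  Matrix.of fun B A => -Complex.I / normSq z * (lower z B * sigma z A + lower (sigma z) B * z A)

/-- The differential of the double covering is `ω v = α v - v β` for `(α, β) ∈ su(2) ⊕ su(2)`.
This is the component `β` of the skew-symmetric matrix `ω`. -/
def so4ToSu2 (w : Matrix (Fin 4) (Fin 4) ℝ) : Matrix (Fin 2) (Fin 2) ℂ :=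
  (-(1 / 4) : ℂ) • ∑ b, (q b)ᴴ * ∑ c, ((w c b : ℝ) : ℂ) • q c

/-- The orientation `e_{abcd}` of `ℝ⁴ ≅ 𝕄` used to define (anti) self-duality. -/
def volumeForm (a b c d : Fin 4) : ℝ :=
  -((1 : Matrix (Fin 4) (Fin 4) ℝ).submatrix ![a, b, c, d] id).det

/-- The `AA'` component of the basis vector `e_a` of `𝕄`. -/
def gamma (a : Fin 4) (A A' : Fin 2) : ℂ := ((Real.sqrt 2)⁻¹ : ℝ) * q a A A'

/-- A complex matrix as a real linear endomorphism of `ℂ²`. -/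
def matCLM : (Fin 2 → Fin 2 → ℂ) →L[ℝ] ((Fin 2 → ℂ) →L[ℝ] (Fin 2 → ℂ)) :=
  LinearMap.toContinuousLinearMap
    { toFun := fun C => LinearMap.toContinuousLinearMap
        ((Matrix.mulVecLin (Matrix.of C)).restrictScalars ℝ)
      map_add' := fun C D => by
        ext v i
        simp only [LinearMap.coe_toContinuousLinearMap', LinearMap.coe_restrictScalars,
          _root_.add_apply, Pi.add_apply, Matrix.mulVecLin_apply, Matrix.mulVec,
          dotProduct, Matrix.of_apply, add_mul, Finset.sum_add_distrib]
      map_smul' := fun c C => by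
        ext v i
        simp only [LinearMap.coe_toContinuousLinearMap', LinearMap.coe_restrictScalars,
          _root_.smul_apply, Pi.smul_apply, Matrix.mulVecLin_apply, Matrix.mulVec,
          dotProduct, Matrix.of_apply, Finset.smul_sum, smul_mul_assoc, RingHom.id_apply] }

lemma matCLM_apply (C : Fin 2 → Fin 2 → ℂ) (v : Fin 2 → ℂ) :
    matCLM C v = (Matrix.of C) *ᵥ v := rfl

lemma volumeForm_eq : (volumeForm 0 1 2 3 : ℂ) =
    ∑ A, ∑ A', ∑ B, ∑ B', ∑ C, ∑ C', ∑ D, ∑ D',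
      gamma 0 A A' * gamma 1 B B' * gamma 2 C C' * gamma 3 D D' *
        (eps A C * eps B D * eps A' D' * eps B' C' -
          eps A D * eps B C * eps A' C' * eps B' D') := by
  have h2 : (((Real.sqrt 2)⁻¹ : ℝ) : ℂ) ^ 4 = 1 / 4 := by
    have : ((Real.sqrt 2)⁻¹ : ℝ) ^ 4 = 1 / 4 := by
      rw [inv_pow, show (4 : ℕ) = 2 * 2 from rfl, pow_mul, Real.sq_sqrt (by norm_num)]
      norm_num
    rw [← Complex.ofReal_pow, this]
    norm_num
  have h0 : volumeForm 0 1 2 3 = -1 := by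
    have : ((1 : Matrix (Fin 4) (Fin 4) ℝ).submatrix ![0, 1, 2, 3] id) = 1 := by
      ext i j
      fin_cases i <;> rfl
    rw [volumeForm, this, Matrix.det_one]
  rw [h0]
  simp only [Fin.sum_univ_two, gamma, eps, q]
  simp
  ring_nf
  simp only [Complex.I_sq]
  rw [Complex.ofReal_inv] at h2
  linear_combination 4 * h2

lemma rhoMinus_mul (u v : Grp) : rhoMinus (u * v) = rhoMinus u * rhoMinus v := by
  ext i j
  simp [rhoMinus, Matrix.mul_apply]

lemma rhoMinus_one : rhoMinus 1 = 1 := by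
  ext i j
  fin_cases i <;> fin_cases j <;> simp [rhoMinus]

lemma rhoMinus_mulVec_ne_zero (u : Grp) {z : Fin 2 → ℂ} (hz : z ≠ 0) :
    rhoMinus u *ᵥ z ≠ 0 := by
  intro h
  apply hz
  have h1 : rhoMinus (u⁻¹ * u) *ᵥ z = 0 := by
    rw [rhoMinus_mul, ← Matrix.mulVec_mulVec, h, Matrix.mulVec_zero]
  rwa [inv_mul_cancel, rhoMinus_one, Matrix.one_mulVec] at h1

end Spin4


/-! ### Spin structures on Riemannian 4-manifolds -/

/-- The model space `ℝ⁴`. -/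
abbrev E4 : Type := EuclideanSpace ℝ (Fin 4)

/-- A smooth Riemannian metric on the 4-manifold `X`. -/
abbrev Metric4 (X : Type*) [TopologicalSpace X] [ChartedSpace E4 X] [IsManifold (𝓡 4) ∞ X] :=
  ContMDiffRiemannianMetric (𝓡 4) ∞ E4 (fun x : X => TangentSpace (𝓡 4) x)

/-- A spin structure on the Riemannian 4-manifold `(X, g)`, i.e. a principal `Spin(4)`-bundle with
an equivariant double covering of an oriented orthonormal frame bundle, given by local sections
over an open cover: the images `frame i` of the local sections in the orthonormal frame bundle,
and the `Spin(4)`-valued transition functions. The orientation of `X` is the one for which all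
the frames `frame i` have the same orientation as `ℝ⁴ ≅ 𝕄`. -/
structure SpinStructure {X : Type*} [TopologicalSpace X] [ChartedSpace E4 X]
    [IsManifold (𝓡 4) ∞ X] (g : Metric4 X) (ι : Type*) where
  baseSet : ι → Set X
  isOpen_baseSet : ∀ i, IsOpen (baseSet i)
  indexAt : X → ι
  mem_baseSet_at : ∀ x, x ∈ baseSet (indexAt x)
  frame : ι → Fin 4 → ∀ x : X, TangentSpace (𝓡 4) x
  smooth_frame : ∀ i a, ContMDiffOn (𝓡 4) (𝓡 4).tangent ∞
    (fun x => (⟨x, frame i a x⟩ : TangentBundle (𝓡 4) X)) (baseSet i)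
  orthonormal_frame : ∀ i, ∀ x ∈ baseSet i, ∀ a b,
    g.inner x (frame i a x) (frame i b x) = if a = b then 1 else 0
  transition : ι → ι → X → Spin4.Grp
  smooth_transition_fst : ∀ i j (A B : Fin 2), ContMDiffOn (𝓡 4) 𝓘(ℝ, ℂ) ∞
    (fun x => ((transition i j x).1 : Matrix (Fin 2) (Fin 2) ℂ) A B) (baseSet i ∩ baseSet j)
  smooth_transition_snd : ∀ i j (A B : Fin 2), ContMDiffOn (𝓡 4) 𝓘(ℝ, ℂ) ∞
    (fun x => ((transition i j x).2 : Matrix (Fin 2) (Fin 2) ℂ) A B) (baseSet i ∩ baseSet j)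
  cocycle : ∀ i j k, ∀ x ∈ baseSet i ∩ baseSet j ∩ baseSet k,
    transition i j x * transition j k x = transition i k x
  frame_transition : ∀ i j, ∀ x ∈ baseSet i ∩ baseSet j, ∀ b,
    frame j b x = ∑ a, Spin4.toSO4 (transition i j x) a b • frame i a x

namespace SpinStructure

open Spin4

variable {X : Type*} [TopologicalSpace X] [ChartedSpace E4 X] [IsManifold (𝓡 4) ∞ X]
  {g : Metric4 X} {ι : Type*} (s : SpinStructure g ι)

/-! #### The Levi-Civita connection and its curvature in the frames -/

/-- `⟨[e_a, e_b], e_c⟩`. -/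
def bracketCoeff (i : ι) (a b c : Fin 4) (x : X) : ℝ :=
  g.inner x (VectorField.mlieBracket (𝓡 4) (s.frame i a) (s.frame i b) x) (s.frame i c x)

/-- `⟨∇_{e_a} e_b, e_c⟩` for the Levi-Civita connection (Koszul formula in an orthonormal
frame). -/
def leviCivita (i : ι) (a b c : Fin 4) (x : X) : ℝ :=
  (1 / 2) * (s.bracketCoeff i a b c x - s.bracketCoeff i b c a x + s.bracketCoeff i c a b x)

/-- The derivative of the function `f` along `e_a`. -/
def frameDeriv (i : ι) (a : Fin 4) (f : X → ℝ) (x : X) : ℝ :=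
  mfderiv (𝓡 4) 𝓘(ℝ, ℝ) f x (s.frame i a x)

/-- The curvature `R_{abcd} = ⟨(∇_a ∇_b - ∇_b ∇_a - ∇_{[a, b]}) e_d, e_c⟩`. -/
def curvature (i : ι) (a b c d : Fin 4) (x : X) : ℝ :=
  s.frameDeriv i a (s.leviCivita i b d c) x - s.frameDeriv i b (s.leviCivita i a d c) x
    + ∑ f, (s.leviCivita i b d f x * s.leviCivita i a f c x
      - s.leviCivita i a d f x * s.leviCivita i b f c x
      - s.bracketCoeff i a b f x * s.leviCivita i f d c x)

/-- The Ricci tensor `R_{ab} = R_{ca}{}^c{}_b`. -/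
def ricci (i : ι) (a b : Fin 4) (x : X) : ℝ := ∑ c, s.curvature i c a c b x

/-- The scalar curvature. -/
def scalar (i : ι) (x : X) : ℝ := ∑ a, s.ricci i a a x

/-- The metric in the orthonormal frames. -/
def delta (a b : Fin 4) : ℝ := if a = b then 1 else 0

/-- The Schouten tensor `P_{ab} = (1/2) R_{ab} - (1/12) R g_{ab}`. -/
def schouten (i : ι) (a b : Fin 4) (x : X) : ℝ :=
  (1 / 2) * s.ricci i a b x - (1 / 12) * s.scalar i x * delta a b

/-- The Weyl tensor `W_{abcd} = R_{abcd} - 2 P_{c[a} g_{b]d} + 2 P_{d[a} g_{b]c}`. -/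
def weyl (i : ι) (a b c d : Fin 4) (x : X) : ℝ :=
  s.curvature i a b c d x
    - (s.schouten i c a x * delta b d - s.schouten i c b x * delta a d)
    + (s.schouten i d a x * delta b c - s.schouten i d b x * delta a c)

/-- `g` is an Einstein metric with scalar curvature `R = 24 Λ`. -/
def IsEinstein (Λ : ℝ) : Prop :=
  ∀ i, ∀ x ∈ s.baseSet i, ∀ a b, s.ricci i a b x = 6 * Λ * delta a b

/-- `g` is anti self-dual: `(1/2) e_{cd}{}^{pq} W_{abpq} = - W_{abcd}`. -/
def IsAntiSelfDual : Prop :=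
  ∀ i, ∀ x ∈ s.baseSet i, ∀ a b c d,
    (1 / 2) * ∑ p, ∑ r, volumeForm c d p r * s.weyl i a b p r x = - s.weyl i a b c d x

/-! #### The spinor bundle `𝕊'` -/

/-- The transition function of `𝕊'` from the trivialisation `i` to the trivialisation `j`. -/
def spinorChange (i j : ι) (x : X) : Matrix (Fin 2) (Fin 2) ℂ := rhoMinus (s.transition j i x)

lemma transition_self (i : ι) (x : X) (hx : x ∈ s.baseSet i) : s.transition i i x = 1 := by
  have h := s.cocycle i i i x ⟨⟨hx, hx⟩, hx⟩
  exact mul_eq_left.mp h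

lemma smooth_spinorChange (i j : ι) (A B : Fin 2) : ContMDiffOn (𝓡 4) 𝓘(ℝ, ℂ) ∞
    (fun x => s.spinorChange i j x A B) (s.baseSet i ∩ s.baseSet j) := by
  have h := s.smooth_transition_snd j i A B
  rw [inter_comm] at h
  exact (Complex.conjCLE.contDiff (n := ∞)).contMDiff.comp_contMDiffOn h

lemma smooth_matCLM_spinorChange (i j : ι) :
    ContMDiffOn (𝓡 4) 𝓘(ℝ, (Fin 2 → ℂ) →L[ℝ] (Fin 2 → ℂ)) ∞
    (fun x => matCLM fun A B => s.spinorChange i j x A B) (s.baseSet i ∩ s.baseSet j) := by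
  refine (matCLM.contDiff (n := ∞)).contMDiff.comp_contMDiffOn ?_
  exact contMDiffOn_pi_space.2 fun A => contMDiffOn_pi_space.2 fun B =>
    s.smooth_spinorChange i j A B

lemma spinorChange_comp (i j k : ι) (x : X)
    (hx : x ∈ s.baseSet i ∩ s.baseSet j ∩ s.baseSet k) :
    s.spinorChange j k x * s.spinorChange i j x = s.spinorChange i k x := by
  rw [spinorChange, spinorChange, spinorChange, ← rhoMinus_mul,
    s.cocycle k j i x ⟨⟨hx.2, hx.1.2⟩, hx.1.1⟩]

/-- The spinor bundle `𝕊'`, associated to the spin structure by the representation `ρ₋`. -/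
def core : VectorBundleCore ℝ X (Fin 2 → ℂ) ι where
  baseSet := s.baseSet
  isOpen_baseSet := s.isOpen_baseSet
  indexAt := s.indexAt
  mem_baseSet_at := s.mem_baseSet_at
  coordChange i j x := matCLM fun A B => s.spinorChange i j x A B
  coordChange_self i x hx v := by
    change s.spinorChange i i x *ᵥ v = v
    rw [spinorChange, s.transition_self i x hx, rhoMinus_one]
    exact Matrix.one_mulVec v
  continuousOn_coordChange i j := (s.smooth_matCLM_spinorChange i j).continuousOn
  coordChange_comp i j k x hx v := by
    change s.spinorChange j k x *ᵥ (s.spinorChange i j x *ᵥ v) = s.spinorChange i k x *ᵥ v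
    rw [Matrix.mulVec_mulVec, s.spinorChange_comp i j k x hx]

instance : s.core.IsContMDiff (𝓡 4) ∞ where
  contMDiffOn_coordChange i j := s.smooth_matCLM_spinorChange i j

/-- The total space of `𝕊'`. -/
abbrev Spinor : Type _ := Bundle.TotalSpace (Fin 2 → ℂ) s.core.Fiber

/-- The model of the total space of `𝕊'`, on `ℝ⁴ × ℂ²`. -/
abbrev modelS : ModelWithCorners ℝ (E4 × (Fin 2 → ℂ)) (ModelProd E4 (Fin 2 → ℂ)) :=
  (𝓡 4).prod 𝓘(ℝ, Fin 2 → ℂ)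

instance : IsManifold modelS ∞ s.Spinor :=
  Bundle.TotalSpace.isManifold (Fin 2 → ℂ) s.core.Fiber

/-- The transition functions are complex linear, so the fibres are complex vector spaces. -/
instance (x : X) : Module ℂ (s.core.Fiber x) := inferInstanceAs (Module ℂ (Fin 2 → ℂ))

/-- The fibre coordinates `z` of a spinor in the trivialisation `i`. -/
def coord (i : ι) (p : s.Spinor) : Fin 2 → ℂ := (s.core.localTriv i p).2

lemma coord_eq (i : ι) (p : s.Spinor) :
    s.coord i p = s.spinorChange (s.indexAt p.1) i p.1 *ᵥ p.2 := rfl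

/-! #### The projectivised spinor bundle `ℙ(𝕊')` as a smooth manifold -/

/-- The total space of `ℙ(𝕊')`: points of `X` together with a complex line in the fibre. -/
structure ProjSpinor where
  pt : X
  line : ℙ ℂ (s.core.Fiber pt)

/-- The vector with `a`-th component `1` and other component `w`. -/
def affineVec (a : Fin 2) (w : ℂ) : Fin 2 → ℂ := fun b => if b = a then 1 else w

lemma affineVec_ne_zero (a : Fin 2) (w : ℂ) : affineVec a w ≠ 0 := fun h => by
  have := congrFun h a
  simp [affineVec] at this

/-- Homogeneous coordinates of a line in the trivialisation `i`. -/
def lineCoord (i : ι) (q : s.ProjSpinor) : Fin 2 → ℂ := s.coord i ⟨q.pt, q.line.rep⟩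

/-- The line over `x` spanned by the spinor with coordinates `z` in the trivialisation `i`. -/
def lineAt (i : ι) (x : X) (z : Fin 2 → ℂ) (hz : z ≠ 0) : s.ProjSpinor :=
  ⟨x, Projectivization.mk ℂ (s.spinorChange i (s.indexAt x) x *ᵥ z : Fin 2 → ℂ)
    (rhoMinus_mulVec_ne_zero _ hz)⟩

lemma lineCoord_lineAt (i j : ι) (x : X) (hi : x ∈ s.baseSet i) (hj : x ∈ s.baseSet j)
    (z : Fin 2 → ℂ) (hz : z ≠ 0) :
    ∃ c : ℂ, c ≠ 0 ∧ s.lineCoord j (s.lineAt i x z hz) = c • (s.spinorChange i j x *ᵥ z) := by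
  obtain ⟨c, hc⟩ := Projectivization.exists_smul_eq_mk_rep ℂ
    (s.spinorChange i (s.indexAt x) x *ᵥ z : Fin 2 → ℂ) (rhoMinus_mulVec_ne_zero _ hz)
  refine ⟨c, c.ne_zero, ?_⟩
  change s.spinorChange (s.indexAt x) j x *ᵥ
    (Projectivization.mk ℂ (s.spinorChange i (s.indexAt x) x *ᵥ z : Fin 2 → ℂ) _).rep = _
  rw [← hc, Units.smul_def, Matrix.mulVec_smul, Matrix.mulVec_mulVec,
    s.spinorChange_comp i (s.indexAt x) j x ⟨⟨hi, s.mem_baseSet_at x⟩, hj⟩]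

lemma lineAt_lineCoord (i : ι) (q : s.ProjSpinor) (hi : q.pt ∈ s.baseSet i) (z : Fin 2 → ℂ)
    (hz : z ≠ 0) (c : ℂ) (h : c • s.lineCoord i q = z) : s.lineAt i q.pt z hz = q := by
  obtain ⟨x, l⟩ := q
  refine congrArg (ProjSpinor.mk x) ?_
  conv_rhs => rw [← l.mk_rep]
  refine (Projectivization.mk_eq_mk_iff' ℂ _ _ _ _).2 ⟨c, ?_⟩
  change c • (l.rep : Fin 2 → ℂ) = _
  rw [← h, Matrix.mulVec_smul]
  congr 1
  have key (v : Fin 2 → ℂ) :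
      v = s.spinorChange i (s.indexAt x) x *ᵥ (s.spinorChange (s.indexAt x) i x *ᵥ v) := by
    rw [Matrix.mulVec_mulVec,
      s.spinorChange_comp (s.indexAt x) i (s.indexAt x) x
        ⟨⟨s.mem_baseSet_at x, hi⟩, s.mem_baseSet_at x⟩,
      spinorChange, s.transition_self _ x (s.mem_baseSet_at x), rhoMinus_one, Matrix.one_mulVec]
  exact key l.rep

/-- The chart `(x, [z]) ↦ (φ x, z_{a'} / z_a)` of `ℙ(𝕊')`, for `φ` the chart of `X` at `x₀`, `z` the
homogeneous coordinates in the trivialisation `i`, and `{a, a'} = {0, 1}`. -/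
def projChart (i : ι) (x₀ : X) (a : Fin 2) : PartialEquiv s.ProjSpinor (ModelProd E4 ℂ) where
  toFun q := (chartAt E4 x₀ q.pt, s.lineCoord i q a.rev / s.lineCoord i q a)
  invFun u := s.lineAt i ((chartAt E4 x₀).symm u.1) (affineVec a u.2) (affineVec_ne_zero a u.2)
  source := {q | q.pt ∈ (chartAt E4 x₀).source ∩ s.baseSet i ∧ s.lineCoord i q a ≠ 0}
  target := {u | u.1 ∈ (chartAt E4 x₀).target ∧ (chartAt E4 x₀).symm u.1 ∈ s.baseSet i}
  map_source' q hq := by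
    refine ⟨(chartAt E4 x₀).map_source hq.1.1, ?_⟩
    change (chartAt E4 x₀).symm (chartAt E4 x₀ q.pt) ∈ _
    rw [(chartAt E4 x₀).left_inv hq.1.1]
    exact hq.1.2
  map_target' u hu := by
    obtain ⟨c, hc, h⟩ := s.lineCoord_lineAt i i _ hu.2 hu.2 _ (affineVec_ne_zero a u.2)
    refine ⟨⟨(chartAt E4 x₀).map_target hu.1, hu.2⟩, ?_⟩
    rw [h, spinorChange, s.transition_self _ _ hu.2, rhoMinus_one, Matrix.one_mulVec]
    simp [affineVec, hc]
  left_inv' q hq := by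
    have h := (chartAt E4 x₀).left_inv hq.1.1
    dsimp only
    simp only [h]
    refine s.lineAt_lineCoord i q hq.1.2 _ _ (s.lineCoord i q a)⁻¹ ?_
    have h0 := hq.2
    ext b
    by_cases hb : b = a
    · subst hb
      simp [affineVec, h0]
    · have : b = a.rev := by
        revert hb
        fin_cases a <;> fin_cases b <;> simp
      subst this
      simp only [affineVec, if_neg hb, Pi.smul_apply, smul_eq_mul]
      rw [mul_comm, div_eq_mul_inv]
  right_inv' u hu := by
    obtain ⟨c, hc, h⟩ := s.lineCoord_lineAt i i _ hu.2 hu.2 _ (affineVec_ne_zero a u.2)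
    rw [spinorChange, s.transition_self _ _ hu.2, rhoMinus_one, Matrix.one_mulVec] at h
    refine Prod.ext ((chartAt E4 x₀).right_inv hu.1) ?_
    dsimp only
    rw [h]
    have : a.rev ≠ a := by fin_cases a <;> simp
    simp [affineVec, hc, this]

/-- The coordinate change from `projChart i x₀ a` to `projChart j x₁ b`. -/
def projTrans (i j : ι) (x₀ x₁ : X) (a b : Fin 2) (u : E4 × ℂ) : E4 × ℂ :=
  let z := s.spinorChange i j ((chartAt E4 x₀).symm u.1) *ᵥ affineVec a u.2
  (chartAt E4 x₁ ((chartAt E4 x₀).symm u.1), z b.rev / z b)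

lemma projTrans_source (i j : ι) (x₀ x₁ : X) (a b : Fin 2) :
    ((s.projChart i x₀ a).symm.trans (s.projChart j x₁ b)).source =
      {u : E4 × ℂ | (u.1 ∈ (chartAt E4 x₀).target ∧
        (chartAt E4 x₀).symm u.1 ∈ (s.baseSet i ∩ s.baseSet j) ∩ (chartAt E4 x₁).source) ∧
        (s.spinorChange i j ((chartAt E4 x₀).symm u.1) *ᵥ affineVec a u.2) b ≠ 0} := by
  ext u
  rw [PartialEquiv.trans_source]
  constructor
  · rintro ⟨⟨h1, h2⟩, ⟨h3, h4⟩, h5⟩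
    obtain ⟨c, hc, h⟩ := s.lineCoord_lineAt i j _ h2 h4 _ (affineVec_ne_zero a u.2)
    refine ⟨⟨h1, ⟨h2, h4⟩, h3⟩, fun h0 => h5 ?_⟩
    change s.lineCoord j (s.lineAt i _ _ (affineVec_ne_zero a u.2)) b = 0
    rw [h, Pi.smul_apply, h0, smul_zero]
  · rintro ⟨⟨h1, ⟨h2, h4⟩, h3⟩, h5⟩
    obtain ⟨c, hc, h⟩ := s.lineCoord_lineAt i j _ h2 h4 _ (affineVec_ne_zero a u.2)
    refine ⟨⟨h1, h2⟩, ⟨h3, h4⟩, ?_⟩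
    change s.lineCoord j (s.lineAt i _ _ (affineVec_ne_zero a u.2)) b ≠ 0
    rw [h, Pi.smul_apply]
    exact smul_ne_zero hc h5

lemma projTrans_eqOn (i j : ι) (x₀ x₁ : X) (a b : Fin 2) :
    EqOn ((s.projChart i x₀ a).symm.trans (s.projChart j x₁ b)) (s.projTrans i j x₀ x₁ a b)
      ((s.projChart i x₀ a).symm.trans (s.projChart j x₁ b)).source := by
  intro u hu
  rw [projTrans_source] at hu
  obtain ⟨⟨h1, ⟨h2, h4⟩, h3⟩, h5⟩ := hu
  obtain ⟨c, hc, h⟩ := s.lineCoord_lineAt i j _ h2 h4 _ (affineVec_ne_zero a u.2)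
  refine Prod.ext rfl ?_
  change s.lineCoord j (s.lineAt i _ _ (affineVec_ne_zero a u.2)) b.rev / s.lineCoord j (s.lineAt i _ _ (affineVec_ne_zero a u.2)) b = _
  rw [h, Pi.smul_apply, Pi.smul_apply, smul_eq_mul, smul_eq_mul, mul_div_mul_left _ _ hc]
  rfl

lemma isOpen_chart_dom (i j : ι) (x₀ x₁ : X) : IsOpen {y : E4 | y ∈ (chartAt E4 x₀).target ∧
    (chartAt E4 x₀).symm y ∈ (s.baseSet i ∩ s.baseSet j) ∩ (chartAt E4 x₁).source} :=
  (chartAt E4 x₀).isOpen_inter_preimage_symm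
    (((s.isOpen_baseSet i).inter (s.isOpen_baseSet j)).inter (chartAt E4 x₁).open_source)

lemma contDiffOn_projVec (i j : ι) (x₀ x₁ : X) (a b : Fin 2) :
    ContDiffOn ℝ ∞ (fun u : E4 × ℂ =>
      (s.spinorChange i j ((chartAt E4 x₀).symm u.1) *ᵥ affineVec a u.2) b)
      {u : E4 × ℂ | u.1 ∈ {y : E4 | y ∈ (chartAt E4 x₀).target ∧
        (chartAt E4 x₀).symm y ∈ (s.baseSet i ∩ s.baseSet j) ∩ (chartAt E4 x₁).source}} := by
  have h1 (A B : Fin 2) : ContDiffOn ℝ ∞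
      (fun y : E4 => s.spinorChange i j ((chartAt E4 x₀).symm y) A B)
      {y : E4 | y ∈ (chartAt E4 x₀).target ∧
        (chartAt E4 x₀).symm y ∈ (s.baseSet i ∩ s.baseSet j) ∩ (chartAt E4 x₁).source} := by
    rw [← contMDiffOn_iff_contDiffOn]
    exact (s.smooth_spinorChange i j A B).comp
      ((contMDiffOn_chart_symm (I := 𝓡 4) (x := x₀)).mono fun y hy => hy.1) fun y hy => hy.2.1
  have h2 (A B : Fin 2) : ContDiffOn ℝ ∞
      (fun u : E4 × ℂ => s.spinorChange i j ((chartAt E4 x₀).symm u.1) A B)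
      {u : E4 × ℂ | u.1 ∈ {y : E4 | y ∈ (chartAt E4 x₀).target ∧
        (chartAt E4 x₀).symm y ∈ (s.baseSet i ∩ s.baseSet j) ∩ (chartAt E4 x₁).source}} :=
    (h1 A B).comp contDiff_fst.contDiffOn fun u hu => hu
  have h3 (B : Fin 2) : ContDiff ℝ ∞ (fun u : E4 × ℂ => affineVec a u.2 B) := by
    by_cases h : B = a
    · simpa [affineVec, h] using contDiff_const
    · simpa [affineVec, h] using contDiff_snd
  simp only [Matrix.mulVec, dotProduct]
  exact ContDiffOn.sum fun B _ => (h2 b B).mul (h3 B).contDiffOn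

lemma isOpen_projTrans_source (i j : ι) (x₀ x₁ : X) (a b : Fin 2) :
    IsOpen (X := E4 × ℂ) ((s.projChart i x₀ a).symm.trans (s.projChart j x₁ b)).source := by
  rw [projTrans_source]
  exact (s.contDiffOn_projVec i j x₀ x₁ a b).continuousOn.isOpen_inter_preimage
    ((s.isOpen_chart_dom i j x₀ x₁).preimage continuous_fst) isOpen_ne

lemma contDiffOn_projTrans (i j : ι) (x₀ x₁ : X) (a b : Fin 2) :
    ContDiffOn ℝ ∞ (s.projTrans i j x₀ x₁ a b)
      ((s.projChart i x₀ a).symm.trans (s.projChart j x₁ b)).source := by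
  rw [projTrans_source]
  refine ContDiffOn.prodMk ?_ ?_
  · have h1 : ContDiffOn ℝ ∞ (fun y : E4 => chartAt E4 x₁ ((chartAt E4 x₀).symm y))
        {y : E4 | y ∈ (chartAt E4 x₀).target ∧
        (chartAt E4 x₀).symm y ∈ (s.baseSet i ∩ s.baseSet j) ∩ (chartAt E4 x₁).source} := by
      rw [← contMDiffOn_iff_contDiffOn]
      exact (contMDiffOn_chart (I := 𝓡 4) (x := x₁)).comp
        ((contMDiffOn_chart_symm (I := 𝓡 4) (x := x₀)).mono fun y hy => hy.1) fun y hy => hy.2.2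
    exact h1.comp contDiff_fst.contDiffOn fun u hu => hu.1
  · have h (c : Fin 2) := (s.contDiffOn_projVec i j x₀ x₁ a c).mono
      (t := {u : E4 × ℂ | (u.1 ∈ (chartAt E4 x₀).target ∧
        (chartAt E4 x₀).symm u.1 ∈ (s.baseSet i ∩ s.baseSet j) ∩ (chartAt E4 x₁).source) ∧
        (s.spinorChange i j ((chartAt E4 x₀).symm u.1) *ᵥ affineVec a u.2) b ≠ 0})
      fun u hu => hu.1
    simp only [div_eq_mul_inv]
    exact (h b.rev).mul ((h b).inv fun u hu => hu.2)

/-- An affine coordinate that does not vanish on the line `q`. -/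
def affineIdx (q : s.ProjSpinor) : Fin 2 :=
  if s.lineCoord (s.indexAt q.pt) q 0 ≠ 0 then 0 else 1

lemma lineCoord_affineIdx_ne_zero (q : s.ProjSpinor) :
    s.lineCoord (s.indexAt q.pt) q (s.affineIdx q) ≠ 0 := by
  by_cases h : s.lineCoord (s.indexAt q.pt) q 0 = 0
  · rw [affineIdx, if_neg (not_not.2 h)]
    intro h1
    have : s.lineCoord (s.indexAt q.pt) q = 0 := by
      ext b
      fin_cases b
      · exact h
      · exact h1
    exact rhoMinus_mulVec_ne_zero _ q.line.rep_nonzero this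
  · rwa [affineIdx, if_pos h]

/-- The atlas of `ℙ(𝕊')`. -/
def projCore : ChartedSpaceCore (ModelProd E4 ℂ) s.ProjSpinor where
  atlas := {e | ∃ i x₀ a, e = s.projChart i x₀ a}
  chartAt q := s.projChart (s.indexAt q.pt) q.pt (s.affineIdx q)
  mem_chart_source q := ⟨⟨mem_chart_source E4 q.pt, s.mem_baseSet_at q.pt⟩,
    s.lineCoord_affineIdx_ne_zero q⟩
  chart_mem_atlas q := ⟨_, _, _, rfl⟩
  open_source := by
    rintro _ _ ⟨i, x₀, a, rfl⟩ ⟨j, x₁, b, rfl⟩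
    exact s.isOpen_projTrans_source i j x₀ x₁ a b
  continuousOn_toFun := by
    rintro _ _ ⟨i, x₀, a, rfl⟩ ⟨j, x₁, b, rfl⟩
    exact (s.contDiffOn_projTrans i j x₀ x₁ a b).continuousOn.congr
      (s.projTrans_eqOn i j x₀ x₁ a b)

instance : TopologicalSpace s.ProjSpinor := s.projCore.toTopologicalSpace

instance : ChartedSpace (ModelProd E4 ℂ) s.ProjSpinor := s.projCore.toChartedSpace

/-- The model of `ℙ(𝕊')`, on `ℝ⁴ × ℂ`. -/
abbrev modelP : ModelWithCorners ℝ (E4 × ℂ) (ModelProd E4 ℂ) := (𝓡 4).prod 𝓘(ℝ, ℂ)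

instance : IsManifold modelP ∞ s.ProjSpinor := by
  apply isManifold_of_contDiffOn
  rintro e e' he he'
  obtain ⟨_, ⟨i, x₀, a, rfl⟩, rfl⟩ := mem_iUnion₂.1 he
  obtain ⟨_, ⟨j, x₁, b, rfl⟩, rfl⟩ := mem_iUnion₂.1 he'
  have h := (s.contDiffOn_projTrans i j x₀ x₁ a b).congr (s.projTrans_eqOn i j x₀ x₁ a b)
  refine h.mono ?_
  rintro u ⟨hu, -⟩
  exact hu

/-! #### The induced connection on `𝕊'`, the form `τ̃`, and the complex structures -/

/-- The matrices `Γ_a` of the connection on `𝕊'` in the trivialisation `i`: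
`∇_{e_a} z = e_a(z) + Γ_a z`. It is induced by the Levi-Civita connection, whose connection matrix
`∇_{e_a} e_b = ω^c_b(e_a) e_c` is lifted to `su(2) ⊕ su(2)`, and `(α, β)` acts by `conj β`. -/
def spinConn (i : ι) (a : Fin 4) (x : X) : Matrix (Fin 2) (Fin 2) ℂ :=
  (so4ToSu2 (Matrix.of fun c b => s.leviCivita i a b c x)).map star

/-- The dual coframe `θ^a`. -/
def coframe (i : ι) (a : Fin 4) (x : X) : TangentSpace (𝓡 4) x →L[ℝ] ℝ :=
  g.inner x (s.frame i a x)

/-- The differential at `p` of the projection `𝕊' → X`. -/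
def dBase (p : s.Spinor) : TangentSpace modelS p →L[ℝ] TangentSpace (𝓡 4) p.1 :=
  mfderiv modelS (𝓡 4) (fun r : s.Spinor => r.1) p

/-- The differential `d z` at `p` of the fibre coordinates of the preferred trivialisation. -/
def dFibre (p : s.Spinor) : TangentSpace modelS p →L[ℝ] (Fin 2 → ℂ) :=
  mfderiv modelS 𝓘(ℝ, Fin 2 → ℂ) (fun r : s.Spinor => s.coord (s.indexAt p.1) r) p

lemma extChartAt_symm_near (p : s.Spinor) :
    ∀ᶠ u in nhds (extChartAt modelS p p),
      (extChartAt (𝓡 4) p.1 ((extChartAt modelS p).symm u).1, s.coord (s.indexAt p.1)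
        ((extChartAt modelS p).symm u)) = u := by
  have h : ∀ᶠ u in nhds (extChartAt modelS p p), u ∈ (extChartAt modelS p).target :=
    extChartAt_target_mem_nhds p
  filter_upwards [h] with u hu
  have h1 := (extChartAt modelS p).right_inv hu
  conv_rhs => rw [← h1]
  have h2 := (extChartAt modelS p).map_target hu
  rw [FiberBundle.extChartAt] at h1 h2 ⊢
  rfl

lemma dBase_apply (p : s.Spinor) (v : E4 × (Fin 2 → ℂ)) : s.dBase p v = v.1 := by
  have h : MDifferentiableAt modelS (𝓡 4) (fun r : s.Spinor => r.1) p :=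
    mdifferentiableAt_proj s.core.Fiber
  have h1 : (writtenInExtChartAt modelS (𝓡 4) p (fun r : s.Spinor => r.1)) =ᶠ[
      nhds (extChartAt modelS p p)] Prod.fst := by
    filter_upwards [s.extChartAt_symm_near p] with u hu
    exact congrArg Prod.fst hu
  rw [dBase, h.mfderiv, ModelWithCorners.range_eq_univ, fderivWithin_univ, h1.fderiv_eq]
  rw [fderiv_fst]
  rfl

lemma dFibre_apply (p : s.Spinor) (v : E4 × (Fin 2 → ℂ)) : s.dFibre p v = v.2 := by
  have h : MDifferentiableAt modelS 𝓘(ℝ, Fin 2 → ℂ)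
      (fun r : s.Spinor => s.coord (s.indexAt p.1) r) p := by
    have h0 : ContMDiffAt modelS modelS ∞ (trivializationAt (Fin 2 → ℂ) s.core.Fiber p.1) p :=
      Trivialization.contMDiffOn (n := ∞) _ |>.contMDiffAt
        ((trivializationAt (Fin 2 → ℂ) s.core.Fiber p.1).open_source.mem_nhds
          (FiberBundle.mem_trivializationAt_proj_source))
    exact (contMDiffAt_snd.comp p h0).mdifferentiableAt (by simp)
  have h1 : (writtenInExtChartAt modelS 𝓘(ℝ, Fin 2 → ℂ) p
      (fun r : s.Spinor => s.coord (s.indexAt p.1) r)) =ᶠ[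
      nhds (extChartAt modelS p p)] Prod.snd := by
    filter_upwards [s.extChartAt_symm_near p] with u hu
    exact congrArg Prod.snd hu
  rw [dFibre, h.mfderiv, ModelWithCorners.range_eq_univ, fderivWithin_univ, h1.fderiv_eq]
  rw [fderiv_snd]
  rfl

/-- `Γ(v) z`, for `v` a tangent vector of `X`. -/
def connTerm (x : X) (z : Fin 2 → ℂ) : TangentSpace (𝓡 4) x →L[ℝ] (Fin 2 → ℂ) :=
  ∑ a, (s.coframe (s.indexAt x) a x).smulRight (s.spinConn (s.indexAt x) a x *ᵥ z)

/-- The forms `δπ^{A'} = dπ^{A'} + Γ_{cB'}^{A'} π^{B'} θ^c`. -/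
def deltaPi (p : s.Spinor) : TangentSpace modelS p →L[ℝ] (Fin 2 → ℂ) :=
  s.dFibre p + (s.connTerm p.1 p.2).comp (s.dBase p)

/-- The `1`-form `τ̃ = ε_{A'B'} π^{A'} δπ^{B'}` on `𝕊'`. -/
def tau (p : s.Spinor) : TangentSpace modelS p [⋀^Fin 1]→L[ℝ] ℂ :=
  ContinuousAlternatingMap.ofSubsingleton ℝ (TangentSpace modelS p) ℂ (0 : Fin 1)
    (∑ A, ∑ B, (eps A B * p.2 A) •
      (ContinuousLinearMap.proj (R := ℝ) (φ := fun _ : Fin 2 => ℂ) B).comp (s.deltaPi p))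

/-- The `3`-form `τ̃ ∧ dτ̃` on `𝕊'`. -/
def tauDTau (p : s.Spinor) : TangentSpace modelS p [⋀^Fin 3]→L[ℝ] ℂ :=
  DiffForm.wedge₁₂ (V := E4 × (Fin 2 → ℂ)) (s.tau p) (DiffForm.d modelS s.tau p)

/-- The complex structure `v^{AA'} ↦ v^{AB'} I_{B'}^{A'}` of `T_x X` given by `π = z`. -/
def baseAcs (x : X) (z : Fin 2 → ℂ) : TangentSpace (𝓡 4) x →L[ℝ] TangentSpace (𝓡 4) x :=
  ∑ a, ∑ b, coeff a b (fun Y => Y * acsMatrix z) •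
    (s.coframe (s.indexAt x) b x).smulRight (s.frame (s.indexAt x) a x)

/-- The almost complex structure `𝕀 = I_π ⊕ i` on `𝕊' ∖ 0`. A tangent vector of `𝕊'` at `p` is
the pair of its components `dBase p` and `dFibre p`; the definition says `dBase p (𝕀 v) = I_π (dBase p v)`
and `δπ (𝕀 v) = i δπ v`. -/
def acs (p : s.Spinor) : TangentSpace modelS p →L[ℝ] TangentSpace modelS p :=
  ContinuousLinearMap.prod (M₂ := E4) (M₃ := Fin 2 → ℂ)
    ((s.baseAcs p.1 p.2).comp (s.dBase p))
    (Complex.I • s.deltaPi p - (s.connTerm p.1 p.2).comp ((s.baseAcs p.1 p.2).comp (s.dBase p)))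

lemma dBase_acs (p : s.Spinor) (v : TangentSpace modelS p) :
    s.dBase p (s.acs p v) = s.baseAcs p.1 p.2 (s.dBase p v) :=
  s.dBase_apply p _

lemma deltaPi_acs (p : s.Spinor) (v : TangentSpace modelS p) :
    s.deltaPi p (s.acs p v) = Complex.I • s.deltaPi p v := by
  have h1 : s.dFibre p (s.acs p v) = Complex.I • s.deltaPi p v -
      s.connTerm p.1 p.2 (s.baseAcs p.1 p.2 (s.dBase p v)) := s.dFibre_apply p _
  have h2 := s.dBase_acs p v
  change s.dFibre p (s.acs p v) + s.connTerm p.1 p.2 (s.dBase p (s.acs p v)) = _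
  rw [h1, h2, sub_add_cancel]

/-- The projection `𝕊' ∖ 0 → ℙ(𝕊')`, with an irrelevant value on the zero section. -/
def toProj (p : s.Spinor) : s.ProjSpinor := by
  classical
  exact if h : p.2 ≠ 0 then ⟨p.1, Projectivization.mk ℂ p.2 h⟩ else
    ⟨p.1, Projectivization.mk ℂ (affineVec 0 0 : Fin 2 → ℂ) (affineVec_ne_zero 0 0)⟩

/-- The local section of `𝕊' ∖ 0 → ℙ(𝕊')` given by the spinors whose `a`-th coordinate in the
trivialisation `i` is `1`. -/
def affineLift (i : ι) (a : Fin 2) (q : s.ProjSpinor) : s.Spinor :=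
  ⟨q.pt, (s.lineCoord i q a)⁻¹ • q.line.rep⟩

/-- The almost complex structure on `ℙ(𝕊')` induced by `𝕀`: it maps `dp (V)` to `dp (𝕀 V)`, for `p`
the projection `𝕊' ∖ 0 → ℙ(𝕊')`; here `V` is the lift by a local section of `p`. -/
def projAcs (q : s.ProjSpinor) : TangentSpace modelP q →L[ℝ] TangentSpace modelP q :=
  let f := s.affineLift (s.indexAt q.pt) (s.affineIdx q)
  (mfderiv modelS modelP s.toProj (f q)).comp ((s.acs (f q)).comp (mfderiv modelP modelS f q))

/-- The fibre at `q` of the tautological line bundle over `ℙ(𝕊')`; without its zero section, this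
bundle is `𝕊' ∖ 0`. -/
abbrev taut (q : s.ProjSpinor) : Submodule ℂ (s.core.Fiber q.pt) := q.line.submodule

/-- The fibre at `q` of the canonical bundle of `ℙ(𝕊')`: the forms of type `(3, 0)`. -/
abbrev canonical (q : s.ProjSpinor) : Submodule ℂ (TangentSpace modelP q [⋀^Fin 3]→L[ℝ] ℂ) :=
  DiffForm.typeK0 (s.projAcs q) 3

/-! #### Line bundles over `ℙ(𝕊')` -/

/-- A section `σ` of the tautological bundle as a map `ℙ(𝕊') → 𝕊'`. -/
def sectionMap (σ : ∀ q : s.ProjSpinor, s.taut q) (q : s.ProjSpinor) : s.Spinor :=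
  ⟨q.pt, (σ q : s.core.Fiber q.pt)⟩

/-- `∂̄ σ = 0` at `q`: the differential of `σ` at `q` is complex linear. -/
def TautDbarZeroAt (σ : ∀ q : s.ProjSpinor, s.taut q) (q : s.ProjSpinor) : Prop :=
  ∀ v : TangentSpace modelP q,
    mfderiv modelP modelS (s.sectionMap σ) q (s.projAcs q v) =
      s.acs (s.sectionMap σ q) (mfderiv modelP modelS (s.sectionMap σ) q v)

/-- `∂̄ α = 0` at `q` for a section `α` of the canonical bundle: as `dα = ∂α + ∂̄α` with `∂α` of
type `(4, 0)` and `∂̄α` of type `(3, 1)`, this says that `dα` is of type `(4, 0)`. -/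
def CanonicalDbarZeroAt (α : ∀ q : s.ProjSpinor, s.canonical q) (q : s.ProjSpinor) : Prop :=
  DiffForm.IsTypeK0 (s.projAcs q)
    (DiffForm.d modelP
      (fun r : s.ProjSpinor => (α r : TangentSpace modelP r [⋀^Fin 3]→L[ℝ] ℂ)) q)

/-- The value `ψ (v ⊗ v ⊗ v ⊗ v)`. -/
def quartic {q : s.ProjSpinor} (ψ : (⨂[ℂ]^4 (s.taut q)) →ₗ[ℂ] s.canonical q) (v : s.taut q) :
    s.canonical q :=
  ψ (PiTensorProduct.tprod ℂ fun _ : Fin 4 => v)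

/-- The fibrewise linear maps `ψ q` form a holomorphic isomorphism from the fourth tensor power of
the tautological bundle onto the canonical bundle: they are bijective, and for a smooth local
section `σ` of `𝕊' ∖ 0` over an open set `U`, the section `ψ (σ⊗⁴)` of the canonical bundle is smooth
and has `∂̄ ψ (σ⊗⁴) = 0` exactly at the points where `∂̄ σ = 0`. -/
structure IsHolomorphicIso
    (ψ : ∀ q : s.ProjSpinor, (⨂[ℂ]^4 (s.taut q)) →ₗ[ℂ] s.canonical q) : Prop where
  bijective : ∀ q, Function.Bijective (ψ q)
  smooth : ∀ (U : Set s.ProjSpinor) (σ : ∀ q : s.ProjSpinor, s.taut q), IsOpen U →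
    (∀ q ∈ U, σ q ≠ 0) → ContMDiffOn modelP modelS ∞ (s.sectionMap σ) U →
    ∀ q ∈ U, DiffForm.SmoothAt modelP (fun r : s.ProjSpinor =>
      (s.quartic (ψ r) (σ r) : TangentSpace modelP r [⋀^Fin 3]→L[ℝ] ℂ)) q
  dbar_iff : ∀ (U : Set s.ProjSpinor) (σ : ∀ q : s.ProjSpinor, s.taut q), IsOpen U →
    (∀ q ∈ U, σ q ≠ 0) → ContMDiffOn modelP modelS ∞ (s.sectionMap σ) U →
    ∀ q ∈ U, s.CanonicalDbarZeroAt (fun r => s.quartic (ψ r) (σ r)) q ↔ s.TautDbarZeroAt σ q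

/-- The linear map `(𝕊'_q)⊗⁴ → K_q` given by an element of `(𝕊'_q)⊗⁻⁴ ⊗ K_q`. -/
def toHom {q : s.ProjSpinor}
    (κ : Module.Dual ℂ (⨂[ℂ]^4 (s.taut q)) ⊗[ℂ] s.canonical q) :
    (⨂[ℂ]^4 (s.taut q)) →ₗ[ℂ] s.canonical q :=
  dualTensorHom ℂ (⨂[ℂ]^4 (s.taut q)) (s.canonical q) κ

/-- The `3`-form `τ̃ ∧ dτ̃` on `𝕊' ∖ 0` descends to the section `κ` of `(𝕊')⊗⁻⁴ ⊗ K` over `ℙ(𝕊')`: at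
each nonzero spinor `v` over `q`, it is the pullback of `κ q (v ⊗ v ⊗ v ⊗ v)` by the projection. -/
def DescendsTo
    (κ : ∀ q : s.ProjSpinor, Module.Dual ℂ (⨂[ℂ]^4 (s.taut q)) ⊗[ℂ] s.canonical q) : Prop :=
  ∀ (q : s.ProjSpinor) (v : s.taut q), v ≠ 0 →
    let p : s.Spinor := ⟨q.pt, (v : s.core.Fiber q.pt)⟩
    let dproj : TangentSpace modelS p →L[ℝ] TangentSpace modelP q :=
      mfderiv modelS modelP s.toProj p
    s.tauDTau p = ((s.quartic (s.toHom (κ q)) v :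
      TangentSpace modelP q [⋀^Fin 3]→L[ℝ] ℂ)).compContinuousLinearMap dproj

end SpinStructure

end

/-! Write η for the 𝕊-valued form `eta` obtained by contracting the soldering form with π. The
curvature of 𝕊' contracted twice with π is made of the self-dual Weyl tensor, the trace-free Ricci
tensor and the scalar curvature. The first vanishes by anti self-duality and the second by the
Einstein condition, so `d_tau_apply` gives dτ̃(V, W) = 2ε(δπ V, δπ W) + Λ ε(η V, η W). As δπ has
only two components and τ̃ = ε(π, δπ), the first term dies in the wedge product with τ̃, and τ̃ ∧
dτ̃ involves only τ̃ and η, with the factor Λ (`tauDTau_apply`). It is nonzero because τ̃, η⁰, η¹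
are independent and Λ ≠ 0.

Both δπ and η are complex linear for 𝕀. Hence τ̃ ∧ dτ̃ has type (3,0) and its differential dτ̃ ∧ dτ̃
has type (4,0); integrability of 𝕀 is never needed. The form τ̃ ∧ dτ̃ is killed by the vertical
vectors lπ and has degree 4 under dilations, even with a variable factor (`tautForm_smul`). So its
pullback by a local section σ of L depends at q only on σ(q), through its fourth power
(`pullTau_dProj`, `pullTau_eq_smul`). This defines κ by means of an affine local section. Since
(3,0)-forms on a complex 3-space are multiples of the determinant (`IsTypeK0.exists_eq_smul`), κ is
bijective on fibres.

For the Cauchy-Riemann operators, κ(σ⊗⁴) = σ*(τ̃ ∧ dτ̃). As p ∘ σ = id and p is holomorphic, dσ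
commutes with the complex structures up to a vertical vector lπ (`dSection_projAcs`). Contracting
dτ̃ ∧ dτ̃ with lπ gives 4l τ̃ ∧ dτ̃ (`d_tauDTau_vertical`). The failure of d(κ(σ⊗⁴)) to be of type
(4,0) is therefore 4l times a nowhere-zero form, and it vanishes exactly when l = 0
(`isTypeK0_d_pullTau_iff`).

The forms and d are defined pointwise, in the trivialisation or chart preferred at each point. The
analytic work is to show that these choices do not matter: `spinConnAt_change` is the gauge law of
the induced connection and `inChart_d` the chart independence of d. The structure equations then
give the curvature. -/

noncomputable section

open scoped Topology

/-! ### Linear algebra of Spin(4), quaternionic matrices and spinors -/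

namespace Spin4

/-- The matrices in the real span of the `q a`. -/
def IsQuat (M : Matrix (Fin 2) (Fin 2) ℂ) : Prop :=
  M 1 1 = star (M 0 0) ∧ M 1 0 = -star (M 0 1)

lemma IsQuat.mul {M N : Matrix (Fin 2) (Fin 2) ℂ} (hM : IsQuat M) (hN : IsQuat N) :
    IsQuat (M * N) := by
  obtain ⟨h1, h2⟩ := hM
  obtain ⟨h3, h4⟩ := hN
  constructor
  · simp only [Matrix.mul_apply, Fin.sum_univ_two, h1, h2, h3, h4, star_add, star_mul', star_neg,
      star_star]
    ring
  · simp only [Matrix.mul_apply, Fin.sum_univ_two, h1, h2, h3, h4, star_add, star_mul', star_star]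
    ring

lemma isQuat_q (a : Fin 4) : IsQuat (q a) := by
  fin_cases a <;> simp [IsQuat, q]

lemma star_mul_self_su (u : specialUnitaryGroup (Fin 2) ℂ) :
    (u : Matrix (Fin 2) (Fin 2) ℂ)ᴴ * (u : Matrix (Fin 2) (Fin 2) ℂ) = 1 := by
  have h := (mem_specialUnitaryGroup_iff.1 u.2).1
  exact (mem_unitaryGroup_iff'.1 h)

lemma mul_star_self_su (u : specialUnitaryGroup (Fin 2) ℂ) :
    (u : Matrix (Fin 2) (Fin 2) ℂ) * (u : Matrix (Fin 2) (Fin 2) ℂ)ᴴ = 1 := by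
  have h := (mem_specialUnitaryGroup_iff.1 u.2).1
  exact (mem_unitaryGroup_iff.1 h)

lemma det_su (u : specialUnitaryGroup (Fin 2) ℂ) :
    (u : Matrix (Fin 2) (Fin 2) ℂ).det = 1 :=
  (mem_specialUnitaryGroup_iff.1 u.2).2

lemma coe_inv_su (u : specialUnitaryGroup (Fin 2) ℂ) :
    ((u⁻¹ : specialUnitaryGroup (Fin 2) ℂ) : Matrix (Fin 2) (Fin 2) ℂ) =
      (u : Matrix (Fin 2) (Fin 2) ℂ)ᴴ := rfl

lemma conjTranspose_su (u : specialUnitaryGroup (Fin 2) ℂ) :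
    (u : Matrix (Fin 2) (Fin 2) ℂ)ᴴ = (u : Matrix (Fin 2) (Fin 2) ℂ).adjugate := by
  have h1 : (u : Matrix (Fin 2) (Fin 2) ℂ) * (u : Matrix (Fin 2) (Fin 2) ℂ).adjugate = 1 := by
    rw [Matrix.mul_adjugate, det_su, one_smul]
  calc _ = (u : Matrix (Fin 2) (Fin 2) ℂ)ᴴ * ((u : Matrix (Fin 2) (Fin 2) ℂ) *
        (u : Matrix (Fin 2) (Fin 2) ℂ).adjugate) := by rw [h1, mul_one]
    _ = _ := by rw [← mul_assoc, star_mul_self_su, one_mul]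

lemma isQuat_su (u : specialUnitaryGroup (Fin 2) ℂ) : IsQuat (u : Matrix (Fin 2) (Fin 2) ℂ) := by
  have h := conjTranspose_su u
  have h0 := congrFun (congrFun h 0) 0
  have h1 := congrFun (congrFun h 1) 0
  simp only [conjTranspose_apply, adjugate_fin_two, of_apply, cons_val_zero, cons_val_one,
    cons_val', cons_val_fin_one] at h0 h1
  exact ⟨h0.symm, by rw [h1, neg_neg]⟩

/-- The `q a` are orthonormal for ½ Re tr(XᴴY), so this is the expansion in that basis. It holds
only on their real span, whence `IsQuat`. -/
lemma IsQuat.sum_coeff {M : Matrix (Fin 2) (Fin 2) ℂ} (hM : IsQuat M) :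
    ∑ a, (((1 / 2) * (trace ((q a)ᴴ * M)).re : ℝ) : ℂ) • q a = M := by
  obtain ⟨h1, h2⟩ := hM
  ext A B
  fin_cases A <;> fin_cases B <;>
    simp [q, Fin.sum_univ_four, trace_fin_two, Matrix.mul_apply, h1, h2] <;>
    apply Complex.ext <;> simp <;> ring

lemma sum_toSO4_smul_q (u : Grp) (b : Fin 4) :
    ∑ a, ((toSO4 u a b : ℝ) : ℂ) • q a =
      (u.1 : Matrix (Fin 2) (Fin 2) ℂ) * q b * (u.2 : Matrix (Fin 2) (Fin 2) ℂ)ᴴ :=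
  (((isQuat_su u.1).mul (isQuat_q b)).mul (isQuat_su u.2⁻¹)).sum_coeff

/-- Orthogonality: for ½ Re tr(XᴴY) the adjoint of Y ↦ AYBᴴ is Y ↦ AᴴYB. -/
lemma toSO4_inv (u : Grp) (a b : Fin 4) : toSO4 u⁻¹ a b = toSO4 u b a := by
  simp only [toSO4, of_apply, coeff, Prod.fst_inv, Prod.snd_inv, inv_inv, coe_inv_su]
  congr 1
  rw [← Complex.conj_re, starRingEnd_apply, ← trace_conjTranspose]
  simp only [conjTranspose_mul, conjTranspose_conjTranspose]
  simp only [mul_assoc]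
  rw [trace_mul_comm (u.2 : Matrix (Fin 2) (Fin 2) ℂ)ᴴ]
  simp only [mul_assoc]

lemma sum_toSO4_smul_q' (u : Grp) (a : Fin 4) :
    ∑ b, ((toSO4 u a b : ℝ) : ℂ) • q b =
      (u.1 : Matrix (Fin 2) (Fin 2) ℂ)ᴴ * q a * (u.2 : Matrix (Fin 2) (Fin 2) ℂ) := by
  have h := sum_toSO4_smul_q u⁻¹ a
  simp only [toSO4_inv] at h
  rw [h]
  simp [coe_inv_su]

lemma so4ToSu2_eq (w : Matrix (Fin 4) (Fin 4) ℝ) :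
    so4ToSu2 w = (-(1 / 4) : ℂ) • ∑ b, ∑ c, ((w c b : ℝ) : ℂ) • ((q b)ᴴ * q c) := by
  simp only [so4ToSu2, Finset.mul_sum, Matrix.mul_smul]

/-- Inserting AAᴴ = 1 between `(q e)ᴴ` and `q d` turns the conjugate by B of their product into the
product of the rotated basis matrices. -/
lemma so4ToSu2_conj (u : Grp) (w : Matrix (Fin 4) (Fin 4) ℝ) :
    so4ToSu2 ((toSO4 u)ᵀ * w * toSO4 u) =
      (u.2 : Matrix (Fin 2) (Fin 2) ℂ)ᴴ * so4ToSu2 w * (u.2 : Matrix (Fin 2) (Fin 2) ℂ) := by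
  have h (d e : Fin 4) : (u.2 : Matrix (Fin 2) (Fin 2) ℂ)ᴴ * ((q e)ᴴ * q d) *
      (u.2 : Matrix (Fin 2) (Fin 2) ℂ) =
      (∑ b, ((toSO4 u e b : ℝ) : ℂ) • q b)ᴴ * ∑ c, ((toSO4 u d c : ℝ) : ℂ) • q c := by
    rw [sum_toSO4_smul_q', sum_toSO4_smul_q']
    simp only [conjTranspose_mul, conjTranspose_conjTranspose]
    calc _ = (u.2 : Matrix (Fin 2) (Fin 2) ℂ)ᴴ * (q e)ᴴ * 1 * q d *
          (u.2 : Matrix (Fin 2) (Fin 2) ℂ) := by simp only [mul_assoc, one_mul]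
      _ = _ := by
        rw [← mul_star_self_su u.1]
        simp only [mul_assoc]
  rw [so4ToSu2_eq, so4ToSu2_eq, Matrix.mul_smul, Matrix.smul_mul]
  congr 1
  simp only [Finset.mul_sum, Finset.sum_mul, Matrix.mul_smul, Matrix.smul_mul, h,
    conjTranspose_sum, conjTranspose_smul, Finset.smul_sum, smul_smul, Complex.star_def,
    Complex.conj_ofReal]
  simp only [Matrix.mul_apply, transpose_apply, Complex.ofReal_sum, Complex.ofReal_mul,
    Finset.sum_mul, Finset.sum_smul]
  calc _ = ∑ b, ∑ e, ∑ c, ∑ d, ((toSO4 u d c : ℂ) * (w d e : ℂ) * (toSO4 u e b : ℂ)) •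
        ((q b)ᴴ * q c) := by
        refine Finset.sum_congr rfl fun b _ => Finset.sum_comm
    _ = ∑ e, ∑ b, ∑ d, ∑ c, ((toSO4 u d c : ℂ) * (w d e : ℂ) * (toSO4 u e b : ℂ)) •
        ((q b)ᴴ * q c) := by
        rw [Finset.sum_comm]
        refine Finset.sum_congr rfl fun b _ => Finset.sum_congr rfl fun e _ => Finset.sum_comm
    _ = _ := by
        refine Finset.sum_congr rfl fun e _ => ?_
        rw [Finset.sum_comm]
        refine Finset.sum_congr rfl fun d _ => ?_
        rw [Finset.sum_comm]
        refine Finset.sum_congr rfl fun c _ => Finset.sum_congr rfl fun b _ => ?_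
        congr 1
        ring

/-- This averaging separates the two su(2) factors: a traceless α placed in the middle is sent to 0,
while the identity gives 4. -/
lemma sum_star_q_mul_mul (M : Matrix (Fin 2) (Fin 2) ℂ) :
    ∑ b, (q b)ᴴ * M * q b = (2 * trace M) • (1 : Matrix (Fin 2) (Fin 2) ℂ) := by
  ext A B
  fin_cases A <;> fin_cases B <;>
    simp [q, Fin.sum_univ_four, trace_fin_two, Matrix.mul_apply] <;> ring_nf <;>
    simp [Complex.I_sq] <;> ring

/-- The inhomogeneous term of the gauge law. `hg` is the derivative of R(q_b)B = A q_b; after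
multiplication by Aᴴ the A' part averages to zero by `hA`, and the B' part gets the factor
-(1/4)·(-4) = 1. -/
lemma so4ToSu2_transpose_mul_deriv (u : Grp) (g' : Matrix (Fin 4) (Fin 4) ℝ)
    (A' B' : Matrix (Fin 2) (Fin 2) ℂ)
    (hg : ∀ b, (∑ a, ((g' a b : ℝ) : ℂ) • q a) * (u.2 : Matrix (Fin 2) (Fin 2) ℂ) +
      (∑ a, ((toSO4 u a b : ℝ) : ℂ) • q a) * B' = A' * q b)
    (hA : trace ((u.1 : Matrix (Fin 2) (Fin 2) ℂ)ᴴ * A') = 0) :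
    so4ToSu2 ((toSO4 u)ᵀ * g') = (u.2 : Matrix (Fin 2) (Fin 2) ℂ)ᴴ * B' := by
  have h1 : so4ToSu2 ((toSO4 u)ᵀ * g') = (-(1 / 4) : ℂ) • ∑ b, (q b)ᴴ *
      ((u.1 : Matrix (Fin 2) (Fin 2) ℂ)ᴴ * ((∑ a, ((g' a b : ℝ) : ℂ) • q a) *
        (u.2 : Matrix (Fin 2) (Fin 2) ℂ))) := by
    rw [so4ToSu2]
    congr 1
    refine Finset.sum_congr rfl fun b _ => ?_
    congr 1
    simp only [Matrix.mul_apply, transpose_apply, Complex.ofReal_sum, Complex.ofReal_mul,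
      Finset.sum_smul]
    rw [Finset.sum_comm, Finset.sum_mul, Finset.mul_sum]
    refine Finset.sum_congr rfl fun d _ => ?_
    rw [Matrix.smul_mul, Matrix.mul_smul, ← mul_assoc, ← sum_toSO4_smul_q', Finset.smul_sum]
    refine Finset.sum_congr rfl fun c _ => ?_
    rw [smul_smul, mul_comm]
  have h2 (b : Fin 4) : (q b)ᴴ * ((u.1 : Matrix (Fin 2) (Fin 2) ℂ)ᴴ *
      ((∑ a, ((g' a b : ℝ) : ℂ) • q a) * (u.2 : Matrix (Fin 2) (Fin 2) ℂ))) =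
      (q b)ᴴ * ((u.1 : Matrix (Fin 2) (Fin 2) ℂ)ᴴ * A') * q b -
        (q b)ᴴ * 1 * q b * ((u.2 : Matrix (Fin 2) (Fin 2) ℂ)ᴴ * B') := by
    rw [eq_sub_of_add_eq (hg b), sum_toSO4_smul_q, ← star_mul_self_su u.1]
    simp only [mul_sub, mul_assoc]
  rw [h1]
  simp only [h2]
  rw [Finset.sum_sub_distrib, ← Finset.sum_mul, sum_star_q_mul_mul, sum_star_q_mul_mul, hA]
  simp only [trace_one, Fintype.card_fin]
  rw [mul_zero, zero_smul, zero_sub, smul_mul_assoc, one_mul, smul_neg, smul_smul, ← neg_smul]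
  norm_num

/-- Jacobi's formula: the hypothesis `h` is the derivative of det A = 1 along a curve with velocity
A'. -/
lemma trace_conjTranspose_mul_eq_zero {A : Matrix (Fin 2) (Fin 2) ℂ}
    (hA1 : Aᴴ = A.adjugate) {A' : Matrix (Fin 2) (Fin 2) ℂ}
    (h : A' 0 0 * A 1 1 + A 0 0 * A' 1 1 - (A' 0 1 * A 1 0 + A 0 1 * A' 1 0) = 0) :
    trace (Aᴴ * A') = 0 := by
  rw [hA1]
  simp [trace_fin_two, adjugate_fin_two, Matrix.vecMul, dotProduct]
  linear_combination h

/-- The three combinations are the self-dual components of w for the orientation with e₀₁₂₃ = -1, so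
the connection on 𝕊' sees only the self-dual part. -/
lemma so4ToSu2_of_skew {w : Matrix (Fin 4) (Fin 4) ℝ} (hw : ∀ a b, w a b = -w b a) :
    so4ToSu2 w = (((w 0 1 - w 2 3) / 2 : ℝ) : ℂ) • q 1 + (((w 0 2 + w 1 3) / 2 : ℝ) : ℂ) • q 2 +
      (((w 0 3 - w 1 2) / 2 : ℝ) : ℂ) • q 3 := by
  have hd (a : Fin 4) : w a a = 0 := by have := hw a a; linarith
  rw [so4ToSu2_eq]
  simp only [Fin.sum_univ_four, hd, hw 1 0, hw 2 0, hw 3 0, hw 2 1, hw 3 1, hw 3 2]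
  ext A B
  fin_cases A <;> fin_cases B <;>
    simp [q, Matrix.mul_apply] <;> ring

/-- The projection of so(4) = su(2) ⊕ su(2) onto an ideal is a homomorphism of Lie algebras; here it
is checked in components. -/
lemma so4ToSu2_commutator {v w : Matrix (Fin 4) (Fin 4) ℝ} (hv : ∀ a b, v a b = -v b a)
    (hw : ∀ a b, w a b = -w b a) :
    so4ToSu2 (v * w - w * v) = so4ToSu2 v * so4ToSu2 w - so4ToSu2 w * so4ToSu2 v := by
  have h (a b : Fin 4) : (v * w - w * v) a b = -(v * w - w * v) b a := by
    simp only [Matrix.sub_apply, Matrix.mul_apply]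
    rw [neg_sub, ← Finset.sum_sub_distrib, ← Finset.sum_sub_distrib]
    refine Finset.sum_congr rfl fun c _ => ?_
    rw [hv a c, hw c b, hw a c, hv c b]
    ring
  have hdv (a : Fin 4) : v a a = 0 := by have := hv a a; linarith
  have hdw (a : Fin 4) : w a a = 0 := by have := hw a a; linarith
  rw [so4ToSu2_of_skew h, so4ToSu2_of_skew hv, so4ToSu2_of_skew hw]
  simp only [Matrix.sub_apply, Matrix.mul_apply, Fin.sum_univ_four, hdv, hdw, hv 1 0, hv 2 0,
    hv 2 1, hv 3 1, hv 3 2, hw 1 0, hw 2 0, hw 2 1, hw 3 1, hw 3 2]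
  ext A B
  fin_cases A <;> fin_cases B <;>
    simp [q] <;> ring_nf <;> simp [Complex.I_sq] <;> ring

lemma trace_so4ToSu2_of_skew {w : Matrix (Fin 4) (Fin 4) ℝ} (hw : ∀ a b, w a b = -w b a) :
    trace (so4ToSu2 w) = 0 := by
  rw [so4ToSu2_of_skew hw]
  simp [q, trace_fin_two]

/-- The element `v^{AA'}` of `ℂ² ⊗ ℂ²` with real coordinates `v`, up to the factor `(√2)⁻¹`. -/
def quat (v : Fin 4 → ℝ) : Matrix (Fin 2) (Fin 2) ℂ := ∑ a, ((v a : ℝ) : ℂ) • q a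

/-- The contraction `v^{AA'} z_{A'}`, up to a factor. -/
def contract (z : Fin 2 → ℂ) (v : Fin 4 → ℝ) : Fin 2 → ℂ := quat v *ᵥ (eps *ᵥ z)

lemma skew_eq (z w : Fin 2 → ℂ) : skew z w = z 0 * w 1 - z 1 * w 0 := by
  simp [skew, eps, Fin.sum_univ_two]
  ring

/-- The part of constant curvature of the curvature of `𝕊'`, contracted with a spinor. -/
lemma skew_constCurvature (z : Fin 2 → ℂ) (v w : Fin 4 → ℝ) :
    2 * skew z ((so4ToSu2 (Matrix.of fun c d => v c * w d - v d * w c)).map star *ᵥ z) =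
      skew (contract z v) (contract z w) := by
  rw [so4ToSu2_of_skew (by intro a b; simp only [of_apply]; ring), skew_eq, skew_eq]
  simp [contract, quat, q, eps, Fin.sum_univ_four, Matrix.mulVec, dotProduct, map_ofNat]
  ring_nf
  simp [Complex.I_sq]
  ring

lemma normSq_eq (z : Fin 2 → ℂ) : normSq z = star (z 0) * z 0 + star (z 1) * z 1 := by
  simp [normSq, lower, sigma, eps, Fin.sum_univ_two]

lemma normSq_ne_zero {z : Fin 2 → ℂ} (hz : z ≠ 0) : normSq z ≠ 0 := by
  intro h
  apply hz
  have h1 : Complex.normSq (z 0) + Complex.normSq (z 1) = 0 := by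
    have : ((Complex.normSq (z 0) + Complex.normSq (z 1) : ℝ) : ℂ) = 0 := by
      rw [Complex.ofReal_add, Complex.normSq_eq_conj_mul_self, Complex.normSq_eq_conj_mul_self,
        ← h, normSq_eq]
      rfl
    exact_mod_cast this
  have h2 := Complex.normSq_nonneg (z 0)
  have h3 := Complex.normSq_nonneg (z 1)
  have h4 : z 0 = 0 := Complex.normSq_eq_zero.1 (by linarith)
  have h5 : z 1 = 0 := Complex.normSq_eq_zero.1 (by linarith)
  ext i
  fin_cases i
  · exact h4
  · exact h5

lemma contract_quat_surjective {z : Fin 2 → ℂ} (hz : z ≠ 0) (y : Fin 2 → ℂ) :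
    ∃ v, contract z v = y := by
  have hn : star (z 0) * z 0 + star (z 1) * z 1 ≠ 0 := by
    have h := normSq_ne_zero hz
    rwa [normSq_eq] at h
  set n := star (z 0) * z 0 + star (z 1) * z 1 with hn0
  have hns : star n = n := by simp [hn0]; ring
  -- M is n⁻¹ times the sum of y(εz)ᴴ, which sends εz to ny, and of the column (-ȳ₁, ȳ₀) times the
  -- row (z₀, z₁), which kills εz and makes M quaternionic.
  set M : Matrix (Fin 2) (Fin 2) ℂ := n⁻¹ • !![y 0 * star (z 1) - z 0 * star (y 1),
    - y 0 * star (z 0) - z 1 * star (y 1);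
    y 1 * star (z 1) + z 0 * star (y 0), - y 1 * star (z 0) + z 1 * star (y 0)] with hM
  have hq : IsQuat M := by
    have hns' := hns
    rw [Complex.star_def] at hns'
    constructor
    · simp [hM, hns']
      exact Or.inl (by ring)
    · simp [hM, hns']
      ring
  refine ⟨fun a => (1 / 2) * (trace ((q a)ᴴ * M)).re, ?_⟩
  rw [contract, quat, hq.sum_coeff, hM]
  ext i
  fin_cases i <;> simp [eps, Matrix.mulVec, dotProduct] <;> field_simp <;>
    simp [hn0] <;> ring

lemma normSq_smul {c : ℂ} (z : Fin 2 → ℂ) : normSq (c • z) = (star c * c) * normSq z := by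
  simp [normSq, lower, sigma, eps, Fin.sum_univ_two]
  ring

/-- The complex structure on the base depends only on the line of z: numerator and `normSq` both
scale by |c|². -/
lemma acsMatrix_smul {c : ℂ} (hc : c ≠ 0) (z : Fin 2 → ℂ) :
    acsMatrix (c • z) = acsMatrix z := by
  ext A B
  have hc' : star c ≠ 0 := by simpa using hc
  simp only [acsMatrix, of_apply, normSq_smul]
  have h : ∀ A B, lower (c • z) A * sigma (c • z) B + lower (sigma (c • z)) A * (c • z) B =
      (star c * c) * (lower z A * sigma z B + lower (sigma z) A * z B) := by
    intro A B
    fin_cases A <;> fin_cases B <;> simp [lower, sigma, eps, Fin.sum_univ_two] <;> ring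
  rw [h]
  by_cases h0 : normSq z = 0
  · simp [h0]
  · field_simp

lemma isQuat_acsMatrix (z : Fin 2 → ℂ) : IsQuat (acsMatrix z) := by
  have h : star (normSq z) = normSq z := by
    simp [normSq, lower, sigma, eps, Fin.sum_univ_two]
    ring
  rw [Complex.star_def] at h
  constructor <;> simp only [acsMatrix, of_apply] <;>
    simp [h, lower, sigma, eps, Fin.sum_univ_two] <;> ring

/-- The lowered spinor is an eigenvector with eigenvalue i. This is why η is complex linear for 𝕀.
-/
lemma acsMatrix_mulVec {z : Fin 2 → ℂ} (hz : z ≠ 0) :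
    acsMatrix z *ᵥ (eps *ᵥ z) = Complex.I • (eps *ᵥ z) := by
  have h := normSq_ne_zero hz
  ext i
  fin_cases i <;>
    simp [acsMatrix, eps, Matrix.mulVec, dotProduct] <;> field_simp <;>
    simp [normSq, lower, sigma, eps, Fin.sum_univ_two] <;> ring

lemma quat_coeff_mul (v : Fin 4 → ℝ) {M : Matrix (Fin 2) (Fin 2) ℂ} (hM : IsQuat M) :
    quat (fun a => ∑ b, coeff a b (fun Y => Y * M) * v b) = quat v * M := by
  simp only [quat, Complex.ofReal_sum, Complex.ofReal_mul, Finset.sum_smul, Finset.sum_mul]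
  rw [Finset.sum_comm]
  refine Finset.sum_congr rfl fun b _ => ?_
  conv_rhs => rw [smul_mul_assoc, ← ((isQuat_q b).mul hM).sum_coeff, Finset.smul_sum]
  refine Finset.sum_congr rfl fun a _ => ?_
  rw [smul_smul, mul_comm]
  rfl

lemma contract_coeff_acsMatrix {z : Fin 2 → ℂ} (hz : z ≠ 0) (v : Fin 4 → ℝ) :
    contract z (fun a => ∑ b, coeff a b (fun Y => Y * acsMatrix z) * v b) =
      Complex.I • contract z v := by
  rw [contract, quat_coeff_mul v (isQuat_acsMatrix z), ← Matrix.mulVec_mulVec, acsMatrix_mulVec hz,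
    Matrix.mulVec_smul, contract]

lemma contract_smul (c : ℂ) (z : Fin 2 → ℂ) (v : Fin 4 → ℝ) :
    contract (c • z) v = c • contract z v := by
  rw [contract, contract, Matrix.mulVec_smul, Matrix.mulVec_smul]

/-- ε is scaled by the determinant, which is 1 on SU(2). -/
lemma skew_rhoMinus (u : Grp) (z w : Fin 2 → ℂ) :
    skew (rhoMinus u *ᵥ z) (rhoMinus u *ᵥ w) = skew z w := by
  have h := congrArg star (det_su u.2)
  rw [det_fin_two] at h
  simp at h
  simp [skew_eq, rhoMinus]
  linear_combination (z 0 * w 1 - z 1 * w 0) * h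

end Spin4

/-! ### Calculus of complex-valued forms: exterior derivative, smoothness, pullbacks -/

namespace DiffForm

section Algebra

variable {E F : Type*} [NormedAddCommGroup E] [NormedSpace ℝ E] [NormedAddCommGroup F]
  [NormedSpace ℝ F]

lemma vec_three {E : Type*} (v : Fin 3 → E) : v = ![v 0, v 1, v 2] := by
  ext i; fin_cases i <;> rfl

lemma wedge₁₂_compContinuousLinearMap (t : F [⋀^Fin 1]→L[ℝ] ℂ) (w : F [⋀^Fin 2]→L[ℝ] ℂ)
    (g : E →L[ℝ] F) : (wedge₁₂ t w).compContinuousLinearMap g =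
      wedge₁₂ (t.compContinuousLinearMap g) (w.compContinuousLinearMap g) := by
  ext v
  rw [vec_three v, wedge₁₂_apply, ContinuousAlternatingMap.compContinuousLinearMap_apply]
  have h3 (x y z : E) : g ∘ ![x, y, z] = ![g x, g y, g z] := by
    ext i; fin_cases i <;> rfl
  have h2 (x y : E) : g ∘ ![x, y] = ![g x, g y] := by
    ext i; fin_cases i <;> rfl
  have h1 (x : E) : g ∘ ![x] = ![g x] := by
    ext i; fin_cases i; rfl
  simp only [h3, wedge₁₂_apply, ContinuousAlternatingMap.compContinuousLinearMap_apply, h2, h1]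

lemma fderiv_form_apply {k : ℕ} {f : E → E [⋀^Fin k]→L[ℝ] ℂ} {x : E}
    (hf : DifferentiableAt ℝ f x) (v : Fin k → E) (u : E) :
    fderiv ℝ (fun y => f y v) x u = fderiv ℝ f x u v := by
  have h := (ContinuousAlternatingMap.apply ℝ E ℂ v).hasFDerivAt.comp x hf.hasFDerivAt
  exact congrArg (fun L : E →L[ℝ] ℂ => L u) h.fderiv

lemma extDeriv_one_apply (t : E → E [⋀^Fin 1]→L[ℝ] ℂ) (x : E) (v w : E) :
    extDeriv t x ![v, w] = fderiv ℝ t x v ![w] - fderiv ℝ t x w ![v] := by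
  have h0 : (0 : Fin 2).removeNth ![v, w] = ![w] := by
    ext i; fin_cases i; rfl
  have h1 : (1 : Fin 2).removeNth ![v, w] = ![v] := by
    ext i; fin_cases i; rfl
  rw [extDeriv, ContinuousAlternatingMap.alternatizeUncurryFin_apply]
  simp [Fin.sum_univ_two, h0, h1, sub_eq_add_neg]

lemma alternatizeUncurryFin_two_apply (f : E →L[ℝ] E [⋀^Fin 2]→L[ℝ] ℂ) (p q r : E) :
    ContinuousAlternatingMap.alternatizeUncurryFin f ![p, q, r] =
      f p ![q, r] - f q ![p, r] + f r ![p, q] := by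
  have h0 : (0 : Fin 3).removeNth ![p, q, r] = ![q, r] := by
    ext i; fin_cases i <;> rfl
  have h1 : (1 : Fin 3).removeNth ![p, q, r] = ![p, r] := by
    ext i; fin_cases i <;> rfl
  have h2 : (2 : Fin 3).removeNth ![p, q, r] = ![p, q] := by
    ext i; fin_cases i <;> rfl
  rw [ContinuousAlternatingMap.alternatizeUncurryFin_apply]
  refine (Fin.sum_univ_three _).trans ?_
  rw [h0, h1, h2]
  simp [sub_eq_add_neg]

lemma alternatizeUncurryFin_three_apply (f : E →L[ℝ] E [⋀^Fin 3]→L[ℝ] ℂ) (p q r s : E) :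
    ContinuousAlternatingMap.alternatizeUncurryFin f ![p, q, r, s] =
      f p ![q, r, s] - f q ![p, r, s] + f r ![p, q, s] - f s ![p, q, r] := by
  have r0 : (0 : Fin 4).removeNth ![p, q, r, s] = ![q, r, s] := by
    ext i; fin_cases i <;> rfl
  have r1 : (1 : Fin 4).removeNth ![p, q, r, s] = ![p, r, s] := by
    ext i; fin_cases i <;> rfl
  have r2 : (2 : Fin 4).removeNth ![p, q, r, s] = ![p, q, s] := by
    ext i; fin_cases i <;> rfl
  have r3 : (3 : Fin 4).removeNth ![p, q, r, s] = ![p, q, r] := by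
    ext i; fin_cases i <;> rfl
  rw [ContinuousAlternatingMap.alternatizeUncurryFin_apply]
  refine (Fin.sum_univ_four _).trans ?_
  rw [r0, r1, r2, r3]
  have e : ((-1 : ℤ) ^ (3 : ℕ)) = -1 := by norm_num
  simp [sub_eq_add_neg, e]

/-- The Leibniz rule for `t ∧ w`, where `w` is closed. -/
lemma extDeriv_wedge₁₂_apply {t : E → E [⋀^Fin 1]→L[ℝ] ℂ} {w : E → E [⋀^Fin 2]→L[ℝ] ℂ} {x : E}
    (ht : DifferentiableAt ℝ t x) (hw : DifferentiableAt ℝ w x)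
    (hd : DifferentiableAt ℝ (fun u => wedge₁₂ (t u) (w u)) x) (hc : extDeriv w x = 0)
    (a b c d : E) :
    extDeriv (fun u => wedge₁₂ (t u) (w u)) x ![a, b, c, d] =
      extDeriv t x ![a, b] * w x ![c, d] - extDeriv t x ![a, c] * w x ![b, d] +
      extDeriv t x ![a, d] * w x ![b, c] + extDeriv t x ![b, c] * w x ![a, d] -
      extDeriv t x ![b, d] * w x ![a, c] + extDeriv t x ![c, d] * w x ![a, b] := by
  have htv (p : E) : DifferentiableAt ℝ (fun u => t u ![p]) x :=
    ((ContinuousAlternatingMap.apply ℝ E ℂ ![p]).differentiableAt).comp x ht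
  have hwv (p q : E) : DifferentiableAt ℝ (fun u => w u ![p, q]) x :=
    ((ContinuousAlternatingMap.apply ℝ E ℂ ![p, q]).differentiableAt).comp x hw
  have hm (p q r u : E) : fderiv ℝ (fun y => t y ![p] * w y ![q, r]) x u =
      fderiv ℝ t x u ![p] * w x ![q, r] + t x ![p] * fderiv ℝ w x u ![q, r] := by
    have h := ((htv p).hasFDerivAt.mul (hwv q r).hasFDerivAt).fderiv
    rw [← fderiv_form_apply ht, ← fderiv_form_apply hw]
    refine (congrArg (fun L : E →L[ℝ] ℂ => L u) h).trans ?_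
    simp [mul_comm, add_comm]
  have h3 (p q r u : E) : fderiv ℝ (fun y => wedge₁₂ (t y) (w y)) x u ![p, q, r] =
      fderiv ℝ (fun y => t y ![p] * w y ![q, r]) x u -
      fderiv ℝ (fun y => t y ![q] * w y ![p, r]) x u +
      fderiv ℝ (fun y => t y ![r] * w y ![p, q]) x u := by
    rw [← fderiv_form_apply hd]
    simp only [wedge₁₂_apply]
    have h := (((htv p).mul (hwv q r)).hasFDerivAt.sub ((htv q).mul (hwv p r)).hasFDerivAt).add
      ((htv r).mul (hwv p q)).hasFDerivAt
    exact congrArg (fun L : E →L[ℝ] ℂ => L u) h.fderiv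
  have hcl (p q r : E) : fderiv ℝ w x p ![q, r] - fderiv ℝ w x q ![p, r] +
      fderiv ℝ w x r ![p, q] = 0 := by
    have h := congrArg (fun α => α ![p, q, r]) hc
    rw [extDeriv, alternatizeUncurryFin_two_apply] at h
    exact h
  rw [extDeriv, alternatizeUncurryFin_three_apply]
  simp only [extDeriv_one_apply, h3, hm]
  -- The terms with a derivative of w group into t ∧ dw, which vanishes since w is closed; what
  -- remains is dt ∧ w.
  linear_combination (t x ![d]) * hcl a b c - (t x ![c]) * hcl a b d + (t x ![b]) * hcl a c d
    - (t x ![a]) * hcl b c d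

set_option synthInstance.maxHeartbeats 200000 in
lemma contDiffAt_extDeriv {k : ℕ} {f : E → E [⋀^Fin k]→L[ℝ] ℂ} {x : E}
    (hf : ContDiffAt ℝ ∞ f x) : ContDiffAt ℝ ∞ (extDeriv f) x := by
  have h : ContDiffAt ℝ ∞ (fderiv ℝ f) x := hf.fderiv_right (m := ∞) (by simp)
  exact (ContinuousAlternatingMap.alternatizeUncurryFinCLM (n := k) ℝ E ℂ).contDiff.contDiffAt.comp x h

end Algebra

section Smooth

variable {D E F : Type*} [NormedAddCommGroup D] [NormedSpace ℝ D] [NormedAddCommGroup E]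
  [NormedSpace ℝ E] [FiniteDimensional ℝ E] [NormedAddCommGroup F] [NormedSpace ℝ F]

/-- A family of forms is smooth as soon as its values on fixed vectors are. -/
lemma contDiffAt_iff_apply {k : ℕ} {n : WithTop ℕ∞} {f : D → E [⋀^Fin k]→L[ℝ] ℂ} {x : D} :
    ContDiffAt ℝ n f x ↔ ∀ v : Fin k → E, ContDiffAt ℝ n (fun u => f u v) x := by
  constructor
  · intro h v
    have hL : ContDiff ℝ n (ContinuousAlternatingMap.apply ℝ E ℂ v) :=
      (ContinuousAlternatingMap.apply ℝ E ℂ v).contDiff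
    exact hL.contDiffAt.comp x h
  · intro h
    let b := Module.finBasis ℝ E
    let Φ : (E [⋀^Fin k]→L[ℝ] ℂ) →ₗ[ℝ] ((Fin k → Fin (Module.finrank ℝ E)) → ℂ) :=
      { toFun := fun α s => α fun j => b (s j)
        map_add' := fun _ _ => rfl
        map_smul' := fun _ _ => rfl }
    have hΦ : Function.Injective Φ := by
      intro α β hαβ
      apply ContinuousAlternatingMap.toAlternatingMap_injective
      apply AlternatingMap.coe_multilinearMap_injective
      exact Module.Basis.ext_multilinear (fun _ => b) fun s => congrFun hαβ s
    -- A form is determined by its values on basis vectors. These live in a finite-dimensional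
    -- space, so the linear left inverse that rebuilds the form is automatically continuous, hence
    -- smooth.
    obtain ⟨Ψ, hΨ⟩ := Φ.exists_leftInverse_of_injective (LinearMap.ker_eq_bot.2 hΦ)
    have h1 : ContDiffAt ℝ n (fun u => Φ (f u)) x := contDiffAt_pi.2 fun s => h _
    have h2 : f = fun u => LinearMap.toContinuousLinearMap Ψ (Φ (f u)) := by
      funext u
      exact (LinearMap.congr_fun hΨ (f u)).symm
    rw [h2]
    exact (LinearMap.toContinuousLinearMap Ψ).contDiff.contDiffAt.comp x h1

lemma contDiffAt_compContinuousLinearMap {k : ℕ} {n : WithTop ℕ∞} {f : D → F [⋀^Fin k]→L[ℝ] ℂ}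
    {g : D → E →L[ℝ] F} {x : D} (hf : ContDiffAt ℝ n f x) (hg : ContDiffAt ℝ n g x) :
    ContDiffAt ℝ n (fun u => (f u).compContinuousLinearMap (g u)) x := by
  refine contDiffAt_iff_apply.2 fun v => ?_
  have h1 : ContDiffAt ℝ n (fun u =>
      ContinuousMultilinearMap.compContinuousLinearMapContinuousMultilinear ℝ
        (fun _ : Fin k => E) (fun _ : Fin k => F) ℂ (fun _ => g u)) x :=
    (ContinuousMultilinearMap.contDiff _).contDiffAt.comp x (contDiffAt_pi.2 fun _ => hg)
  have h2 : ContDiffAt ℝ n (fun u => ContinuousAlternatingMap.toContinuousMultilinearMapCLM ℝ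
      (f u)) x :=
    (ContinuousAlternatingMap.toContinuousMultilinearMapCLM (𝕜 := ℝ) (E := F) (F := ℂ)
      (ι := Fin k) ℝ).contDiff.contDiffAt.comp x hf
  have h3 := h1.clm_apply h2
  exact (ContinuousMultilinearMap.apply ℝ (fun _ : Fin k => E) ℂ v).contDiff.contDiffAt.comp x h3

lemma contDiffAt_wedge₁₂ {n : WithTop ℕ∞} {t : D → E [⋀^Fin 1]→L[ℝ] ℂ}
    {w : D → E [⋀^Fin 2]→L[ℝ] ℂ} {x : D} (ht : ContDiffAt ℝ n t x) (hw : ContDiffAt ℝ n w x) :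
    ContDiffAt ℝ n (fun u => wedge₁₂ (t u) (w u)) x := by
  refine contDiffAt_iff_apply.2 fun v => ?_
  rw [contDiffAt_iff_apply] at ht hw
  rw [vec_three v]
  simp only [wedge₁₂_apply]
  exact (((ht _).mul (hw _)).sub ((ht _).mul (hw _))).add ((ht _).mul (hw _))

end Smooth

section Manifold

variable {E : Type*} [NormedAddCommGroup E] [NormedSpace ℝ E] {H : Type*} [TopologicalSpace H]
  {I : ModelWithCorners ℝ E H} [I.Boundaryless] {M : Type*} [TopologicalSpace M]
  [ChartedSpace H M]

/-- The tangent space at q is the model space E, identified through this very chart, so its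
differential at q is the identity. -/
lemma mfderiv_extChartAt_self (q : M) (v : E) :
    mfderiv I 𝓘(ℝ, E) (extChartAt I q) q v = v := by
  have h : MDifferentiableAt I 𝓘(ℝ, E) (extChartAt I q) q :=
    (contMDiffAt_extChartAt (I := I) (n := ∞) (x := q)).mdifferentiableAt (by simp)
  have h1 : writtenInExtChartAt I 𝓘(ℝ, E) q (extChartAt I q) =ᶠ[𝓝 (extChartAt I q q)] id := by
    filter_upwards [extChartAt_target_mem_nhds q] with y hy
    exact (extChartAt I q).right_inv hy
  rw [h.mfderiv, ModelWithCorners.range_eq_univ, fderivWithin_univ, h1.fderiv_eq, fderiv_id]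
  rfl

lemma d_apply {k : ℕ} (α : ∀ x : M, TangentSpace I x [⋀^Fin k]→L[ℝ] ℂ) (q : M)
    (v : Fin (k + 1) → E) :
    d I α q v = extDeriv (inChart I α q) (extChartAt I q q) v := by
  change extDeriv (inChart I α q) (extChartAt I q q) (fun i => _) = _
  congr 1
  funext i
  exact mfderiv_extChartAt_self q (v i)

variable [IsManifold I ∞ M]
  {E' : Type*} [NormedAddCommGroup E'] [NormedSpace ℝ E'] {H' : Type*} [TopologicalSpace H']
  {I' : ModelWithCorners ℝ E' H'} [I'.Boundaryless] {N : Type*} [TopologicalSpace N]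
  [ChartedSpace H' N] [IsManifold I' ∞ N]

lemma minSmoothness_two_le : minSmoothness ℝ 2 ≤ (∞ : WithTop ℕ∞) := by
  rw [minSmoothness_of_isRCLikeNormedField]
  exact ENat.LEInfty.out

lemma mdifferentiableAt_extChartAt_symm {q : M} {y : E}
    (hy : y ∈ (extChartAt I q).target) :
    MDifferentiableAt 𝓘(ℝ, E) I (extChartAt I q).symm y :=
  ((contMDiffOn_extChartAt_symm (n := ∞) q).contMDiffAt
    (extChartAt_target_mem_nhds' hy)).mdifferentiableAt (by simp)

/-- The local expression of a pullback. -/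
lemma inChart_pullback {k : ℕ} {α : ∀ x : M, TangentSpace I x [⋀^Fin k]→L[ℝ] ℂ}
    {β : ∀ x : N, TangentSpace I' x [⋀^Fin k]→L[ℝ] ℂ} {f : M → N} {q : M} {n : N} {y : E}
    (hy : y ∈ (extChartAt I q).target)
    (hn : f ((extChartAt I q).symm y) ∈ (extChartAt I' n).source)
    (hf : ContMDiffAt I I' ∞ f ((extChartAt I q).symm y))
    (h : ∀ᶠ r in 𝓝 ((extChartAt I q).symm y),
      α r = (β (f r)).compContinuousLinearMap (mfderiv I I' f r)) :
    inChart I α q =ᶠ[𝓝 y] fun u =>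
      (inChart I' β n ((extChartAt I' n ∘ f ∘ (extChartAt I q).symm) u)).compContinuousLinearMap
        (fderiv ℝ (extChartAt I' n ∘ f ∘ (extChartAt I q).symm) u) := by
  have : IsManifold I 1 M := IsManifold.of_le (n := ∞) (by simp)
  have : IsManifold I' 1 N := IsManifold.of_le (n := ∞) (by simp)
  have hc : ContinuousAt (extChartAt I q).symm y := continuousAt_extChartAt_symm'' hy
  have h1 : ∀ᶠ r in 𝓝 ((extChartAt I q).symm y), MDifferentiableAt I I' f r :=
    ((contMDiffAt_iff_contMDiffAt_nhds (n := 1) (by simp)).1 (hf.of_le (by simp))).mono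
      fun r hr => hr.mdifferentiableAt one_ne_zero
  have h2 : ∀ᶠ r in 𝓝 ((extChartAt I q).symm y), f r ∈ (extChartAt I' n).source :=
    hf.continuousAt.preimage_mem_nhds ((isOpen_extChartAt_source n).mem_nhds hn)
  filter_upwards [extChartAt_target_mem_nhds' hy, hc.eventually h, hc.eventually h1,
    hc.eventually h2, hc.eventually (eventually_eventually_nhds.2 h2)] with u hu hα hfu hfn hfn'
  set r := (extChartAt I q).symm u with hr
  have hsym := mdifferentiableAt_extChartAt_symm hu
  have hg : MDifferentiableAt 𝓘(ℝ, E) I' (f ∘ (extChartAt I q).symm) u := hfu.comp u hsym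
  have hψ : MDifferentiableAt I' 𝓘(ℝ, E') (extChartAt I' n) (f r) :=
    mdifferentiableAt_extChartAt (by rwa [extChartAt_source] at hfn)
  have hF : MDifferentiableAt 𝓘(ℝ, E) 𝓘(ℝ, E') (extChartAt I' n ∘ f ∘ (extChartAt I q).symm) u :=
    hψ.comp u hg
  have hmem : (extChartAt I' n ∘ f ∘ (extChartAt I q).symm) u ∈ (extChartAt I' n).target :=
    (extChartAt I' n).map_source hfn
  have hinv : (extChartAt I' n).symm ((extChartAt I' n ∘ f ∘ (extChartAt I q).symm) u) = f r :=
    (extChartAt I' n).left_inv hfn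
  have hev : (extChartAt I' n).symm ∘ (extChartAt I' n ∘ f ∘ (extChartAt I q).symm) =ᶠ[𝓝 u]
      f ∘ (extChartAt I q).symm := by
    filter_upwards [(continuousAt_extChartAt_symm'' hu).eventually hfn'] with z hz
    exact (extChartAt I' n).left_inv hz
  -- Both sides are the derivative of f ∘ φ⁻¹, expanded by the chain rule with and without passing
  -- through the chart of the target.
  have key : ∀ v : E, mfderiv 𝓘(ℝ, E') I' (extChartAt I' n).symm
        ((extChartAt I' n ∘ f ∘ (extChartAt I q).symm) u)
        (fderiv ℝ (extChartAt I' n ∘ f ∘ (extChartAt I q).symm) u v) =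
      mfderiv I I' f r (mfderiv 𝓘(ℝ, E) I (extChartAt I q).symm u v) := by
    intro v
    have e1 := mfderiv_comp u (mdifferentiableAt_extChartAt_symm hmem) hF
    have e2 := mfderiv_comp u hfu hsym
    have e3 := hev.mfderiv_eq (I := 𝓘(ℝ, E)) (I' := I')
    rw [mfderiv_eq_fderiv] at e1
    have e4 : mfderiv 𝓘(ℝ, E) I' ((extChartAt I' n).symm ∘
      (extChartAt I' n ∘ f ∘ (extChartAt I q).symm)) u v =
      mfderiv 𝓘(ℝ, E) I' (f ∘ (extChartAt I q).symm) u v :=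
        congrArg (fun L : E →L[ℝ] E' => L v) e3
    rw [e1, e2] at e4
    exact e4
  let β' : N → E' [⋀^Fin k]→L[ℝ] ℂ := β
  have hβ : β' ((extChartAt I' n).symm ((extChartAt I' n ∘ f ∘ (extChartAt I q).symm) u)) =
      β' (f r) := congrArg β' hinv
  ext v
  have e5 : inChart I α q u v = β' (f r) fun i =>
      mfderiv I I' f r (mfderiv 𝓘(ℝ, E) I (extChartAt I q).symm u (v i)) := by
    change α r _ = _
    rw [hα]
    rfl
  rw [e5, ← hβ]
  change _ = β' ((extChartAt I' n).symm ((extChartAt I' n ∘ f ∘ (extChartAt I q).symm) u)) _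
  congr 1
  funext i
  exact (key (v i)).symm

lemma mfderiv_extChartAt_symm_self (q : M) (v : E) :
    mfderiv 𝓘(ℝ, E) I (extChartAt I q).symm (extChartAt I q q) v = v := by
  have h : MDifferentiableAt 𝓘(ℝ, E) I (extChartAt I q).symm (extChartAt I q q) :=
    mdifferentiableAt_extChartAt_symm (mem_extChartAt_target q)
  have h1 : writtenInExtChartAt 𝓘(ℝ, E) I (extChartAt I q q) (extChartAt I q).symm
      =ᶠ[𝓝 (extChartAt I q q)] id := by
    filter_upwards [extChartAt_target_mem_nhds q] with y hy
    simp only [writtenInExtChartAt, extChartAt_to_inv, Function.comp_apply]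
    exact (extChartAt I q).right_inv hy
  rw [h.mfderiv, ModelWithCorners.range_eq_univ, fderivWithin_univ]
  change fderiv ℝ _ (extChartAt I q q) v = v
  rw [h1.fderiv_eq, fderiv_id]
  rfl

/-- The exterior derivative may be computed in any preferred chart. -/
lemma inChart_d {k : ℕ} {α : ∀ x : M, TangentSpace I x [⋀^Fin k]→L[ℝ] ℂ}
    (hα : ∀ x, DifferentiableAt ℝ (inChart I α x) (extChartAt I x x)) {q : M} {y : E}
    (hy : y ∈ (extChartAt I q).target) : inChart I (d I α) q y = extDeriv (inChart I α q) y := by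
  set r := (extChartAt I q).symm y with hr
  -- Pulling back by the identity is the change from the chart at q to the chart at r, in which d is
  -- defined at r.
  have h1 := inChart_pullback (α := α) (β := α) (f := id) (n := r) hy (mem_extChartAt_source r)
    contMDiffAt_id (Filter.Eventually.of_forall fun x => by
      rw [mfderiv_id]; rfl)
  set F := extChartAt I r ∘ id ∘ (extChartAt I q).symm with hF
  have hsym : ContMDiffAt 𝓘(ℝ, E) I ∞ (extChartAt I q).symm y :=
    (contMDiffOn_extChartAt_symm (n := ∞) q).contMDiffAt (extChartAt_target_mem_nhds' hy)
  have hFs : ContDiffAt ℝ ∞ F y :=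
    (ContMDiffAt.comp y (contMDiffAt_extChartAt (n := ∞) (x := r)) hsym).contDiffAt
  have hd : DifferentiableAt ℝ (inChart I α r) (F y) := hα r
  rw [h1.extDeriv_eq, extDeriv_pullback hd hFs minSmoothness_two_le]
  have hD : mfderiv 𝓘(ℝ, E) 𝓘(ℝ, E) F y =
      (mfderiv I 𝓘(ℝ, E) (extChartAt I r) r).comp (mfderiv 𝓘(ℝ, E) I (extChartAt I q).symm y) :=
    mfderiv_comp y (mdifferentiableAt_extChartAt (mem_chart_source H r))
      (hsym.mdifferentiableAt (by simp))
  rw [mfderiv_eq_fderiv] at hD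
  rw [hD]
  rfl

/-- The exterior derivative commutes with pullbacks. -/
lemma d_pullback {k : ℕ} {α : ∀ x : M, TangentSpace I x [⋀^Fin k]→L[ℝ] ℂ}
    {β : ∀ x : N, TangentSpace I' x [⋀^Fin k]→L[ℝ] ℂ} {f : M → N} {q : M}
    (hf : ContMDiffAt I I' ∞ f q) (hβ : SmoothAt I' β (f q))
    (h : ∀ᶠ r in 𝓝 q, α r = (β (f r)).compContinuousLinearMap (mfderiv I I' f r)) :
    d I α q = (d I' β (f q)).compContinuousLinearMap (mfderiv I I' f q) := by
  have e : (extChartAt I q).symm (extChartAt I q q) = q := extChartAt_to_inv q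
  have h1 := inChart_pullback (α := α) (β := β) (f := f) (n := f q) (mem_extChartAt_target q)
    (by rw [e]; exact mem_extChartAt_source _) (by rwa [e]) (by rwa [e])
  have hsym : ContMDiffAt 𝓘(ℝ, E) I ∞ (extChartAt I q).symm (extChartAt I q q) :=
    (contMDiffOn_extChartAt_symm (n := ∞) q).contMDiffAt (extChartAt_target_mem_nhds q)
  have hF : ContDiffAt ℝ ∞ (extChartAt I' (f q) ∘ f ∘ (extChartAt I q).symm)
      (extChartAt I q q) := by
    refine (ContMDiffAt.comp _ (I' := I') ?_ (ContMDiffAt.comp _ ?_ hsym)).contDiffAt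
    · simp only [Function.comp_apply, e]
      exact contMDiffAt_extChartAt
    · rwa [e]
  have hβ' : DifferentiableAt ℝ (inChart I' β (f q))
      ((extChartAt I' (f q) ∘ f ∘ (extChartAt I q).symm) (extChartAt I q q)) := by
    simp only [Function.comp_apply, e]
    exact ContDiffAt.differentiableAt hβ (by simp)
  have hd := extDeriv_pullback hβ' hF minSmoothness_two_le
  have hfd := hf.mdifferentiableAt (by simp : (∞ : WithTop ℕ∞) ≠ 0)
  have hD : fderiv ℝ (extChartAt I' (f q) ∘ f ∘ (extChartAt I q).symm) (extChartAt I q q) =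
      mfderiv I I' f q := by
    rw [hfd.mfderiv, ModelWithCorners.range_eq_univ, fderivWithin_univ]
    rfl
  ext v
  refine (d_apply α q v).trans ?_
  rw [h1.extDeriv_eq, hd, hD]
  simp only [Function.comp_apply, e]
  exact (d_apply β (f q) _).symm

variable [FiniteDimensional ℝ E]

lemma smoothAt_pullback {k : ℕ} {α : ∀ x : M, TangentSpace I x [⋀^Fin k]→L[ℝ] ℂ}
    {β : ∀ x : N, TangentSpace I' x [⋀^Fin k]→L[ℝ] ℂ} {f : M → N} {q : M}
    (hf : ContMDiffAt I I' ∞ f q) (hβ : SmoothAt I' β (f q))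
    (h : ∀ᶠ r in 𝓝 q, α r = (β (f r)).compContinuousLinearMap (mfderiv I I' f r)) :
    SmoothAt I α q := by
  have e : (extChartAt I q).symm (extChartAt I q q) = q := extChartAt_to_inv q
  have h1 := inChart_pullback (α := α) (β := β) (f := f) (n := f q) (mem_extChartAt_target q)
    (by rw [e]; exact mem_extChartAt_source _) (by rwa [e]) (by rwa [e])
  have hsym : ContMDiffAt 𝓘(ℝ, E) I ∞ (extChartAt I q).symm (extChartAt I q q) :=
    (contMDiffOn_extChartAt_symm (n := ∞) q).contMDiffAt (extChartAt_target_mem_nhds q)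
  have hF : ContDiffAt ℝ ∞ (extChartAt I' (f q) ∘ f ∘ (extChartAt I q).symm)
      (extChartAt I q q) := by
    refine (ContMDiffAt.comp _ (I' := I') ?_ (ContMDiffAt.comp _ ?_ hsym)).contDiffAt
    · simp only [Function.comp_apply, e]
      exact contMDiffAt_extChartAt
    · rwa [e]
  refine ContDiffAt.congr_of_eventuallyEq ?_ h1
  have hβ' : ContDiffAt ℝ ∞ (inChart I' β (f q))
      ((extChartAt I' (f q) ∘ f ∘ (extChartAt I q).symm) (extChartAt I q q)) := by
    simp only [Function.comp_apply, e]
    exact hβ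
  exact contDiffAt_compContinuousLinearMap (ContDiffAt.comp _ hβ' hF)
    (hF.fderiv_right (m := ∞) (by simp))

end Manifold

end DiffForm

/-! ### Derivatives on a manifold along coordinate lines -/

section ChartLine

variable {E : Type*} [NormedAddCommGroup E] [NormedSpace ℝ E] {H : Type*} [TopologicalSpace H]
  (I : ModelWithCorners ℝ E H) {M : Type*} [TopologicalSpace M] [ChartedSpace H M]
  {F : Type*} [NormedAddCommGroup F] [NormedSpace ℝ F]

/-- The line through `x` in the direction `v` in the preferred chart at `x`. -/
def chartLine (x : M) (v : E) (t : ℝ) : M :=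
  (extChartAt I x).symm (extChartAt I x x + t • v)

lemma chartLine_zero (x : M) (v : E) : chartLine I x v 0 = x := by
  rw [chartLine, zero_smul, add_zero, extChartAt_to_inv]

lemma eventually_chartLine (x : M) (v : E) {p : M → Prop}
    (hp : ∀ᶠ y in 𝓝 x, p y) : ∀ᶠ t in 𝓝 (0 : ℝ), p (chartLine I x v t) := by
  have h1 : ContinuousAt (fun t : ℝ => extChartAt I x x + t • v) 0 := by fun_prop
  have h2 : ContinuousAt (chartLine I x v) 0 := by
    refine ContinuousAt.comp (g := (extChartAt I x).symm) ?_ h1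
    simp only [zero_smul, add_zero]
    exact continuousAt_extChartAt_symm x
  have h3 := h2.tendsto
  rw [chartLine_zero] at h3
  exact h3.eventually hp

/-- It turns statements about `mfderiv` into one-variable ones, where product rules and uniqueness
of derivatives apply directly. -/
lemma hasDerivAt_chartLine [I.Boundaryless] {h : M → F} {x : M}
    (hh : MDifferentiableAt I 𝓘(ℝ, F) h x) (v : E) :
    HasDerivAt (fun t => h (chartLine I x v t)) (mfderiv I 𝓘(ℝ, F) h x v : F) 0 := by
  have h1 : HasFDerivAt (writtenInExtChartAt I 𝓘(ℝ, F) x h)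
      (mfderiv I 𝓘(ℝ, F) h x : E →L[ℝ] F) (extChartAt I x x + (0 : ℝ) • v) := by
    have h2 := hh.hasMFDerivAt.2
    rw [ModelWithCorners.range_eq_univ] at h2
    rw [zero_smul, add_zero]
    exact hasFDerivWithinAt_univ.1 h2
  have h2 : HasDerivAt (fun t : ℝ => extChartAt I x x + t • v) (v : E) 0 := by
    simpa using ((hasDerivAt_id (0 : ℝ)).smul_const v).const_add (extChartAt I x x)
  exact h1.comp_hasDerivAt (0 : ℝ) h2

end ChartLine

section DirDeriv

variable {X : Type*} [TopologicalSpace X] [ChartedSpace E4 X]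
  {F : Type*} [NormedAddCommGroup F] [NormedSpace ℝ F]

/-- The derivative of a vector-valued function along a tangent vector. -/
def dirDeriv (h : X → F) (x : X) (v : E4) : F :=
  mfderiv (𝓡 4) 𝓘(ℝ, F) h x v

lemma hasDerivAt_coordLine {h : X → F} {x : X} (hh : MDifferentiableAt (𝓡 4) 𝓘(ℝ, F) h x)
    (v : E4) :
    HasDerivAt (fun t => h (chartLine (𝓡 4) x v t)) (dirDeriv h x v) 0 :=
  hasDerivAt_chartLine (𝓡 4) hh v

end DirDeriv

/-! ### Leibniz rules for Lie brackets of combinations of four vector fields -/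

section Bracket

open VectorField

variable {X : Type*} [TopologicalSpace X] [ChartedSpace E4 X] [IsManifold (𝓡 4) ∞ X]

lemma mlieBracket_sum_smul_left {V : Fin 4 → ∀ x : X, TangentSpace (𝓡 4) x}
    {W : ∀ x : X, TangentSpace (𝓡 4) x} {f : Fin 4 → X → ℝ} {x : X}
    (hf : ∀ a, MDifferentiableAt (𝓡 4) 𝓘(ℝ, ℝ) (f a) x)
    (hV : ∀ a, MDifferentiableAt (𝓡 4) (𝓡 4).tangent
      (fun y => (⟨y, V a y⟩ : TangentBundle (𝓡 4) X)) x) :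
    mlieBracket (𝓡 4) (fun y => ∑ a, f a y • V a y) W x =
      ∑ a, (f a x • mlieBracket (𝓡 4) (V a) W x - dirDeriv (f a) x (W x) • V a x) := by
  have : IsManifold (𝓡 4) 1 X := IsManifold.of_le (n := ∞) (by simp)
  have key : ∀ t : Finset (Fin 4),
      mlieBracket (𝓡 4) (fun y => ∑ a ∈ t, f a y • V a y) W x =
      ∑ a ∈ t, (f a x • mlieBracket (𝓡 4) (V a) W x - dirDeriv (f a) x (W x) • V a x) := by
    intro t
    induction t using Finset.induction_on with
    | empty =>
      simp only [Finset.sum_empty]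
      have := mlieBracket_zero_left (I := 𝓡 4) (W := W)
      exact congrFun this x
    | insert a t ha ih =>
      have h1 : (fun y => ∑ b ∈ insert a t, f b y • V b y) =
          (f a • V a) + fun y => ∑ b ∈ t, f b y • V b y := by
        funext y
        rw [Finset.sum_insert ha]
        rfl
      have h2 : MDifferentiableAt (𝓡 4) (𝓡 4).tangent
          (fun y => (⟨y, ∑ b ∈ t, f b y • V b y⟩ : TangentBundle (𝓡 4) X)) x :=
        MDifferentiableAt.sum_section fun b _ => MDifferentiableAt.smul_section (hf b) (hV b)
      rw [h1, mlieBracket_add_left (MDifferentiableAt.smul_section (hf a) (hV a)) h2, ih, mlieBracket_smul_left (hf a) (hV a), Finset.sum_insert ha]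
      congr 1
      rw [neg_smul, neg_add_eq_sub]
      rfl
  exact key Finset.univ

lemma mlieBracket_sum_smul_right {V : ∀ x : X, TangentSpace (𝓡 4) x}
    {W : Fin 4 → ∀ x : X, TangentSpace (𝓡 4) x} {f : Fin 4 → X → ℝ} {x : X}
    (hf : ∀ a, MDifferentiableAt (𝓡 4) 𝓘(ℝ, ℝ) (f a) x)
    (hW : ∀ a, MDifferentiableAt (𝓡 4) (𝓡 4).tangent
      (fun y => (⟨y, W a y⟩ : TangentBundle (𝓡 4) X)) x) :
    mlieBracket (𝓡 4) V (fun y => ∑ a, f a y • W a y) x =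
      ∑ a, (f a x • mlieBracket (𝓡 4) V (W a) x + dirDeriv (f a) x (V x) • W a x) := by
  rw [mlieBracket_swap_apply, mlieBracket_sum_smul_left hf hW, ← Finset.sum_neg_distrib]
  refine Finset.sum_congr rfl fun a _ => ?_
  rw [mlieBracket_swap_apply (V := V) (W := W a), smul_neg, neg_sub, sub_eq_add_neg, add_comm]

end Bracket

/-! ### Orthonormal frames: dual coframe, smoothness and symmetries of the coefficients -/

namespace SpinStructure

open Spin4 VectorField

variable {X : Type*} [TopologicalSpace X] [ChartedSpace E4 X] [IsManifold (𝓡 4) ∞ X]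
  {g : Metric4 X} {ι : Type*} (s : SpinStructure g ι)

lemma coframe_apply (i : ι) (a : Fin 4) (x : X) (v : TangentSpace (𝓡 4) x) :
    s.coframe i a x v = g.inner x (s.frame i a x) v := rfl

lemma coframe_frame {i : ι} {x : X} (hx : x ∈ s.baseSet i) (a b : Fin 4) :
    s.coframe i a x (s.frame i b x) = if a = b then 1 else 0 :=
  s.orthonormal_frame i x hx a b

lemma sum_coframe_smul_frame {i : ι} {x : X} (hx : x ∈ s.baseSet i) (v : TangentSpace (𝓡 4) x) :
    ∑ a, s.coframe i a x v • s.frame i a x = v := by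
  have hli : LinearIndependent ℝ (fun a => (s.frame i a x : E4)) := by
    rw [Fintype.linearIndependent_iff]
    intro c hc a
    have h := congrArg (s.coframe i a x) hc
    rw [map_zero] at h
    erw [map_sum] at h
    have h1 : ∀ b, s.coframe i a x (c b • s.frame i b x) = if a = b then c b else 0 := by
      intro b
      rw [map_smul, s.coframe_frame hx]
      split_ifs <;> simp
    rw [Finset.sum_congr rfl fun b _ => h1 b] at h
    simpa using h
  let b := basisOfLinearIndependentOfCardEqFinrank hli
    ((Fintype.card_fin 4).trans (finrank_euclideanSpace_fin (𝕜 := ℝ) (n := 4)).symm)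
  have hb : ∀ a, b a = s.frame i a x := fun a => by simp [b]
  have h2 : ∀ a, s.coframe i a x v = b.repr v a := by
    intro a
    conv_lhs => rw [← b.sum_repr v]
    erw [map_sum]
    have h1 : ∀ c, s.coframe i a x (b.repr v c • b c) = if a = c then b.repr v c else 0 := by
      intro c
      erw [map_smul]
      rw [hb, s.coframe_frame hx]
      split_ifs <;> simp
    rw [Finset.sum_congr rfl fun c _ => h1 c]
    simp
  calc _ = ∑ a, b.repr v a • b a := Finset.sum_congr rfl fun a _ => by rw [h2, hb]
    _ = v := b.sum_repr v

lemma contMDiffAt_frame {i : ι} {x : X} (hx : x ∈ s.baseSet i) (a : Fin 4) :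
    ContMDiffAt (𝓡 4) (𝓡 4).tangent ∞
      (fun y => (⟨y, s.frame i a y⟩ : TangentBundle (𝓡 4) X)) x :=
  (s.smooth_frame i a).contMDiffAt ((s.isOpen_baseSet i).mem_nhds hx)

lemma contMDiffAt_inner {V W : ∀ x : X, TangentSpace (𝓡 4) x} {x : X}
    (hV : ContMDiffAt (𝓡 4) (𝓡 4).tangent ∞ (fun y => (⟨y, V y⟩ : TangentBundle (𝓡 4) X)) x)
    (hW : ContMDiffAt (𝓡 4) (𝓡 4).tangent ∞ (fun y => (⟨y, W y⟩ : TangentBundle (𝓡 4) X)) x) :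
    ContMDiffAt (𝓡 4) 𝓘(ℝ, ℝ) ∞ (fun y => g.inner y (V y) (W y)) x := by
  have : ContMDiffAt (𝓡 4) ((𝓡 4).prod 𝓘(ℝ, ℝ)) ∞
      (fun y => TotalSpace.mk' ℝ (E := Bundle.Trivial X ℝ) y (g.inner y (V y) (W y))) x :=
    ContMDiffAt.clm_bundle_apply₂ (F₁ := E4) (F₂ := E4) g.contMDiff.contMDiffAt hV hW
  rw [contMDiffAt_totalSpace] at this
  exact this.2

lemma contMDiffAt_bracketCoeff {i : ι} {x : X} (hx : x ∈ s.baseSet i) (a b c : Fin 4) :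
    ContMDiffAt (𝓡 4) 𝓘(ℝ, ℝ) ∞ (s.bracketCoeff i a b c) x := by
  have : IsManifold (𝓡 4) (((⊤ : ℕ∞) : WithTop ℕ∞) + 1) X := by
    simpa using (inferInstance : IsManifold (𝓡 4) ∞ X)
  have : IsManifold (𝓡 4) (minSmoothness ℝ 2) X :=
    IsManifold.of_le (n := ∞) DiffForm.minSmoothness_two_le
  refine contMDiffAt_inner ?_ (s.contMDiffAt_frame hx c)
  exact ContMDiffAt.mlieBracket_vectorField (m := ⊤) (n := ⊤) (s.contMDiffAt_frame hx a)
    (s.contMDiffAt_frame hx b) (by simp)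

lemma contMDiffAt_leviCivita {i : ι} {x : X} (hx : x ∈ s.baseSet i) (a b c : Fin 4) :
    ContMDiffAt (𝓡 4) 𝓘(ℝ, ℝ) ∞ (s.leviCivita i a b c) x :=
  contMDiffAt_const.mul (((s.contMDiffAt_bracketCoeff hx a b c).sub
    (s.contMDiffAt_bracketCoeff hx b c a)).add (s.contMDiffAt_bracketCoeff hx c a b))

lemma bracketCoeff_swap (i : ι) (a b c : Fin 4) (x : X) :
    s.bracketCoeff i a b c x = -s.bracketCoeff i b a c x := by
  rw [bracketCoeff, bracketCoeff, mlieBracket_swap_apply, map_neg]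
  rfl

/-- Metric compatibility, which in an orthonormal frame follows from the Koszul formula and the
antisymmetry of brackets. -/
lemma leviCivita_swap (i : ι) (a b c : Fin 4) (x : X) :
    s.leviCivita i a b c x = -s.leviCivita i a c b x := by
  rw [leviCivita, leviCivita, s.bracketCoeff_swap i b c a, s.bracketCoeff_swap i c a b,
    s.bracketCoeff_swap i a b c]
  ring

end SpinStructure

section DirDeriv

variable {X : Type*} [TopologicalSpace X] [ChartedSpace E4 X]
  {F : Type*} [NormedAddCommGroup F] [NormedSpace ℝ F]

lemma dirDeriv_sum_smul (h : X → F) (x : X) (c : Fin 4 → ℝ) (v : Fin 4 → E4) :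
    dirDeriv h x (∑ a, c a • v a) = ∑ a, c a • dirDeriv h x (v a) := by
  let L : E4 →L[ℝ] F := mfderiv (𝓡 4) 𝓘(ℝ, F) h x
  change L _ = ∑ a, c a • L _
  simp

lemma map_sum_smul_sum_smul (L : E4 →L[ℝ] ℝ) {α β δ : Fin 4 → ℝ} {γ r : Fin 4 → Fin 4 → ℝ}
    {M : Fin 4 → Fin 4 → E4} {e : Fin 4 → E4} {p : Fin 4 → ℝ} (he : ∀ c, L (e c) = p c)
    (hM : ∀ c d, L (M c d) = r c d) :
    L (∑ c, (α c • ∑ d, (β d • M c d + γ c d • e d) - δ c • e c)) =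
      ∑ c, ∑ d, α c * β d * r c d + ∑ d, p d * ∑ c, α c * γ c d - ∑ d, p d * δ d := by
  simp only [map_sum, map_sub, map_add, map_smul, smul_eq_mul, he, hM, Finset.sum_sub_distrib,
    Finset.sum_add_distrib, mul_add, Finset.mul_sum]
  congr 1
  · congr 1
    · simp only [mul_assoc]
    · rw [Finset.sum_comm]
      exact Finset.sum_congr rfl fun c _ => Finset.sum_congr rfl fun d _ => by ring
  · exact Finset.sum_congr rfl fun c _ => by ring

end DirDeriv

/-! ### The Levi-Civita connection under a change of orthonormal frame -/

namespace SpinStructure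

open Spin4 VectorField

variable {X : Type*} [TopologicalSpace X] [ChartedSpace E4 X] [IsManifold (𝓡 4) ∞ X]
  {g : Metric4 X} {ι : Type*} (s : SpinStructure g ι)

/-- The change of frames from `i` to `j`. -/
def frameChange (i j : ι) (a b : Fin 4) (x : X) : ℝ := toSO4 (s.transition i j x) a b

/-- The derivative of the change of frames. -/
def frameChangeDeriv (i j : ι) (x : X) (v : E4) : Matrix (Fin 4) (Fin 4) ℝ :=
  Matrix.of fun a b => dirDeriv (s.frameChange i j a b) x v

lemma coframe_frame' {i j : ι} {x : X} (hi : x ∈ s.baseSet i) (hj : x ∈ s.baseSet j)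
    (a b : Fin 4) : s.coframe i a x (s.frame j b x) = s.frameChange i j a b x := by
  rw [s.frame_transition i j x ⟨hi, hj⟩ b]
  erw [map_sum]
  have h (c : Fin 4) : s.coframe i a x (toSO4 (s.transition i j x) c b • s.frame i c x) =
      if a = c then s.frameChange i j c b x else 0 := by
    rw [map_smul, s.coframe_frame hi]
    split_ifs <;> simp [frameChange]
  rw [Finset.sum_congr rfl fun c _ => h c]
  simp

/-- The entries are inner products of two smooth frames. -/
lemma contMDiffAt_frameChange {i j : ι} {x : X} (hi : x ∈ s.baseSet i) (hj : x ∈ s.baseSet j)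
    (a b : Fin 4) : ContMDiffAt (𝓡 4) 𝓘(ℝ, ℝ) ∞ (s.frameChange i j a b) x := by
  refine (contMDiffAt_inner (g := g) (s.contMDiffAt_frame hi a)
    (s.contMDiffAt_frame hj b)).congr_of_eventuallyEq ?_
  filter_upwards [(s.isOpen_baseSet i).mem_nhds hi, (s.isOpen_baseSet j).mem_nhds hj] with y h1 h2
  exact (s.coframe_frame' h1 h2 a b).symm

lemma mdifferentiableAt_frameChange {i j : ι} {x : X} (hi : x ∈ s.baseSet i)
    (hj : x ∈ s.baseSet j) (a b : Fin 4) :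
    MDifferentiableAt (𝓡 4) 𝓘(ℝ, ℝ) (s.frameChange i j a b) x :=
  (s.contMDiffAt_frameChange hi hj a b).mdifferentiableAt (by simp)

lemma coframe_sum (i : ι) (a : Fin 4) (x : X) (v : Fin 4 → TangentSpace (𝓡 4) x) :
    s.coframe i a x (∑ c, v c) = ∑ c, s.coframe i a x (v c) := by
  erw [map_sum]

lemma coframe_frame_right {i j : ι} {x : X} (hi : x ∈ s.baseSet i) (hj : x ∈ s.baseSet j)
    (a b : Fin 4) : s.coframe j b x (s.frame i a x) = s.frameChange i j a b x := by
  rw [coframe_apply, g.symm, ← coframe_apply, s.coframe_frame' hi hj]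

lemma coframe_eq_sum {i j : ι} {x : X} (hi : x ∈ s.baseSet i) (hj : x ∈ s.baseSet j)
    (b : Fin 4) (v : TangentSpace (𝓡 4) x) :
    s.coframe j b x v = ∑ a, s.frameChange i j a b x * s.coframe i a x v := by
  conv_lhs => rw [← s.sum_coframe_smul_frame hi v]
  rw [coframe_sum]
  refine Finset.sum_congr rfl fun a _ => ?_
  rw [map_smul, s.coframe_frame_right hi hj, smul_eq_mul, mul_comm]

lemma frameChange_orthogonal {i j : ι} {x : X} (hi : x ∈ s.baseSet i) (hj : x ∈ s.baseSet j)
    (b c : Fin 4) :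
    ∑ a, s.frameChange i j a b x * s.frameChange i j a c x = if b = c then 1 else 0 := by
  rw [← s.coframe_frame hj b c, s.coframe_eq_sum hi hj]
  exact Finset.sum_congr rfl fun a _ => by rw [s.coframe_frame' hi hj]

/-- Derivative of RᵀR = 1: the matrix Rᵀ dR is skew. -/
lemma frameChangeDeriv_skew {i j : ι} {x : X} (hi : x ∈ s.baseSet i) (hj : x ∈ s.baseSet j)
    (v : E4) (b c : Fin 4) :
    ∑ a, s.frameChange i j a b x * s.frameChangeDeriv i j x v a c =
      -∑ a, s.frameChange i j a c x * s.frameChangeDeriv i j x v a b := by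
  have h (a b : Fin 4) := hasDerivAt_coordLine (s.mdifferentiableAt_frameChange hi hj a b) v
  have h1 := HasDerivAt.fun_sum (u := Finset.univ) fun a _ => (h a b).mul (h a c)
  have h2 : (fun t => ∑ a, s.frameChange i j a b (chartLine (𝓡 4) x v t) *
      s.frameChange i j a c (chartLine (𝓡 4) x v t)) =ᶠ[𝓝 0] fun _ => if b = c then 1 else 0 := by
    filter_upwards [eventually_chartLine (𝓡 4) x v ((s.isOpen_baseSet i).mem_nhds hi),
      eventually_chartLine (𝓡 4) x v ((s.isOpen_baseSet j).mem_nhds hj)] with t h3 h4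
    exact s.frameChange_orthogonal h3 h4 b c
  have h3 := (hasDerivAt_const (0 : ℝ) (if b = c then (1 : ℝ) else 0)).congr_of_eventuallyEq h2
  have h4 := h1.unique h3
  simp only [chartLine_zero, Finset.sum_add_distrib] at h4
  simp only [frameChangeDeriv, of_apply]
  rw [eq_neg_iff_add_eq_zero, add_comm, ← h4]
  congr 1
  exact Finset.sum_congr rfl fun a _ => mul_comm _ _

lemma dirDeriv_frame_eq_sum {i j : ι} {x : X} (hi : x ∈ s.baseSet i) (hj : x ∈ s.baseSet j)
    (h : X → ℝ) (b : Fin 4) :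
    dirDeriv h x (s.frame j b x) = ∑ a, s.frameChange i j a b x * dirDeriv h x (s.frame i a x) := by
  rw [s.frame_transition i j x ⟨hi, hj⟩ b]
  exact dirDeriv_sum_smul h x _ _

lemma bracketCoeff_change {i j : ι} {x : X} (hi : x ∈ s.baseSet i) (hj : x ∈ s.baseSet j)
    (a b f : Fin 4) :
    s.bracketCoeff j a b f x =
      ∑ c, ∑ d, ∑ h, s.frameChange i j c a x * s.frameChange i j d b x *
        s.frameChange i j h f x * s.bracketCoeff i c d h x +
      ∑ d, s.frameChange i j d f x * s.frameChangeDeriv i j x (s.frame j a x) d b -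
      ∑ d, s.frameChange i j d f x * s.frameChangeDeriv i j x (s.frame j b x) d a := by
  have hG := s.mdifferentiableAt_frameChange hi hj
  have hF (c : Fin 4) : MDifferentiableAt (𝓡 4) (𝓡 4).tangent
      (fun y => (⟨y, s.frame i c y⟩ : TangentBundle (𝓡 4) X)) x :=
    (s.contMDiffAt_frame hi c).mdifferentiableAt (by simp)
  have hev (b : Fin 4) : s.frame j b =ᶠ[𝓝 x]
      fun y => ∑ c, s.frameChange i j c b y • s.frame i c y := by
    filter_upwards [(s.isOpen_baseSet i).mem_nhds hi, (s.isOpen_baseSet j).mem_nhds hj] with y h1 h2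
    exact s.frame_transition i j y ⟨h1, h2⟩ b
  have h1 : mlieBracket (𝓡 4) (s.frame j a) (s.frame j b) x =
      ∑ c, (s.frameChange i j c a x • ∑ d, (s.frameChange i j d b x •
          mlieBracket (𝓡 4) (s.frame i c) (s.frame i d) x +
          dirDeriv (s.frameChange i j d b) x (s.frame i c x) • s.frame i d x) -
        dirDeriv (s.frameChange i j c a) x (s.frame j b x) • s.frame i c x) := by
    refine ((hev a).mlieBracket_vectorField_eq (Filter.EventuallyEq.refl _ (s.frame j b))).trans
      ((mlieBracket_sum_smul_left (fun c => hG c a) hF).trans ?_)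
    refine Finset.sum_congr rfl fun c _ => ?_
    exact congrArg (fun w : TangentSpace (𝓡 4) x => s.frameChange i j c a x • w -
      dirDeriv (s.frameChange i j c a) x (s.frame j b x) • s.frame i c x)
      (((Filter.EventuallyEq.refl _ (s.frame i c)).mlieBracket_vectorField_eq (hev b)).trans
      (mlieBracket_sum_smul_right (fun c => hG c b) hF))
  have h2 (d : Fin 4) : s.coframe j f x (s.frame i d x) = s.frameChange i j d f x :=
    s.coframe_frame_right hi hj d f
  have h3 (c d : Fin 4) : s.coframe j f x (mlieBracket (𝓡 4) (s.frame i c) (s.frame i d) x) =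
      ∑ h, s.frameChange i j h f x * s.bracketCoeff i c d h x := by
    rw [s.coframe_eq_sum hi hj]
    refine Finset.sum_congr rfl fun h _ => ?_
    rw [coframe_apply, g.symm]
    rfl
  have h4 : s.bracketCoeff j a b f x =
      s.coframe j f x (mlieBracket (𝓡 4) (s.frame j a) (s.frame j b) x) := by
    rw [coframe_apply, g.symm]
    rfl
  rw [h4, h1]
  refine (map_sum_smul_sum_smul (s.coframe j f x) h2 h3).trans ?_
  congr 1
  congr 1
  · simp only [Finset.mul_sum, mul_assoc]
  · refine Finset.sum_congr rfl fun d _ => ?_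
    exact congrArg _ (s.dirDeriv_frame_eq_sum hi hj _ a).symm

/-- Each of the three brackets in the Koszul formula contributes two derivative terms. Skewness of
Rᵀ dR cancels four of the six and makes the other two equal, which absorbs the factor 1/2. -/
lemma leviCivita_change {i j : ι} {x : X} (hi : x ∈ s.baseSet i) (hj : x ∈ s.baseSet j)
    (a b f : Fin 4) :
    s.leviCivita j a b f x =
      ∑ c, ∑ d, ∑ h, s.frameChange i j c a x * s.frameChange i j d b x *
        s.frameChange i j h f x * s.leviCivita i c d h x +
      ∑ d, s.frameChange i j d f x * s.frameChangeDeriv i j x (s.frame j a x) d b := by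
  have hs (a b f : Fin 4) := s.frameChangeDeriv_skew hi hj (s.frame j a x) b f
  have p1 : ∑ c, ∑ d, ∑ h, s.frameChange i j c b x * s.frameChange i j d f x *
        s.frameChange i j h a x * s.bracketCoeff i c d h x =
      ∑ c, ∑ d, ∑ h, s.frameChange i j c a x * s.frameChange i j d b x *
        s.frameChange i j h f x * s.bracketCoeff i d h c x := by
    rw [Finset.sum_congr rfl fun c _ => Finset.sum_comm, Finset.sum_comm]
    refine Finset.sum_congr rfl fun c _ => Finset.sum_congr rfl fun d _ =>
      Finset.sum_congr rfl fun h _ => ?_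
    ring
  have p2 : ∑ c, ∑ d, ∑ h, s.frameChange i j c f x * s.frameChange i j d a x *
        s.frameChange i j h b x * s.bracketCoeff i c d h x =
      ∑ c, ∑ d, ∑ h, s.frameChange i j c a x * s.frameChange i j d b x *
        s.frameChange i j h f x * s.bracketCoeff i h c d x := by
    rw [Finset.sum_comm, Finset.sum_congr rfl fun c _ => Finset.sum_comm]
    refine Finset.sum_congr rfl fun c _ => Finset.sum_congr rfl fun d _ =>
      Finset.sum_congr rfl fun h _ => ?_
    ring
  have p3 : ∑ c, ∑ d, ∑ h, s.frameChange i j c a x * s.frameChange i j d b x *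
        s.frameChange i j h f x * s.leviCivita i c d h x =
      (1 / 2) * (∑ c, ∑ d, ∑ h, s.frameChange i j c a x * s.frameChange i j d b x *
        s.frameChange i j h f x * s.bracketCoeff i c d h x -
      ∑ c, ∑ d, ∑ h, s.frameChange i j c a x * s.frameChange i j d b x *
        s.frameChange i j h f x * s.bracketCoeff i d h c x +
      ∑ c, ∑ d, ∑ h, s.frameChange i j c a x * s.frameChange i j d b x *
        s.frameChange i j h f x * s.bracketCoeff i h c d x) := by
    simp only [← Finset.sum_sub_distrib, ← Finset.sum_add_distrib, Finset.mul_sum]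
    refine Finset.sum_congr rfl fun c _ => Finset.sum_congr rfl fun d _ =>
      Finset.sum_congr rfl fun h _ => ?_
    rw [leviCivita]
    ring
  rw [p3, leviCivita, s.bracketCoeff_change hi hj a b f, s.bracketCoeff_change hi hj b f a,
    s.bracketCoeff_change hi hj f a b, p1, p2]
  linear_combination (1 / 2) * hs f b a - (1 / 2) * hs b a f - (1 / 2) * hs a b f

/-- The connection matrix of the Levi-Civita connection. -/
def connMatrix (i : ι) (x : X) (v : TangentSpace (𝓡 4) x) : Matrix (Fin 4) (Fin 4) ℝ :=
  Matrix.of fun c b => ∑ a, s.coframe i a x v * s.leviCivita i a b c x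

/-- The gauge law ω ↦ RᵀωR + Rᵀ dR, obtained by contracting `leviCivita_change` with the coframe. -/
lemma connMatrix_change {i j : ι} {x : X} (hi : x ∈ s.baseSet i) (hj : x ∈ s.baseSet j)
    (v : TangentSpace (𝓡 4) x) :
    s.connMatrix j x v = (toSO4 (s.transition i j x))ᵀ * s.connMatrix i x v *
      toSO4 (s.transition i j x) + (toSO4 (s.transition i j x))ᵀ * s.frameChangeDeriv i j x v := by
  ext f b
  have h1 (c : Fin 4) : ∑ a, s.coframe j a x v * s.frameChange i j c a x = s.coframe i c x v := by
    conv_rhs => rw [← s.sum_coframe_smul_frame hj v, coframe_sum]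
    refine Finset.sum_congr rfl fun a _ => ?_
    rw [map_smul, s.coframe_frame' hi hj, smul_eq_mul]
  have h2 (d : Fin 4) : ∑ a, s.coframe j a x v * s.frameChangeDeriv i j x (s.frame j a x) d b =
      s.frameChangeDeriv i j x v d b := by
    conv_rhs => rw [← s.sum_coframe_smul_frame hj v]
    exact (dirDeriv_sum_smul (s.frameChange i j d b) x _ _).symm
  simp only [connMatrix, of_apply, Matrix.add_apply, Matrix.mul_apply, transpose_apply,
    s.leviCivita_change hi hj, mul_add, Finset.sum_add_distrib]
  congr 1
  · simp only [← h1, Finset.mul_sum, Finset.sum_mul]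
    rw [Finset.sum_comm]
    rw [Finset.sum_congr rfl fun c _ => Finset.sum_comm]
    rw [Finset.sum_comm]
    refine Finset.sum_congr rfl fun d _ => ?_
    rw [Finset.sum_congr rfl fun c _ => Finset.sum_comm]
    rw [Finset.sum_comm]
    refine Finset.sum_congr rfl fun h _ => Finset.sum_congr rfl fun c _ =>
      Finset.sum_congr rfl fun a _ => ?_
    simp only [frameChange]
    ring
  · simp only [← h2, Finset.mul_sum]
    rw [Finset.sum_comm]
    refine Finset.sum_congr rfl fun h _ => Finset.sum_congr rfl fun c _ => ?_
    simp only [frameChange]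
    ring

end SpinStructure

namespace Spin4

lemma so4ToSu2_sum_smul (c : Fin 4 → ℝ) (W : Fin 4 → Matrix (Fin 4) (Fin 4) ℝ) :
    so4ToSu2 (∑ a, c a • W a) = ∑ a, ((c a : ℝ) : ℂ) • so4ToSu2 (W a) := by
  simp only [so4ToSu2_eq, Matrix.sum_apply, Matrix.smul_apply, smul_eq_mul, Complex.ofReal_sum,
    Complex.ofReal_mul, Finset.sum_smul, Finset.smul_sum, smul_smul]
  rw [Finset.sum_congr rfl fun b _ => Finset.sum_comm, Finset.sum_comm]
  refine Finset.sum_congr rfl fun a _ => Finset.sum_congr rfl fun b _ =>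
    Finset.sum_congr rfl fun d _ => ?_
  congr 1
  ring

end Spin4

/-! ### The gauge law of the induced connection on 𝕊' -/

namespace SpinStructure

open Spin4

variable {X : Type*} [TopologicalSpace X] [ChartedSpace E4 X] [IsManifold (𝓡 4) ∞ X]
  {g : Metric4 X} {ι : Type*} (s : SpinStructure g ι)

/-- The connection form of `𝕊'` in the trivialisation `i`. -/
def spinConnAt (i : ι) (x : X) (v : TangentSpace (𝓡 4) x) : Matrix (Fin 2) (Fin 2) ℂ :=
  (so4ToSu2 (s.connMatrix i x v)).map star

lemma spinConnAt_eq_sum (i : ι) (x : X) (v : TangentSpace (𝓡 4) x) :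
    s.spinConnAt i x v = ∑ a, ((s.coframe i a x v : ℝ) : ℂ) • s.spinConn i a x := by
  have h : s.connMatrix i x v =
      ∑ a, s.coframe i a x v • Matrix.of fun c b => s.leviCivita i a b c x := by
    ext c b
    simp [connMatrix, Matrix.sum_apply]
  rw [spinConnAt, h, so4ToSu2_sum_smul]
  ext A B
  simp [Matrix.sum_apply, spinConn]

lemma connTerm_apply (x : X) (z : Fin 2 → ℂ) (v : TangentSpace (𝓡 4) x) :
    s.connTerm x z v = s.spinConnAt (s.indexAt x) x v *ᵥ z := by
  rw [spinConnAt_eq_sum, Matrix.sum_mulVec, connTerm]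
  refine (_root_.sum_apply _ _ _).trans (Finset.sum_congr rfl fun a _ => ?_)
  ext A
  simp [Matrix.smul_mulVec]

/-- The derivative of the transition functions of `𝕊'`. -/
def spinorChangeDeriv (i j : ι) (x : X) (v : E4) : Matrix (Fin 2) (Fin 2) ℂ :=
  Matrix.of fun A B => dirDeriv (fun y => s.spinorChange i j y A B) x v

lemma mdifferentiableAt_spinorChange {i j : ι} {x : X} (hi : x ∈ s.baseSet i)
    (hj : x ∈ s.baseSet j) (A B : Fin 2) :
    MDifferentiableAt (𝓡 4) 𝓘(ℝ, ℂ) (fun y => s.spinorChange i j y A B) x :=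
  ((s.smooth_spinorChange i j A B).contMDiffAt (((s.isOpen_baseSet i).inter
    (s.isOpen_baseSet j)).mem_nhds ⟨hi, hj⟩)).mdifferentiableAt (by simp)

/-- The transformation law of the connection on `𝕊'`. -/
lemma spinConnAt_change {i j : ι} {x : X} (hi : x ∈ s.baseSet i) (hj : x ∈ s.baseSet j)
    (v : TangentSpace (𝓡 4) x) :
    s.spinorChangeDeriv i j x v + s.spinConnAt j x v * s.spinorChange i j x =
      s.spinorChange i j x * s.spinConnAt i x v := by
  set u := s.transition j i x with hu
  have hx0 : chartLine (𝓡 4) x v 0 = x := chartLine_zero (𝓡 4) x v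
  have hopen : IsOpen (s.baseSet j ∩ s.baseSet i) :=
    (s.isOpen_baseSet j).inter (s.isOpen_baseSet i)
  have hd1 (A B : Fin 2) : MDifferentiableAt (𝓡 4) 𝓘(ℝ, ℂ)
      (fun y => ((s.transition j i y).1 : Matrix (Fin 2) (Fin 2) ℂ) A B) x :=
    ((s.smooth_transition_fst j i A B).contMDiffAt
      (hopen.mem_nhds ⟨hj, hi⟩)).mdifferentiableAt (by simp)
  have hd2 (A B : Fin 2) : MDifferentiableAt (𝓡 4) 𝓘(ℝ, ℂ)
      (fun y => ((s.transition j i y).2 : Matrix (Fin 2) (Fin 2) ℂ) A B) x :=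
    ((s.smooth_transition_snd j i A B).contMDiffAt
      (hopen.mem_nhds ⟨hj, hi⟩)).mdifferentiableAt (by simp)
  have e1 (A B : Fin 2) := hasDerivAt_coordLine (hd1 A B) v
  have e2 (A B : Fin 2) := hasDerivAt_coordLine (hd2 A B) v
  have e3 (a b : Fin 4) :=
    (hasDerivAt_coordLine (s.mdifferentiableAt_frameChange hj hi a b) v).ofReal_comp
  set A' : Matrix (Fin 2) (Fin 2) ℂ := Matrix.of fun A B =>
    dirDeriv (fun y => ((s.transition j i y).1 : Matrix (Fin 2) (Fin 2) ℂ) A B) x v with hA'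
  set B' : Matrix (Fin 2) (Fin 2) ℂ := Matrix.of fun A B =>
    dirDeriv (fun y => ((s.transition j i y).2 : Matrix (Fin 2) (Fin 2) ℂ) A B) x v with hB'
  have h1 : s.spinorChangeDeriv i j x v = B'.map star := by
    ext A B
    refine (hasDerivAt_coordLine (s.mdifferentiableAt_spinorChange hi hj A B) v).unique ?_
    exact (e2 A B).star
  -- The first factor of the transition function has determinant 1 along the whole line, so the
  -- derivative of the determinant vanishes.
  have h2 : trace ((u.1 : Matrix (Fin 2) (Fin 2) ℂ)ᴴ * A') = 0 := by
    refine trace_conjTranspose_mul_eq_zero (conjTranspose_su u.1) ?_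
    have h3 := ((e1 0 0).mul (e1 1 1)).sub ((e1 0 1).mul (e1 1 0))
    have h4 : HasDerivAt (fun _ : ℝ => (1 : ℂ)) 0 0 := hasDerivAt_const _ _
    have h5 := h3.unique (h4.congr_of_eventuallyEq (Filter.Eventually.of_forall fun t => by
      rw [← det_su (s.transition j i (chartLine (𝓡 4) x v t)).1, det_fin_two]
      rfl))
    simp only [hx0] at h5
    exact h5
  -- The covering relation is differentiated in the form R(q_b)B = A q_b, which avoids
  -- differentiating B⁻¹.
  have h3 (b : Fin 4) : (∑ a, ((s.frameChangeDeriv j i x v a b : ℝ) : ℂ) • q a) *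
      (u.2 : Matrix (Fin 2) (Fin 2) ℂ) + (∑ a, ((toSO4 u a b : ℝ) : ℂ) • q a) * B' =
      A' * q b := by
    ext P Q
    have f1 := HasDerivAt.fun_sum (u := Finset.univ) fun R _ =>
      (HasDerivAt.fun_sum (u := Finset.univ) fun a _ => (e3 a b).mul_const (q a P R)).fun_mul (e2 R Q)
    have f2 := HasDerivAt.fun_sum (u := Finset.univ) fun R _ => (e1 P R).mul_const (q b R Q)
    have f3 := f1.unique (f2.congr_of_eventuallyEq (Filter.Eventually.of_forall fun t => by
      have h := congrArg (· * ((s.transition j i (chartLine (𝓡 4) x v t)).2 :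
        Matrix (Fin 2) (Fin 2) ℂ)) (sum_toSO4_smul_q (s.transition j i (chartLine (𝓡 4) x v t)) b)
      simp only [mul_assoc, star_mul_self_su, mul_one] at h
      have h' := congrFun (congrFun h P) Q
      simp only [Matrix.mul_apply, Matrix.sum_apply, Matrix.smul_apply, smul_eq_mul] at h'
      exact h'))
    simp only [hx0, Finset.sum_add_distrib] at f3
    simp only [Matrix.mul_apply, Matrix.add_apply, Matrix.sum_apply, Matrix.smul_apply,
      smul_eq_mul]
    exact f3
  have h4 := so4ToSu2_transpose_mul_deriv u _ A' B' h3 h2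
  have h5 : so4ToSu2 (s.connMatrix i x v) = (u.2 : Matrix (Fin 2) (Fin 2) ℂ)ᴴ *
      so4ToSu2 (s.connMatrix j x v) * (u.2 : Matrix (Fin 2) (Fin 2) ℂ) +
      (u.2 : Matrix (Fin 2) (Fin 2) ℂ)ᴴ * B' := by
    rw [s.connMatrix_change hj hi, ← h4, ← so4ToSu2_conj]
    simp only [so4ToSu2_eq, Matrix.add_apply, Complex.ofReal_add, add_smul, Finset.sum_add_distrib,
      smul_add]
    rfl
  -- This is the gauge law on the su(2) side; entrywise conjugation then gives the law in the
  -- representation conj B.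
  have h6 : (u.2 : Matrix (Fin 2) (Fin 2) ℂ) * so4ToSu2 (s.connMatrix i x v) =
      so4ToSu2 (s.connMatrix j x v) * (u.2 : Matrix (Fin 2) (Fin 2) ℂ) + B' := by
    rw [h5, mul_add, ← mul_assoc, ← mul_assoc, ← mul_assoc, mul_star_self_su, one_mul, one_mul]
  have hm (M N : Matrix (Fin 2) (Fin 2) ℂ) : (M * N).map star = M.map star * N.map star := by
    ext A B
    simp [Matrix.mul_apply]
  have h7 := congrArg (fun M : Matrix (Fin 2) (Fin 2) ℂ => M.map star) h6
  simp only [hm] at h7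
  rw [h1, spinConnAt, spinConnAt, spinorChange, rhoMinus, h7, add_comm, ← hm]
  ext A B
  simp only [Matrix.add_apply, Matrix.map_apply, star_add]
  rfl

end SpinStructure

/-! ### Commuting coordinate vector fields -/

section CoordField

open VectorField

variable {X : Type*} [TopologicalSpace X] [ChartedSpace E4 X] [IsManifold (𝓡 4) ∞ X]

/-- The coordinate vector field with constant coefficients `v` in the preferred chart at `x₀`. -/
def coordField (x₀ : X) (v : E4) (x : X) : TangentSpace (𝓡 4) x :=
  mfderiv 𝓘(ℝ, E4) (𝓡 4) (extChartAt (𝓡 4) x₀).symm (extChartAt (𝓡 4) x₀ x) v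

lemma coordField_self (x₀ : X) (v : E4) : coordField x₀ v x₀ = v :=
  DiffForm.mfderiv_extChartAt_symm_self x₀ v

lemma contMDiffAt_coordField (x₀ : X) (v : E4) :
    ContMDiffAt (𝓡 4) (𝓡 4).tangent ∞
      (fun y => (⟨y, coordField x₀ v y⟩ : TangentBundle (𝓡 4) X)) x₀ := by
  have : IsManifold (𝓡 4) 1 X := IsManifold.of_le (n := ∞) (by simp)
  have h0 : x₀ ∈ (trivializationAt E4 (TangentSpace (𝓡 4) : X → Type _) x₀).baseSet :=
    FiberBundle.mem_baseSet_trivializationAt' x₀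
  have hnear : (chartAt E4 x₀).source ∈ 𝓝 x₀ := chart_source_mem_nhds E4 x₀
  refine (Trivialization.contMDiffAt_section_iff
    (trivializationAt E4 (TangentSpace (𝓡 4) : X → Type _) x₀) h0).2 ?_
  refine (contMDiffAt_const (c := v)).congr_of_eventuallyEq ?_
  filter_upwards [hnear] with y hy
  have h1 := TangentBundle.symmL_trivializationAt (I := 𝓡 4) (x₀ := x₀) (𝕜 := ℝ) hy
  rw [ModelWithCorners.range_eq_univ, mfderivWithin_univ] at h1
  have h2 : coordField x₀ v y =
      (trivializationAt E4 (TangentSpace (𝓡 4) : X → Type _) x₀).symm y v :=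
    ((congrArg (fun L : E4 →L[ℝ] E4 => L v) h1).symm).trans
      (Trivialization.symmL_apply _ (by simpa using hy) v)
  rw [h2]
  exact congrArg Prod.snd (Trivialization.apply_mk_symm _ (by simpa using hy) v)

/-- In the chart at x₀ both fields are constant. Such fields make the structure equations computable
without a bracket term. -/
lemma mlieBracket_coordField (x₀ : X) (v w : E4) :
    mlieBracket (𝓡 4) (coordField x₀ v) (coordField x₀ w) x₀ = 0 := by
  have : IsManifold (𝓡 4) 1 X := IsManifold.of_le (n := ∞) (by simp)
  have h (v : E4) : mpullbackWithin 𝓘(ℝ, E4) (𝓡 4) (extChartAt (𝓡 4) x₀).symm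
      (coordField x₀ v) (range (𝓡 4)) =ᶠ[𝓝 (extChartAt (𝓡 4) x₀ x₀)] fun _ => v := by
    filter_upwards [extChartAt_target_mem_nhds (I := 𝓡 4) x₀] with y hy
    have h1 := isInvertible_mfderivWithin_extChartAt_symm hy
    rw [mpullbackWithin_apply, coordField, (extChartAt (𝓡 4) x₀).right_inv hy]
    have h2 : mfderiv 𝓘(ℝ, E4) (𝓡 4) (extChartAt (𝓡 4) x₀).symm y =
        mfderivWithin 𝓘(ℝ, E4) (𝓡 4) (extChartAt (𝓡 4) x₀).symm (range (𝓡 4)) y := by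
      rw [ModelWithCorners.range_eq_univ, mfderivWithin_univ]
    rw [h2]
    exact h1.inverse_apply_self v
  rw [← mlieBracketWithin_univ, mlieBracketWithin_apply]
  have h3 := Filter.EventuallyEq.lieBracketWithin_vectorField_eq (𝕜 := ℝ)
    (s := (extChartAt (𝓡 4) x₀).symm ⁻¹' univ ∩ range (𝓡 4))
    ((h v).filter_mono nhdsWithin_le_nhds) (h v).self_of_nhds
    ((h w).filter_mono nhdsWithin_le_nhds) (h w).self_of_nhds
  refine (congrArg _ (h3.trans ?_)).trans (map_zero _)
  simp only [lieBracketWithin, fderivWithin_fun_const]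
  exact sub_self _

end CoordField

namespace SpinStructure

open Spin4

variable {X : Type*} [TopologicalSpace X] [ChartedSpace E4 X] [IsManifold (𝓡 4) ∞ X]
  {g : Metric4 X} {ι : Type*} (s : SpinStructure g ι)

/-! #### The form `τ̃` in the trivialisations -/

lemma contMDiffAt_iff_coord {E : Type*} [NormedAddCommGroup E] [NormedSpace ℝ E] {H : Type*}
    [TopologicalSpace H] {I : ModelWithCorners ℝ E H} {M : Type*} [TopologicalSpace M]
    [ChartedSpace H M] {f : M → s.Spinor} {q : M} {i : ι} (hi : (f q).1 ∈ s.baseSet i) :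
    ContMDiffAt I modelS ∞ f q ↔ ContMDiffAt I (𝓡 4) ∞ (fun r => (f r).1) q ∧
      ContMDiffAt I 𝓘(ℝ, Fin 2 → ℂ) ∞ (fun r => s.coord i (f r)) q := by
  have : MemTrivializationAtlas (s.core.localTriv i) := ⟨⟨i, rfl⟩⟩
  exact (s.core.localTriv i).contMDiffAt_iff ((s.core.mem_localTriv_source i (f q)).2 hi)

lemma contMDiffAt_proj (r : s.Spinor) :
    ContMDiffAt modelS (𝓡 4) ∞ (fun r : s.Spinor => r.1) r :=
  ((s.contMDiffAt_iff_coord (s.mem_baseSet_at r.1)).1 contMDiffAt_id).1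

lemma contMDiffAt_coord {i : ι} {r : s.Spinor} (hi : r.1 ∈ s.baseSet i) :
    ContMDiffAt modelS 𝓘(ℝ, Fin 2 → ℂ) ∞ (s.coord i) r :=
  ((s.contMDiffAt_iff_coord hi).1 contMDiffAt_id).2

lemma eventually_mem_baseSet {i : ι} {r : s.Spinor} (hi : r.1 ∈ s.baseSet i) :
    ∀ᶠ r' : s.Spinor in 𝓝 r, r'.1 ∈ s.baseSet i :=
  (s.contMDiffAt_proj r).continuousAt.eventually ((s.isOpen_baseSet i).mem_nhds hi)

lemma coord_change {i j : ι} {r : s.Spinor} (hi : r.1 ∈ s.baseSet i) (hj : r.1 ∈ s.baseSet j) :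
    s.coord j r = s.spinorChange i j r.1 *ᵥ s.coord i r := by
  have h := s.spinorChange_comp _ i j r.1 ⟨⟨s.mem_baseSet_at r.1, hi⟩, hj⟩
  exact ((mulVec_mulVec (r.2 : Fin 2 → ℂ) _ _).trans
    (congrArg (· *ᵥ (r.2 : Fin 2 → ℂ)) h)).symm

lemma coord_indexAt (r : s.Spinor) : s.coord (s.indexAt r.1) r = r.2 := by
  rw [coord_eq, spinorChange, s.transition_self _ _ (s.mem_baseSet_at r.1), rhoMinus_one]
  exact one_mulVec _

/-- The differential of the fibre coordinates in the trivialisation `i`. -/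
def dCoord (i : ι) (r : s.Spinor) : TangentSpace modelS r →L[ℝ] (Fin 2 → ℂ) :=
  mfderiv modelS 𝓘(ℝ, Fin 2 → ℂ) (s.coord i) r

/-- Product rule for z_j = S z_i, with S depending only on the base point. -/
lemma dCoord_change {i j : ι} {r : s.Spinor} (hi : r.1 ∈ s.baseSet i) (hj : r.1 ∈ s.baseSet j)
    (V : TangentSpace modelS r) :
    s.dCoord j r V = s.spinorChangeDeriv i j r.1 (s.dBase r V) *ᵥ s.coord i r +
      s.spinorChange i j r.1 *ᵥ s.dCoord i r V := by
  have h0 : chartLine modelS r V 0 = r := chartLine_zero modelS r V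
  have h1 (A B : Fin 2) : HasDerivAt
      (fun t => s.spinorChange i j (chartLine modelS r V t).1 A B)
      (s.spinorChangeDeriv i j r.1 (s.dBase r V) A B) 0 := by
    have hS := s.mdifferentiableAt_spinorChange hi hj A B
    have hp : MDifferentiableAt modelS (𝓡 4) (fun r : s.Spinor => r.1) r :=
      (s.contMDiffAt_proj r).mdifferentiableAt (by simp)
    have h2 := hasDerivAt_chartLine modelS (hS.comp r hp) V
    rw [mfderiv_comp r hS hp] at h2
    exact h2
  have h2 (k : ι) (hk : r.1 ∈ s.baseSet k) (A : Fin 2) : HasDerivAt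
      (fun t => s.coord k (chartLine modelS r V t) A) (s.dCoord k r V A) 0 :=
    hasDerivAt_pi.1 (hasDerivAt_chartLine modelS
      ((s.contMDiffAt_coord hk).mdifferentiableAt (by simp)) V) A
  ext A
  have h3 := HasDerivAt.fun_sum (u := Finset.univ) fun B _ => (h1 A B).fun_mul (h2 i hi B)
  have h4 := (h2 j hj A).unique (h3.congr_of_eventuallyEq (by
    filter_upwards [eventually_chartLine modelS r V (s.eventually_mem_baseSet hi),
      eventually_chartLine modelS r V (s.eventually_mem_baseSet hj)] with t hti htj
    rw [s.coord_change hti htj]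
    rfl))
  simp only [h0, Finset.sum_add_distrib] at h4
  exact h4

lemma tau_apply (p : s.Spinor) (V : TangentSpace modelS p) :
    s.tau p ![V] = skew p.2 (s.deltaPi p V) := by
  change (∑ A, ∑ B, (eps A B * p.2 A) •
      (ContinuousLinearMap.proj (R := ℝ) (φ := fun _ : Fin 2 => ℂ) B).comp (s.deltaPi p)) V = _
  simp only [skew, Fin.sum_univ_two]
  rfl

lemma deltaPi_apply (p : s.Spinor) (V : TangentSpace modelS p) :
    s.deltaPi p V = s.dFibre p V +
      s.spinConnAt (s.indexAt p.1) p.1 (s.dBase p V) *ᵥ (p.2 : Fin 2 → ℂ) :=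
  congrArg (s.dFibre p V + ·) (s.connTerm_apply p.1 p.2 (s.dBase p V))

/-- By the gauge law δπ transforms like π, and ε is invariant, so any trivialisation computes τ̃. A
single one can then be kept fixed near a point, as differentiation requires. -/
lemma tau_eq_coord {i : ι} {r : s.Spinor} (hi : r.1 ∈ s.baseSet i) (V : TangentSpace modelS r) :
    s.tau r ![V] = skew (s.coord i r)
      (s.dCoord i r V + s.spinConnAt i r.1 (s.dBase r V) *ᵥ s.coord i r) := by
  have hj := s.mem_baseSet_at r.1
  rw [tau_apply, deltaPi_apply, s.dCoord_change hj hi, s.coord_change hj hi, mulVec_mulVec,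
    add_right_comm, ← add_mulVec, s.spinConnAt_change hj hi, ← mulVec_mulVec, ← mulVec_add,
    coord_indexAt, spinorChange]
  refine Eq.trans ?_ (skew_rhoMinus _ _ _).symm
  rw [add_comm]
  rfl

lemma extChartAt_symm_mem (p : s.Spinor) {u : E4 × (Fin 2 → ℂ)}
    (hu : u ∈ (extChartAt modelS p).target) :
    u.1 ∈ (extChartAt (𝓡 4) p.1).target ∧
    ((extChartAt modelS p).symm u).1 ∈ s.baseSet (s.indexAt p.1) ∧
    ((extChartAt modelS p).symm u).1 = (extChartAt (𝓡 4) p.1).symm u.1 ∧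
    s.coord (s.indexAt p.1) ((extChartAt modelS p).symm u) = u.2 := by
  have h1 := (extChartAt modelS p).right_inv hu
  have h2 := (extChartAt modelS p).map_target hu
  generalize (extChartAt modelS p).symm u = r at h1 h2
  rw [FiberBundle.extChartAt] at h1 h2
  have h4 : r.1 ∈ s.baseSet (s.indexAt p.1) :=
    (s.core.mem_localTriv_source (s.indexAt p.1) r).1 h2.1
  have h5 : r.1 ∈ (extChartAt (𝓡 4) p.1).source := h2.2.1
  have h6 : extChartAt (𝓡 4) p.1 r.1 = u.1 := congrArg Prod.fst h1
  refine ⟨?_, h4, ?_, congrArg Prod.snd h1⟩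
  · rw [← h6]
    exact (extChartAt (𝓡 4) p.1).map_source h5
  · rw [← h6, (extChartAt (𝓡 4) p.1).left_inv h5]

/-- The connection form of `𝕊'` along a coordinate vector field. -/
def spinConnCoord (i : ι) (x₀ : X) (v : E4) (x : X) : Matrix (Fin 2) (Fin 2) ℂ :=
  s.spinConnAt i x (coordField x₀ v x)

/-- The form `τ̃` in the preferred charts of the total space of `𝕊'`. -/
lemma inChart_tau (p : s.Spinor) {u : E4 × (Fin 2 → ℂ)} (hu : u ∈ (extChartAt modelS p).target)
    (V : E4 × (Fin 2 → ℂ)) :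
    DiffForm.inChart modelS s.tau p u ![V] = skew u.2 (V.2 +
      s.spinConnCoord (s.indexAt p.1) p.1 V.1 ((extChartAt (𝓡 4) p.1).symm u.1) *ᵥ u.2) := by
  obtain ⟨h1, h2, h3, h4⟩ := s.extChartAt_symm_mem p hu
  set i := s.indexAt p.1 with hi
  set r := (extChartAt modelS p).symm u with hr
  have hmd : MDifferentiableAt 𝓘(ℝ, E4 × (Fin 2 → ℂ)) modelS (extChartAt modelS p).symm u :=
    DiffForm.mdifferentiableAt_extChartAt_symm hu
  have hev := extChartAt_target_mem_nhds' (I := modelS) hu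
  have e : DiffForm.inChart modelS s.tau p u ![V] =
      s.tau r ![mfderiv 𝓘(ℝ, E4 × (Fin 2 → ℂ)) modelS (extChartAt modelS p).symm u V] := by
    change s.tau r (_ ∘ ![V]) = _
    congr 1
    ext i
    fin_cases i
    rfl
  have h5 : s.dCoord i r (mfderiv 𝓘(ℝ, E4 × (Fin 2 → ℂ)) modelS (extChartAt modelS p).symm u V) =
      V.2 := by
    have hc : MDifferentiableAt modelS 𝓘(ℝ, Fin 2 → ℂ) (s.coord i) r :=
      (s.contMDiffAt_coord h2).mdifferentiableAt (by simp)
    have hcomp := mfderiv_comp u hc hmd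
    have heq : s.coord i ∘ (extChartAt modelS p).symm =ᶠ[𝓝 u] Prod.snd := by
      filter_upwards [hev] with u' hu'
      exact (s.extChartAt_symm_mem p hu').2.2.2
    rw [heq.mfderiv_eq, mfderiv_eq_fderiv, fderiv_snd] at hcomp
    exact (congrArg (fun L : (E4 × (Fin 2 → ℂ)) →L[ℝ] (Fin 2 → ℂ) => L V) hcomp).symm
  have h6 : s.dBase r (mfderiv 𝓘(ℝ, E4 × (Fin 2 → ℂ)) modelS (extChartAt modelS p).symm u V) =
      mfderiv 𝓘(ℝ, E4) (𝓡 4) (extChartAt (𝓡 4) p.1).symm u.1 V.1 := by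
    have hc : MDifferentiableAt modelS (𝓡 4) (fun r : s.Spinor => r.1) r :=
      (s.contMDiffAt_proj r).mdifferentiableAt (by simp)
    have hcomp := mfderiv_comp u hc hmd
    have heq : (fun r : s.Spinor => r.1) ∘ (extChartAt modelS p).symm =ᶠ[𝓝 u]
        (extChartAt (𝓡 4) p.1).symm ∘ Prod.fst := by
      filter_upwards [hev] with u' hu'
      exact (s.extChartAt_symm_mem p hu').2.2.1
    have hcomp2 := mfderiv_comp (I := 𝓘(ℝ, E4 × (Fin 2 → ℂ))) (I' := 𝓘(ℝ, E4)) (I'' := 𝓡 4) u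
      (DiffForm.mdifferentiableAt_extChartAt_symm h1)
      (differentiableAt_fst (𝕜 := ℝ) (p := u)).mdifferentiableAt
    rw [heq.mfderiv_eq, hcomp2, mfderiv_eq_fderiv, fderiv_fst] at hcomp
    exact (congrArg (fun L : (E4 × (Fin 2 → ℂ)) →L[ℝ] E4 => L V) hcomp).symm
  rw [e, s.tau_eq_coord h2, h5, h6, h4, spinConnCoord, coordField,
    (extChartAt (𝓡 4) p.1).right_inv h1, ← h3]

end SpinStructure

/-! ### Linearity of the projection to su(2), and duality on two-forms -/

namespace Spin4

lemma map_star_so4ToSu2_apply (w : Matrix (Fin 4) (Fin 4) ℝ) (A B : Fin 2) :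
    (so4ToSu2 w).map star A B =
      ∑ b, ∑ c, ((w c b : ℝ) : ℂ) * star ((-(1 / 4) : ℂ) * ((q b)ᴴ * q c) A B) := by
  simp only [so4ToSu2_eq, Matrix.map_apply, Matrix.smul_apply, Matrix.sum_apply, smul_eq_mul,
    Finset.mul_sum, star_sum]
  refine Finset.sum_congr rfl fun b _ => Finset.sum_congr rfl fun c _ => ?_
  simp only [star_mul', Complex.star_def, Complex.conj_ofReal]
  ring

lemma so4ToSu2_add (v w : Matrix (Fin 4) (Fin 4) ℝ) :
    so4ToSu2 (v + w) = so4ToSu2 v + so4ToSu2 w := by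
  simp only [so4ToSu2_eq, Matrix.add_apply, Complex.ofReal_add, add_smul, Finset.sum_add_distrib,
    smul_add]

lemma so4ToSu2_smul (c : ℝ) (w : Matrix (Fin 4) (Fin 4) ℝ) :
    so4ToSu2 (c • w) = (c : ℂ) • so4ToSu2 w := by
  simp only [so4ToSu2_eq, Matrix.smul_apply, Complex.ofReal_mul, mul_smul, Finset.smul_sum,
    smul_eq_mul]
  refine Finset.sum_congr rfl fun b _ => Finset.sum_congr rfl fun d _ => ?_
  rw [smul_comm]

lemma hasDerivAt_map_star_so4ToSu2 {w : ℝ → Matrix (Fin 4) (Fin 4) ℝ}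
    {w' : Matrix (Fin 4) (Fin 4) ℝ} {t : ℝ}
    (hw : ∀ c b, HasDerivAt (fun t => w t c b) (w' c b) t) (A B : Fin 2) :
    HasDerivAt (fun t => (so4ToSu2 (w t)).map star A B) ((so4ToSu2 w').map star A B) t := by
  simp only [map_star_so4ToSu2_apply]
  exact HasDerivAt.fun_sum fun b _ => HasDerivAt.fun_sum fun c _ =>
    (hw c b).ofReal_comp.mul_const _

/-- Over the integers the finitely many determinants are decidable. -/
lemma volumeForm_eq_intCast (a b c d : Fin 4) : volumeForm a b c d =
    ((-((1 : Matrix (Fin 4) (Fin 4) ℤ).submatrix ![a, b, c, d] id).det : ℤ) : ℝ) := by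
  rw [volumeForm, Int.cast_neg, Int.cast_det]
  congr 2
  ext i j
  change (1 : Matrix (Fin 4) (Fin 4) ℝ) (![a, b, c, d] i) j =
    (((1 : Matrix (Fin 4) (Fin 4) ℤ) (![a, b, c, d] i) j : ℤ) : ℝ)
  rw [Matrix.one_apply, Matrix.one_apply]
  split_ifs <;> simp

lemma det_submatrix_01 : ∀ p r, -((1 : Matrix (Fin 4) (Fin 4) ℤ).submatrix ![0, 1, p, r] id).det =
    (if p = 3 ∧ r = 2 then 1 else 0) - (if p = 2 ∧ r = 3 then 1 else 0) := by
  decide +kernel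

lemma det_submatrix_02 : ∀ p r, -((1 : Matrix (Fin 4) (Fin 4) ℤ).submatrix ![0, 2, p, r] id).det =
    (if p = 1 ∧ r = 3 then 1 else 0) - (if p = 3 ∧ r = 1 then 1 else 0) := by
  decide +kernel

lemma det_submatrix_03 : ∀ p r, -((1 : Matrix (Fin 4) (Fin 4) ℤ).submatrix ![0, 3, p, r] id).det =
    (if p = 2 ∧ r = 1 then 1 else 0) - (if p = 1 ∧ r = 2 then 1 else 0) := by
  decide +kernel

lemma sum_volumeForm (f : Fin 4 → Fin 4 → ℝ) :
    (∑ p, ∑ r, volumeForm 0 1 p r * f p r = f 3 2 - f 2 3) ∧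
    (∑ p, ∑ r, volumeForm 0 2 p r * f p r = f 1 3 - f 3 1) ∧
    (∑ p, ∑ r, volumeForm 0 3 p r * f p r = f 2 1 - f 1 2) := by
  simp only [volumeForm_eq_intCast, det_submatrix_01, det_submatrix_02, det_submatrix_03]
  refine ⟨?_, ?_, ?_⟩ <;> simp [Fin.sum_univ_four] <;> ring

lemma volumeForm_swap (c d p r : Fin 4) : volumeForm d c p r = -volumeForm c d p r := by
  have h : (1 : Matrix (Fin 4) (Fin 4) ℝ).submatrix ![d, c, p, r] id =
      ((1 : Matrix (Fin 4) (Fin 4) ℝ).submatrix ![c, d, p, r] id).submatrix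
        (Equiv.swap (0 : Fin 4) 1) id := by
    rw [Matrix.submatrix_submatrix]
    congr 1
    ext i
    fin_cases i <;> rfl
  rw [volumeForm, volumeForm, h, Matrix.det_permute, Equiv.Perm.sign_swap (by decide)]
  simp

end Spin4

section DirDeriv

variable {X : Type*} [TopologicalSpace X] [ChartedSpace E4 X]

lemma dirDeriv_sum_mul {f h : Fin 4 → X → ℝ} {x : X} {v : E4}
    (hf : ∀ a, MDifferentiableAt (𝓡 4) 𝓘(ℝ, ℝ) (f a) x)
    (hh : ∀ a, MDifferentiableAt (𝓡 4) 𝓘(ℝ, ℝ) (h a) x) {k : X → ℝ}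
    (hk : MDifferentiableAt (𝓡 4) 𝓘(ℝ, ℝ) k x) (hev : k = fun y => ∑ a, f a y * h a y) :
    dirDeriv k x v = ∑ a, (dirDeriv (f a) x v * h a x + f a x * dirDeriv (h a) x v) := by
  have h1 := HasDerivAt.fun_sum (u := Finset.univ) fun a _ =>
    (hasDerivAt_coordLine (hf a) v).fun_mul (hasDerivAt_coordLine (hh a) v)
  have h2 := hasDerivAt_coordLine hk v
  subst hev
  have h3 := h2.unique h1
  simpa only [chartLine_zero] using h3

end DirDeriv

namespace SpinStructure

open Spin4 VectorField

variable {X : Type*} [TopologicalSpace X] [ChartedSpace E4 X] [IsManifold (𝓡 4) ∞ X]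
  {g : Metric4 X} {ι : Type*} (s : SpinStructure g ι)

/-! #### Curvature of the induced connection -/

/-- The components of a coordinate vector field in the frame `i`. -/
def coframeCoord (i : ι) (a : Fin 4) (x₀ : X) (v : E4) (x : X) : ℝ :=
  s.coframe i a x (coordField x₀ v x)

lemma contMDiffAt_coframeCoord {i : ι} {x₀ : X} (hx : x₀ ∈ s.baseSet i) (a : Fin 4) (v : E4) :
    ContMDiffAt (𝓡 4) 𝓘(ℝ, ℝ) ∞ (s.coframeCoord i a x₀ v) x₀ :=
  contMDiffAt_inner (g := g) (s.contMDiffAt_frame hx a) (contMDiffAt_coordField x₀ v)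

lemma coframeCoord_self (i : ι) (a : Fin 4) (x₀ : X) (v : E4) :
    s.coframeCoord i a x₀ v x₀ = s.coframe i a x₀ v := by
  rw [coframeCoord, coordField_self]

/-- The first structure equation. -/
lemma dirDeriv_coframeCoord_sub {i : ι} {x₀ : X} (hx : x₀ ∈ s.baseSet i) (f : Fin 4) (v w : E4) :
    dirDeriv (s.coframeCoord i f x₀ w) x₀ v - dirDeriv (s.coframeCoord i f x₀ v) x₀ w =
      -∑ c, ∑ d, s.coframe i c x₀ v * s.coframe i d x₀ w * s.bracketCoeff i c d f x₀ := by
  have hG (a : Fin 4) (v : E4) : MDifferentiableAt (𝓡 4) 𝓘(ℝ, ℝ) (s.coframeCoord i a x₀ v) x₀ :=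
    (s.contMDiffAt_coframeCoord hx a v).mdifferentiableAt (by simp)
  have hF (c : Fin 4) : MDifferentiableAt (𝓡 4) (𝓡 4).tangent
      (fun y => (⟨y, s.frame i c y⟩ : TangentBundle (𝓡 4) X)) x₀ :=
    (s.contMDiffAt_frame hx c).mdifferentiableAt (by simp)
  have hev (v : E4) : coordField x₀ v =ᶠ[𝓝 x₀]
      fun y => ∑ c, s.coframeCoord i c x₀ v y • s.frame i c y := by
    filter_upwards [(s.isOpen_baseSet i).mem_nhds hx] with y hy
    exact (s.sum_coframe_smul_frame hy _).symm
  have h1 : mlieBracket (𝓡 4) (coordField x₀ v) (coordField x₀ w) x₀ =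
      ∑ c, (s.coframeCoord i c x₀ v x₀ • ∑ d, (s.coframeCoord i d x₀ w x₀ •
          mlieBracket (𝓡 4) (s.frame i c) (s.frame i d) x₀ +
          dirDeriv (s.coframeCoord i d x₀ w) x₀ (s.frame i c x₀) • s.frame i d x₀) -
        dirDeriv (s.coframeCoord i c x₀ v) x₀ (coordField x₀ w x₀) • s.frame i c x₀) := by
    refine ((hev v).mlieBracket_vectorField_eq (Filter.EventuallyEq.refl _ _)).trans
      ((mlieBracket_sum_smul_left (fun c => hG c v) hF).trans ?_)
    refine Finset.sum_congr rfl fun c _ => ?_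
    exact congrArg (fun z : TangentSpace (𝓡 4) x₀ => s.coframeCoord i c x₀ v x₀ • z -
      dirDeriv (s.coframeCoord i c x₀ v) x₀ (coordField x₀ w x₀) • s.frame i c x₀)
      (((Filter.EventuallyEq.refl _ (s.frame i c)).mlieBracket_vectorField_eq (hev w)).trans
      (mlieBracket_sum_smul_right (fun c => hG c w) hF))
  have h2 := congrArg (s.coframe i f x₀) h1
  -- The two coordinate fields commute, so the Leibniz expansion in the frame has zero f-component;
  -- solving it for the derivative terms gives dθ^f(v, w).
  rw [mlieBracket_coordField, map_zero] at h2
  have h3 (c d : Fin 4) : s.coframe i f x₀ (mlieBracket (𝓡 4) (s.frame i c) (s.frame i d) x₀) =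
      s.bracketCoeff i c d f x₀ := by
    rw [coframe_apply, g.symm]
    rfl
  have h4 := h2.trans (map_sum_smul_sum_smul (s.coframe i f x₀)
    (fun c => s.coframe_frame hx f c) h3)
  have h5 : ∑ c, s.coframeCoord i c x₀ v x₀ *
      dirDeriv (s.coframeCoord i f x₀ w) x₀ (s.frame i c x₀) =
      dirDeriv (s.coframeCoord i f x₀ w) x₀ v := by
    conv_rhs => rw [← coordField_self x₀ v, ← s.sum_coframe_smul_frame hx (coordField x₀ v x₀)]
    exact (dirDeriv_sum_smul _ _ _ _).symm
  simp only [ite_mul, one_mul, zero_mul, Finset.sum_ite_eq, Finset.mem_univ, if_true, h5] at h4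
  simp only [coframeCoord_self, coordField_self] at h4
  linarith

lemma connMatrix_skew (i : ι) (x : X) (v : TangentSpace (𝓡 4) x) (a b : Fin 4) :
    s.connMatrix i x v a b = -s.connMatrix i x v b a := by
  simp only [connMatrix, of_apply, ← Finset.sum_neg_distrib]
  refine Finset.sum_congr rfl fun c _ => ?_
  rw [s.leviCivita_swap i c b a]
  ring

/-- The Levi-Civita connection matrix along a coordinate vector field. -/
def connCoord (i : ι) (x₀ : X) (v : E4) (c b : Fin 4) (x : X) : ℝ :=
  s.connMatrix i x (coordField x₀ v x) c b

lemma contMDiffAt_connCoord {i : ι} {x₀ : X} (hx : x₀ ∈ s.baseSet i) (v : E4) (c b : Fin 4) :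
    ContMDiffAt (𝓡 4) 𝓘(ℝ, ℝ) ∞ (s.connCoord i x₀ v c b) x₀ :=
  contMDiffAt_finsetSum (t := Finset.univ)
    (f := fun a x => s.coframeCoord i a x₀ v x * s.leviCivita i a b c x) fun a _ =>
    (s.contMDiffAt_coframeCoord hx a v).mul (s.contMDiffAt_leviCivita hx a b c)

/-- The derivative along `v` of the connection matrix along `w`. -/
def connCoordDeriv (i : ι) (x₀ : X) (v w : E4) : Matrix (Fin 4) (Fin 4) ℝ :=
  Matrix.of fun c b => dirDeriv (s.connCoord i x₀ w c b) x₀ v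

lemma connCoordDeriv_apply {i : ι} {x₀ : X} (hx : x₀ ∈ s.baseSet i) (v w : E4) (c b : Fin 4) :
    s.connCoordDeriv i x₀ v w c b = ∑ a, (dirDeriv (s.coframeCoord i a x₀ w) x₀ v *
      s.leviCivita i a b c x₀ + s.coframe i a x₀ w *
      ∑ e, s.coframe i e x₀ v * s.frameDeriv i e (s.leviCivita i a b c) x₀) := by
  refine (dirDeriv_sum_mul
    (fun a => (s.contMDiffAt_coframeCoord hx a w).mdifferentiableAt (by simp))
    (fun a => (s.contMDiffAt_leviCivita hx a b c).mdifferentiableAt (by simp))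
    ((s.contMDiffAt_connCoord hx w c b).mdifferentiableAt (by simp)) rfl).trans ?_
  refine Finset.sum_congr rfl fun a _ => ?_
  rw [coframeCoord_self]
  congr 2
  conv_lhs => rw [← coordField_self x₀ v, ← s.sum_coframe_smul_frame hx (coordField x₀ v x₀)]
  refine (dirDeriv_sum_smul _ _ _ _).trans ?_
  rw [coordField_self]
  rfl

/-- The curvature form `dω(v, w) + [ω(v), ω(w)]`. -/
def curvatureForm (i : ι) (x₀ : X) (v w : E4) : Matrix (Fin 4) (Fin 4) ℝ :=
  s.connCoordDeriv i x₀ v w - s.connCoordDeriv i x₀ w v +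
    (s.connMatrix i x₀ v * s.connMatrix i x₀ w - s.connMatrix i x₀ w * s.connMatrix i x₀ v)

/-- The second structure equation. -/
lemma curvatureForm_apply {i : ι} {x₀ : X} (hx : x₀ ∈ s.baseSet i) (v w : E4) (c b : Fin 4) :
    s.curvatureForm i x₀ v w c b = ∑ a, ∑ e, s.coframe i a x₀ v * s.coframe i e x₀ w *
      s.curvature i a e c b x₀ := by
  have h (f : Fin 4) := s.dirDeriv_coframeCoord_sub hx f v w
  simp only [curvatureForm, Matrix.add_apply, Matrix.sub_apply, s.connCoordDeriv_apply hx,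
    Matrix.mul_apply, connMatrix, of_apply, curvature]
  simp only [Fin.sum_univ_four] at h ⊢
  -- Derivatives of the coframe are traded for bracket coefficients; they become the ∇_{[a, b]} term
  -- of the curvature.
  linear_combination h 0 * s.leviCivita i 0 b c x₀ + h 1 * s.leviCivita i 1 b c x₀ +
    h 2 * s.leviCivita i 2 b c x₀ + h 3 * s.leviCivita i 3 b c x₀

end SpinStructure

/-! ### Algebra of traceless matrices and ε used in the computation of dτ̃ -/

namespace Spin4

lemma so4ToSu2_eq_zero {w : Matrix (Fin 4) (Fin 4) ℝ} (hw : ∀ a b, w a b = -w b a)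
    (h1 : w 0 1 = w 2 3) (h2 : w 0 2 = -w 1 3) (h3 : w 0 3 = w 1 2) : so4ToSu2 w = 0 := by
  rw [so4ToSu2_of_skew hw, h1, h2, h3]
  simp

/-- Tracelessness of M is equivalent to symmetry of the bilinear form ε(·, M·). -/
lemma skew_mulVec_comm {M : Matrix (Fin 2) (Fin 2) ℂ} (hM : trace M = 0) (z w : Fin 2 → ℂ) :
    skew z (M *ᵥ w) = skew w (M *ᵥ z) := by
  rw [trace_fin_two] at hM
  simp only [skew_eq, mulVec, dotProduct, Fin.sum_univ_two]
  linear_combination (z 0 * w 1 - z 1 * w 0) * hM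

lemma skew_commutator {M N : Matrix (Fin 2) (Fin 2) ℂ} (hM : trace M = 0) (hN : trace N = 0)
    (z : Fin 2 → ℂ) :
    skew z ((M * N - N * M) *ᵥ z) = -2 * skew (M *ᵥ z) (N *ᵥ z) := by
  rw [trace_fin_two] at hM hN
  have h1 : M 1 1 = -M 0 0 := by linear_combination hM
  have h2 : N 1 1 = -N 0 0 := by linear_combination hN
  simp only [skew_eq, mulVec, dotProduct, Fin.sum_univ_two, Matrix.sub_apply, Matrix.mul_apply,
    h1, h2]
  ring

lemma map_star_so4ToSu2_curvature {v w : Matrix (Fin 4) (Fin 4) ℝ} (hv : ∀ a b, v a b = -v b a)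
    (hw : ∀ a b, w a b = -w b a) (v' w' : Matrix (Fin 4) (Fin 4) ℝ) :
    (so4ToSu2 (v' - w' + (v * w - w * v))).map star =
      (so4ToSu2 v').map star - (so4ToSu2 w').map star +
      ((so4ToSu2 v).map star * (so4ToSu2 w).map star -
        (so4ToSu2 w).map star * (so4ToSu2 v).map star) := by
  have hs (M N : Matrix (Fin 4) (Fin 4) ℝ) : so4ToSu2 (M - N) = so4ToSu2 M - so4ToSu2 N := by
    rw [eq_sub_iff_add_eq, ← so4ToSu2_add, sub_add_cancel]
  rw [so4ToSu2_add, so4ToSu2_commutator hv hw, hs]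
  ext A B
  simp [Matrix.mul_apply]

/-- The left side is dτ̃ on two vectors with fibre parts v, w and connection matrices M, N, where A
and B are the derivatives of the connection. Completing v and w to v + Mz and w + Nz, the values of
δπ, leaves exactly the curvature. -/
lemma skew_curvature_aux {M N : Matrix (Fin 2) (Fin 2) ℂ} (hM : trace M = 0) (hN : trace N = 0)
    (A B : Matrix (Fin 2) (Fin 2) ℂ) (v w z : Fin 2 → ℂ) :
    skew v (w + N *ᵥ z) + skew z (A *ᵥ z + N *ᵥ v) -
      (skew w (v + M *ᵥ z) + skew z (B *ᵥ z + M *ᵥ w)) =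
    2 * skew (v + M *ᵥ z) (w + N *ᵥ z) + skew z ((A - B + (M * N - N * M)) *ᵥ z) := by
  have ha (a b c : Fin 2 → ℂ) : skew a (b + c) = skew a b + skew a c := by
    simp only [skew_eq, Pi.add_apply]; ring
  have ha' (a b c : Fin 2 → ℂ) : skew (a + b) c = skew a c + skew b c := by
    simp only [skew_eq, Pi.add_apply]; ring
  have hb (a b c : Fin 2 → ℂ) : skew a (b - c) = skew a b - skew a c := by
    simp only [skew_eq, Pi.sub_apply]; ring
  have hc (a b : Fin 2 → ℂ) : skew a b = -skew b a := by
    simp only [skew_eq]; ring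
  rw [add_mulVec (A - B), sub_mulVec A]
  simp only [ha, ha', hb, skew_commutator hM hN, skew_mulVec_comm hM z w, skew_mulVec_comm hN z v]
  rw [hc w v, hc (M *ᵥ z) w]
  ring

end Spin4

/-! ### Curvature of 𝕊' for an anti self-dual Einstein metric, and the formula for dτ̃ -/

namespace SpinStructure

open Spin4

variable {X : Type*} [TopologicalSpace X] [ChartedSpace E4 X] [IsManifold (𝓡 4) ∞ X]
  {g : Metric4 X} {ι : Type*} (s : SpinStructure g ι)

/-- The Schouten tensor is Λg, because ½·6Λ - (1/12)·24Λ = Λ. -/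
lemma weyl_eq {Λ : ℝ} (hE : s.IsEinstein Λ) {i : ι} {x : X} (hx : x ∈ s.baseSet i)
    (a b c d : Fin 4) : s.curvature i a b c d x = s.weyl i a b c d x +
      2 * Λ * (delta a c * delta b d - delta b c * delta a d) := by
  have h1 : s.scalar i x = 24 * Λ := by
    simp only [scalar, hE i x hx, delta, Fin.sum_univ_four]
    norm_num
    ring
  have h2 (a b : Fin 4) : s.schouten i a b x = Λ * delta a b := by
    rw [schouten, hE i x hx, h1]
    ring
  have h3 (a b : Fin 4) : delta a b = delta b a := by simp only [delta, eq_comm]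
  rw [weyl, h2, h2, h2, h2, h3 c a, h3 c b, h3 d a, h3 d b]
  ring

/-- Anti self-duality in the last pair of indices says that the three self-dual combinations seen by
`so4ToSu2` vanish. -/
lemma so4ToSu2_weyl (hA : s.IsAntiSelfDual) {i : ι} {x : X} (hx : x ∈ s.baseSet i)
    (v w : Fin 4 → ℝ) :
    so4ToSu2 (Matrix.of fun c d => ∑ a, ∑ b, v a * w b * s.weyl i a b c d x) = 0 := by
  -- The antisymmetry is inherited from the volume form through the duality equation, so no symmetry
  -- of the curvature has to be proved.
  have hsk (a b c d : Fin 4) : s.weyl i a b c d x = -s.weyl i a b d c x := by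
    have h1 := hA i x hx a b c d
    have h2 := hA i x hx a b d c
    simp only [volumeForm_swap c d, neg_mul, Finset.sum_neg_distrib] at h2
    linarith
  have h1 (a b : Fin 4) : s.weyl i a b 0 1 x = s.weyl i a b 2 3 x := by
    have h := hA i x hx a b 0 1
    rw [(sum_volumeForm fun p r => s.weyl i a b p r x).1, hsk a b 3 2] at h
    linarith
  have h2 (a b : Fin 4) : s.weyl i a b 0 2 x = -s.weyl i a b 1 3 x := by
    have h := hA i x hx a b 0 2
    rw [(sum_volumeForm fun p r => s.weyl i a b p r x).2.1, hsk a b 3 1] at h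
    linarith
  have h3 (a b : Fin 4) : s.weyl i a b 0 3 x = s.weyl i a b 1 2 x := by
    have h := hA i x hx a b 0 3
    rw [(sum_volumeForm fun p r => s.weyl i a b p r x).2.2, hsk a b 2 1] at h
    linarith
  refine so4ToSu2_eq_zero (fun c d => ?_) ?_ ?_ ?_ <;> simp only [of_apply, h1, h2, h3]
  · simp only [hsk _ _ c d, mul_neg, Finset.sum_neg_distrib]
  · simp only [mul_neg, Finset.sum_neg_distrib]

/-- The components of a tangent vector in the preferred frame. -/
def components (x : X) (v : TangentSpace (𝓡 4) x) (a : Fin 4) : ℝ :=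
  s.coframe (s.indexAt x) a x v

lemma curvatureForm_eq {Λ : ℝ} (hE : s.IsEinstein Λ) (x : X) (v w : E4) :
    s.curvatureForm (s.indexAt x) x v w =
      (Matrix.of fun c d => ∑ a, ∑ b, s.components x v a * s.components x w b *
        s.weyl (s.indexAt x) a b c d x) +
      (2 * Λ) • Matrix.of fun c d => s.components x v c * s.components x w d -
        s.components x v d * s.components x w c := by
  ext c d
  rw [s.curvatureForm_apply (s.mem_baseSet_at x)]
  simp only [s.weyl_eq hE (s.mem_baseSet_at x), mul_add, Finset.sum_add_distrib, Matrix.add_apply,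
    Matrix.smul_apply, of_apply, smul_eq_mul]
  congr 1
  simp only [components, delta, mul_sub, Finset.sum_sub_distrib]
  congr 1 <;> simp <;> ring

/-- The curvature of the induced connection contracted with `z`. -/
lemma skew_curvatureForm {Λ : ℝ} (hE : s.IsEinstein Λ) (hA : s.IsAntiSelfDual) (x : X)
    (v w : E4) (z : Fin 2 → ℂ) :
    skew z ((so4ToSu2 (s.curvatureForm (s.indexAt x) x v w)).map star *ᵥ z) =
      Λ * skew (contract z (s.components x v)) (contract z (s.components x w)) := by
  rw [s.curvatureForm_eq hE, so4ToSu2_add, s.so4ToSu2_weyl hA (s.mem_baseSet_at x), zero_add,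
    so4ToSu2_smul, ← skew_constCurvature]
  have h (M : Matrix (Fin 2) (Fin 2) ℂ) : ((2 * Λ : ℝ) : ℂ) • M.map star =
      (((2 * Λ : ℝ) : ℂ) • M).map star := by
    ext A B
    have h0 : star ((2 * Λ : ℝ) : ℂ) = ((2 * Λ : ℝ) : ℂ) := Complex.conj_ofReal _
    change ((2 * Λ : ℝ) : ℂ) * star (M A B) = star (((2 * Λ : ℝ) : ℂ) * M A B)
    rw [star_mul', h0]
  rw [← h, smul_mulVec]
  simp only [skew_eq, Pi.smul_apply, smul_eq_mul]
  push_cast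
  ring

lemma trace_spinConnAt (i : ι) (x : X) (v : TangentSpace (𝓡 4) x) :
    trace (s.spinConnAt i x v) = 0 := by
  have h := congrArg star (trace_so4ToSu2_of_skew (s.connMatrix_skew i x v))
  rw [trace_fin_two, star_add, star_zero] at h
  rw [trace_fin_two]
  exact h

lemma spinConnCoord_self (i : ι) (x : X) (v : E4) :
    s.spinConnCoord i x v x = s.spinConnAt i x v := by
  rw [spinConnCoord, coordField_self]

lemma contMDiffAt_spinConnCoord {i : ι} {x : X} (hx : x ∈ s.baseSet i) (v : E4) (A B : Fin 2) :
    ContMDiffAt (𝓡 4) 𝓘(ℝ, ℂ) ∞ (fun y => s.spinConnCoord i x v y A B) x := by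
  have h : (fun y => s.spinConnCoord i x v y A B) = fun y => ∑ b, ∑ c,
      Complex.ofRealCLM (s.connCoord i x v c b y) *
        star ((-(1 / 4) : ℂ) * ((q b)ᴴ * q c) A B) := by
    funext y
    exact map_star_so4ToSu2_apply _ A B
  rw [h]
  refine contMDiffAt_finsetSum fun b _ => contMDiffAt_finsetSum fun c _ => ?_
  exact ((Complex.ofRealCLM.contDiff.mul contDiff_const).contMDiff.contMDiffAt).comp x
    (s.contMDiffAt_connCoord hx v c b)

lemma dirDeriv_spinConnCoord {i : ι} {x : X} (hx : x ∈ s.baseSet i) (v w : E4) (A B : Fin 2) :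
    dirDeriv (fun y => s.spinConnCoord i x w y A B) x v =
      (so4ToSu2 (s.connCoordDeriv i x v w)).map star A B :=
  (hasDerivAt_coordLine ((s.contMDiffAt_spinConnCoord hx w A B).mdifferentiableAt (by simp))
    v).unique (hasDerivAt_map_star_so4ToSu2 (fun c b => hasDerivAt_coordLine
      ((s.contMDiffAt_connCoord hx w c b).mdifferentiableAt (by simp)) v) A B)

lemma contDiffAt_spinConnCoord_symm (x : X) (v : E4) (z : Fin 2 → ℂ) (A B : Fin 2) :
    ContDiffAt ℝ ∞ (fun u : E4 × (Fin 2 → ℂ) => s.spinConnCoord (s.indexAt x) x v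
      ((extChartAt (𝓡 4) x).symm u.1) A B) (extChartAt (𝓡 4) x x, z) := by
  have h1 : ContMDiffAt 𝓘(ℝ, E4) 𝓘(ℝ, ℂ) ∞ (fun y => s.spinConnCoord (s.indexAt x) x v
      ((extChartAt (𝓡 4) x).symm y) A B) (extChartAt (𝓡 4) x x) := by
    refine ContMDiffAt.comp (I' := 𝓡 4) (g := fun y => s.spinConnCoord (s.indexAt x) x v y A B)
      (extChartAt (𝓡 4) x x) ?_
      ((contMDiffOn_extChartAt_symm x).contMDiffAt (extChartAt_target_mem_nhds x))
    rw [extChartAt_to_inv]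
    exact s.contMDiffAt_spinConnCoord (s.mem_baseSet_at x) v A B
  exact h1.contDiffAt.comp (extChartAt (𝓡 4) x x, z) contDiffAt_fst

lemma extChartAt_spinor (p : s.Spinor) :
    extChartAt modelS p p = (extChartAt (𝓡 4) p.1 p.1, (p.2 : Fin 2 → ℂ)) := by
  rw [FiberBundle.extChartAt]
  exact Prod.ext rfl (s.coord_indexAt p)

lemma smoothAt_tau (p : s.Spinor) : DiffForm.SmoothAt modelS s.tau p := by
  refine DiffForm.contDiffAt_iff_apply.2 fun V => ?_
  have hV : V = ![V 0] := by
    funext i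
    fin_cases i
    rfl
  rw [hV]
  have h : (fun u => DiffForm.inChart modelS s.tau p u ![V 0]) =ᶠ[𝓝 (extChartAt modelS p p)]
      fun u : E4 × (Fin 2 → ℂ) => skew u.2 ((V 0).2 +
      s.spinConnCoord (s.indexAt p.1) p.1 (V 0).1 ((extChartAt (𝓡 4) p.1).symm u.1) *ᵥ u.2) := by
    filter_upwards [extChartAt_target_mem_nhds (I := modelS) p] with u hu
    exact s.inChart_tau p hu _
  refine ContDiffAt.congr_of_eventuallyEq ?_ h
  rw [extChartAt_spinor]
  have h1 := s.contDiffAt_spinConnCoord_symm p.1 (V 0).1 p.2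
  have h2 (A : Fin 2) : ContDiffAt ℝ ∞ (fun u : E4 × (Fin 2 → ℂ) => u.2 A)
      (extChartAt (𝓡 4) p.1 p.1, (p.2 : Fin 2 → ℂ)) := by fun_prop
  simp only [skew_eq, mulVec, dotProduct, Fin.sum_univ_two, Pi.add_apply]
  exact ((h2 0).mul (contDiffAt_const.add (((h1 1 0).mul (h2 0)).add ((h1 1 1).mul (h2 1))))).sub
    ((h2 1).mul (contDiffAt_const.add (((h1 0 0).mul (h2 0)).add ((h1 0 1).mul (h2 1)))))

lemma differentiableAt_inChart_tau (p : s.Spinor) :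
    DifferentiableAt ℝ (DiffForm.inChart modelS s.tau p) (extChartAt modelS p p) :=
  (s.smoothAt_tau p).differentiableAt (by simp)

lemma deltaPi_eq (p : s.Spinor) (V : E4 × (Fin 2 → ℂ)) :
    s.deltaPi p V = V.2 + s.spinConnAt (s.indexAt p.1) p.1 V.1 *ᵥ (p.2 : Fin 2 → ℂ) :=
  (s.deltaPi_apply p V).trans (congrArg₂ (fun (a : Fin 2 → ℂ) (b : TangentSpace (𝓡 4) p.1) =>
    a + s.spinConnAt (s.indexAt p.1) p.1 b *ᵥ (p.2 : Fin 2 → ℂ)) (s.dFibre_apply p V)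
    (s.dBase_apply p V))

/-- The form `η` with values in `𝕊`, the contraction of the soldering form with `π`. -/
def eta (p : s.Spinor) (V : TangentSpace modelS p) : Fin 2 → ℂ :=
  contract p.2 (s.components p.1 (s.dBase p V))

lemma eta_eq (p : s.Spinor) (V : E4 × (Fin 2 → ℂ)) :
    s.eta p V = contract p.2 (s.components p.1 V.1) :=
  congrArg (fun b : TangentSpace (𝓡 4) p.1 => contract p.2 (s.components p.1 b))
    (s.dBase_apply p V)

/-- Derivative along t ↦ p + tV in the chart. The argument W is constant there, so its connection
term is Γ along the coordinate field of W.1, evaluated on a coordinate line of the base. -/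
lemma fderiv_inChart_tau (p : s.Spinor) (V W : E4 × (Fin 2 → ℂ)) :
    fderiv ℝ (DiffForm.inChart modelS s.tau p) (extChartAt modelS p p) V ![W] =
      skew V.2 (s.deltaPi p W) + skew (p.2 : Fin 2 → ℂ)
        ((so4ToSu2 (s.connCoordDeriv (s.indexAt p.1) p.1 V.1 W.1)).map star *ᵥ
          (p.2 : Fin 2 → ℂ) +
        s.spinConnAt (s.indexAt p.1) p.1 W.1 *ᵥ V.2) := by
  rw [s.deltaPi_eq p W]
  set z : Fin 2 → ℂ := p.2 with hz
  have hz0 : z + (0 : ℝ) • V.2 = z := by rw [zero_smul, add_zero]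
  have hx := s.mem_baseSet_at p.1
  rw [← DiffForm.fderiv_form_apply (s.differentiableAt_inChart_tau p)]
  have hd : DifferentiableAt ℝ (fun u => DiffForm.inChart modelS s.tau p u ![W])
      (extChartAt modelS p p) :=
    ((DiffForm.contDiffAt_iff_apply.1 (s.smoothAt_tau p)) ![W]).differentiableAt (by simp)
  have hl : HasDerivAt (fun t : ℝ => extChartAt modelS p p + t • V) V 0 := by
    simpa using ((hasDerivAt_id (0 : ℝ)).smul_const V).const_add (extChartAt modelS p p)
  have e0 : extChartAt modelS p p + (0 : ℝ) • V = extChartAt modelS p p := by simp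
  have h1 := HasFDerivAt.comp_hasDerivAt (0 : ℝ) (f := fun t : ℝ => extChartAt modelS p p + t • V)
    (l := fun u => DiffForm.inChart modelS s.tau p u ![W]) (by rw [e0]; exact hd.hasFDerivAt) hl
  have hev : (fun t : ℝ => DiffForm.inChart modelS s.tau p (extChartAt modelS p p + t • V) ![W])
      =ᶠ[𝓝 0] fun t => skew (z + t • V.2) (W.2 + s.spinConnCoord (s.indexAt p.1) p.1 W.1
        (chartLine (𝓡 4) p.1 V.1 t) *ᵥ (z + t • V.2)) := by
    have hc : ContinuousAt (fun t : ℝ => extChartAt modelS p p + t • V) 0 := by fun_prop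
    have ht := hc.tendsto
    rw [e0] at ht
    filter_upwards [ht.eventually (extChartAt_target_mem_nhds (I := modelS) p)] with t hu
    rw [s.inChart_tau p hu]
    rw [extChartAt_spinor]
    rfl
  have hz' (A : Fin 2) : HasDerivAt (fun t : ℝ => (z + t • V.2) A) (V.2 A) 0 := by
    have : HasDerivAt (fun t : ℝ => z + t • V.2) V.2 0 := by
      simpa using ((hasDerivAt_id (0 : ℝ)).smul_const V.2).const_add z
    exact hasDerivAt_pi.1 this A
  have hS (A B : Fin 2) := hasDerivAt_coordLine
    ((s.contMDiffAt_spinConnCoord hx W.1 A B).mdifferentiableAt (by simp)) V.1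
  have hM (A : Fin 2) := ((hS A 0).fun_mul (hz' 0)).fun_add ((hS A 1).fun_mul (hz' 1))
  have h2 := (((hz' 0).fun_mul ((hM 1).const_add (W.2 1))).fun_sub
    ((hz' 1).fun_mul ((hM 0).const_add (W.2 0))))
  have h3 := (h1.congr_of_eventuallyEq hev.symm).unique (h2.congr_of_eventuallyEq
    (Filter.Eventually.of_forall fun t => by
      simp only [skew_eq, mulVec, dotProduct, Fin.sum_univ_two, Pi.add_apply, Pi.smul_apply]))
  refine h3.trans ?_
  simp only [hz0]
  simp only [s.dirDeriv_spinConnCoord hx, chartLine_zero, spinConnCoord_self, skew_eq, mulVec, dotProduct, Fin.sum_univ_two, Pi.add_apply]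
  ring

lemma d_tau_apply_prod {Λ : ℝ} (hE : s.IsEinstein Λ) (hA : s.IsAntiSelfDual) (p : s.Spinor)
    (V W : E4 × (Fin 2 → ℂ)) :
    DiffForm.d modelS s.tau p ![V, W] =
      2 * skew (s.deltaPi p V) (s.deltaPi p W) + Λ * skew (s.eta p V) (s.eta p W) := by
  refine (DiffForm.d_apply s.tau p ![V, W]).trans ((DiffForm.extDeriv_one_apply _ _ V W).trans ?_)
  rw [s.fderiv_inChart_tau, s.fderiv_inChart_tau]
  rw [s.eta_eq p V, s.eta_eq p W, s.deltaPi_eq p V, s.deltaPi_eq p W]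
  set z : Fin 2 → ℂ := p.2 with hz
  have h1 := s.skew_curvatureForm hE hA p.1 V.1 W.1 z
  have h2 := map_star_so4ToSu2_curvature (s.connMatrix_skew (s.indexAt p.1) p.1 V.1)
    (s.connMatrix_skew (s.indexAt p.1) p.1 W.1) (s.connCoordDeriv (s.indexAt p.1) p.1 V.1 W.1)
    (s.connCoordDeriv (s.indexAt p.1) p.1 W.1 V.1)
  exact (skew_curvature_aux (s.trace_spinConnAt _ _ _) (s.trace_spinConnAt _ _ _) _ _ _ _ z).trans
    (congrArg (_ + ·) ((congrArg (fun M => skew z (M *ᵥ z)) h2.symm).trans h1))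

/-- The differential of `τ̃` for an anti self-dual Einstein metric. -/
lemma d_tau_apply {Λ : ℝ} (hE : s.IsEinstein Λ) (hA : s.IsAntiSelfDual) (p : s.Spinor)
    (V W : TangentSpace modelS p) :
    DiffForm.d modelS s.tau p ![V, W] =
      2 * skew (s.deltaPi p V) (s.deltaPi p W) + Λ * skew (s.eta p V) (s.eta p W) :=
  s.d_tau_apply_prod hE hA p V W

end SpinStructure

namespace SpinStructure

open Spin4

variable {X : Type*} [TopologicalSpace X] [ChartedSpace E4 X] [IsManifold (𝓡 4) ∞ X]
  {g : Metric4 X} {ι : Type*} (s : SpinStructure g ι)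

/-! #### The forms `τ̃ ∧ dτ̃` and `d(τ̃ ∧ dτ̃)` -/

/-- The fibre coordinates of a spinor in the preferred trivialisation. -/
def fibre (p : s.Spinor) : Fin 2 → ℂ := p.2

/-- The δπ ∧ δπ part of dτ̃ drops out: for three vectors d₁, d₂, d₃ of ℂ² the cyclic sum of ε(π, d₁)
ε(d₂, d₃) is zero. -/
lemma tauDTau_apply {Λ : ℝ} (hE : s.IsEinstein Λ) (hA : s.IsAntiSelfDual) (p : s.Spinor)
    (V₁ V₂ V₃ : TangentSpace modelS p) :
    s.tauDTau p ![V₁, V₂, V₃] =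
      Λ * (skew (s.fibre p) (s.deltaPi p V₁) * skew (s.eta p V₂) (s.eta p V₃) -
        skew (s.fibre p) (s.deltaPi p V₂) * skew (s.eta p V₁) (s.eta p V₃) +
        skew (s.fibre p) (s.deltaPi p V₃) * skew (s.eta p V₁) (s.eta p V₂)) := by
  refine (DiffForm.wedge₁₂_apply (V := E4 × (Fin 2 → ℂ)) (s.tau p) (DiffForm.d modelS s.tau p)
    V₁ V₂ V₃).trans ?_
  change s.tau p ![V₁] * DiffForm.d modelS s.tau p ![V₂, V₃] -
    s.tau p ![V₂] * DiffForm.d modelS s.tau p ![V₁, V₃] +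
    s.tau p ![V₃] * DiffForm.d modelS s.tau p ![V₁, V₂] = _
  have e (V : TangentSpace modelS p) : s.tau p ![V] = skew (s.fibre p) (s.deltaPi p V) :=
    s.tau_apply p V
  rw [s.d_tau_apply hE hA, s.d_tau_apply hE hA, s.d_tau_apply hE hA, e, e, e]
  generalize s.deltaPi p V₁ = d₁
  generalize s.deltaPi p V₂ = d₂
  generalize s.deltaPi p V₃ = d₃
  simp only [skew_eq]
  ring

lemma inChart_tauDTau (p : s.Spinor) {u : E4 × (Fin 2 → ℂ)}
    (hu : u ∈ (extChartAt modelS p).target) :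
    DiffForm.inChart modelS s.tauDTau p u = DiffForm.wedge₁₂ (DiffForm.inChart modelS s.tau p u)
      (extDeriv (DiffForm.inChart modelS s.tau p) u) := by
  rw [← DiffForm.inChart_d s.differentiableAt_inChart_tau hu]
  exact DiffForm.wedge₁₂_compContinuousLinearMap (E := E4 × (Fin 2 → ℂ))
    (F := E4 × (Fin 2 → ℂ)) _ _ _

lemma inChart_tauDTau_eventuallyEq (p : s.Spinor) :
    DiffForm.inChart modelS s.tauDTau p =ᶠ[𝓝 (extChartAt modelS p p)]
      fun u => DiffForm.wedge₁₂ (DiffForm.inChart modelS s.tau p u)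
        (extDeriv (DiffForm.inChart modelS s.tau p) u) := by
  filter_upwards [extChartAt_target_mem_nhds (I := modelS) p] with u hu
  exact s.inChart_tauDTau p hu

lemma smoothAt_tauDTau (p : s.Spinor) : DiffForm.SmoothAt modelS s.tauDTau p :=
  (DiffForm.contDiffAt_wedge₁₂ (s.smoothAt_tau p)
    (DiffForm.contDiffAt_extDeriv (s.smoothAt_tau p))).congr_of_eventuallyEq
    (s.inChart_tauDTau_eventuallyEq p)

/-- This is dτ̃ ∧ dτ̃, since ddτ̃ = 0; the six shuffle terms coincide in pairs, whence the factor 2.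
-/
lemma d_tauDTau_apply (p : s.Spinor) (V₀ V₁ V₂ V₃ : TangentSpace modelS p) :
    DiffForm.d modelS s.tauDTau p ![V₀, V₁, V₂, V₃] =
      2 * (DiffForm.d modelS s.tau p ![V₀, V₁] * DiffForm.d modelS s.tau p ![V₂, V₃] -
        DiffForm.d modelS s.tau p ![V₀, V₂] * DiffForm.d modelS s.tau p ![V₁, V₃] +
        DiffForm.d modelS s.tau p ![V₀, V₃] * DiffForm.d modelS s.tau p ![V₁, V₂]) := by
  have ht := s.smoothAt_tau p
  have hw := DiffForm.contDiffAt_extDeriv ht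
  have e (V W : TangentSpace modelS p) : DiffForm.d modelS s.tau p ![V, W] =
      extDeriv (DiffForm.inChart modelS s.tau p) (extChartAt modelS p p) ![V, W] :=
    DiffForm.d_apply s.tau p ![V, W]
  refine (DiffForm.d_apply s.tauDTau p ![V₀, V₁, V₂, V₃]).trans ?_
  rw [e, e, e, e, e, e, (s.inChart_tauDTau_eventuallyEq p).extDeriv_eq]
  refine (DiffForm.extDeriv_wedge₁₂_apply (E := E4 × (Fin 2 → ℂ)) (ht.differentiableAt (by simp))
    (hw.differentiableAt (by simp))
    ((DiffForm.contDiffAt_wedge₁₂ ht hw).differentiableAt (by simp))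
    (extDeriv_extDeriv_apply ht DiffForm.minSmoothness_two_le) V₀ V₁ V₂ V₃).trans ?_
  ring

/-! #### Compatibility with the complex structure -/

lemma components_baseAcs (x : X) (z : Fin 2 → ℂ) (v : TangentSpace (𝓡 4) x) :
    s.components x (s.baseAcs x z v) =
      fun a => ∑ b, coeff a b (fun Y => Y * acsMatrix z) * s.components x v b := by
  have h : s.baseAcs x z v = ∑ a, (∑ b, coeff a b (fun Y => Y * acsMatrix z) *
      s.components x v b) • s.frame (s.indexAt x) a x := by
    rw [baseAcs]
    refine (_root_.sum_apply _ _ _).trans (Finset.sum_congr rfl fun a _ => ?_)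
    refine (_root_.sum_apply _ _ _).trans ?_
    rw [Finset.sum_smul]
    refine Finset.sum_congr rfl fun b _ => ?_
    rw [mul_smul]
    rfl
  funext a
  rw [components, h, coframe_sum]
  refine (Finset.sum_congr rfl fun b _ => ?_).trans (Finset.sum_ite_eq Finset.univ a
    (fun a => ∑ b, coeff a b (fun Y => Y * acsMatrix z) * s.components x v b)) |>.trans
    (if_pos (Finset.mem_univ a))
  rw [map_smul, s.coframe_frame (s.mem_baseSet_at x)]
  split_ifs with hab <;> simp

lemma eta_acs {p : s.Spinor} (hp : s.fibre p ≠ 0) (V : TangentSpace modelS p) :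
    s.eta p (s.acs p V) = Complex.I • s.eta p V := by
  have h : s.components p.1 (s.dBase p (s.acs p V)) = fun a => ∑ b,
      coeff a b (fun Y => Y * acsMatrix (s.fibre p)) * s.components p.1 (s.dBase p V) b := by
    rw [dBase_acs]
    exact s.components_baseAcs p.1 (s.fibre p) (s.dBase p V)
  exact (congrArg (contract (s.fibre p)) h).trans (contract_coeff_acsMatrix hp _)

lemma skew_smul_right (c : ℂ) (z w : Fin 2 → ℂ) : skew z (c • w) = c * skew z w := by
  simp only [skew_eq, Pi.smul_apply, smul_eq_mul]
  ring

lemma skew_smul_left (c : ℂ) (z w : Fin 2 → ℂ) : skew (c • z) w = c * skew z w := by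
  simp only [skew_eq, Pi.smul_apply, smul_eq_mul]
  ring

lemma skew_self (z : Fin 2 → ℂ) : skew z z = 0 := by
  simp only [skew_eq]
  ring

/-- Each vector enters linearly through δπ or η, and 𝕀 acts on both as multiplication by i. -/
lemma isTypeK0_tauDTau {Λ : ℝ} (hE : s.IsEinstein Λ) (hA : s.IsAntiSelfDual) {p : s.Spinor}
    (hp : s.fibre p ≠ 0) : DiffForm.IsTypeK0 (s.acs p) (s.tauDTau p) := by
  intro v j
  have hv : v = ![v 0, v 1, v 2] := by
    funext i
    fin_cases i <;> rfl
  have hu : Function.update v j (s.acs p (v j)) =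
      ![Function.update v j (s.acs p (v j)) 0, Function.update v j (s.acs p (v j)) 1,
        Function.update v j (s.acs p (v j)) 2] := by
    funext i
    fin_cases i <;> rfl
  rw [hu]
  conv_rhs => rw [hv]
  rw [s.tauDTau_apply hE hA, s.tauDTau_apply hE hA]
  fin_cases j <;>
    simp [Function.update, s.eta_acs hp, s.deltaPi_acs, skew_smul_left, skew_smul_right] <;> ring

lemma isTypeK0_d_tauDTau {Λ : ℝ} (hE : s.IsEinstein Λ) (hA : s.IsAntiSelfDual) {p : s.Spinor}
    (hp : s.fibre p ≠ 0) : DiffForm.IsTypeK0 (s.acs p) (DiffForm.d modelS s.tauDTau p) := by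
  intro v j
  have hv : v = ![v 0, v 1, v 2, v 3] := by
    funext i
    fin_cases i <;> rfl
  have hu : Function.update v j (s.acs p (v j)) =
      ![Function.update v j (s.acs p (v j)) 0, Function.update v j (s.acs p (v j)) 1,
        Function.update v j (s.acs p (v j)) 2, Function.update v j (s.acs p (v j)) 3] := by
    funext i
    fin_cases i <;> rfl
  rw [hu]
  conv_rhs => rw [hv]
  rw [d_tauDTau_apply, d_tauDTau_apply]
  simp only [s.d_tau_apply hE hA]
  fin_cases j <;>
    simp [Function.update, s.eta_acs hp, s.deltaPi_acs, skew_smul_left, skew_smul_right] <;> ring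

/-- The vertical tangent vector `w`. -/
def vertical (p : s.Spinor) (w : Fin 2 → ℂ) : TangentSpace modelS p := ((0 : E4), w)

lemma dBase_vertical (p : s.Spinor) (w : Fin 2 → ℂ) : s.dBase p (s.vertical p w) = 0 :=
  s.dBase_apply p _

lemma deltaPi_vertical (p : s.Spinor) (w : Fin 2 → ℂ) : s.deltaPi p (s.vertical p w) = w := by
  change s.dFibre p _ + s.connTerm p.1 p.2 (s.dBase p _) = w
  rw [dBase_vertical, map_zero, add_zero]
  exact s.dFibre_apply p _

lemma contract_zero (z : Fin 2 → ℂ) : contract z 0 = 0 := by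
  simp [contract, quat]

lemma components_zero (x : X) : s.components x 0 = 0 := by
  funext a
  exact map_zero _

lemma eta_vertical (p : s.Spinor) (w : Fin 2 → ℂ) : s.eta p (s.vertical p w) = 0 := by
  rw [eta, dBase_vertical, components_zero]
  exact contract_zero _

/-- Tangent vectors are determined by their horizontal and vertical components. -/
lemma tangent_ext {p : s.Spinor} {V W : TangentSpace modelS p} (h1 : s.dBase p V = s.dBase p W)
    (h2 : s.deltaPi p V = s.deltaPi p W) : V = W := by
  have h3 : s.dFibre p V = s.dFibre p W := by
    change s.dFibre p V + s.connTerm p.1 p.2 (s.dBase p V) =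
      s.dFibre p W + s.connTerm p.1 p.2 (s.dBase p W) at h2
    rw [h1] at h2
    exact add_right_cancel h2
  exact Prod.ext ((s.dBase_apply p V).symm.trans (h1.trans (s.dBase_apply p W)))
    ((s.dFibre_apply p V).symm.trans (h3.trans (s.dFibre_apply p W)))

lemma eta_add (p : s.Spinor) (V W : TangentSpace modelS p) :
    s.eta p (V + W) = s.eta p V + s.eta p W := by
  have h (a : Fin 4) : s.components p.1 (s.dBase p (V + W)) a =
      s.components p.1 (s.dBase p V) a + s.components p.1 (s.dBase p W) a := by
    rw [components, map_add, map_add]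
    rfl
  simp only [eta, contract, quat, h, Complex.ofReal_add, add_smul, Finset.sum_add_distrib,
    add_mulVec]

/-- On cπ one has η = 0 and δπ = cπ, so dτ̃(cπ, V) = 2c τ̃(V). With the factor 2 of dτ̃ ∧ dτ̃ this
gives 4c, in accordance with the homogeneity degree 4. -/
lemma d_tauDTau_vertical {Λ : ℝ} (hE : s.IsEinstein Λ) (hA : s.IsAntiSelfDual) (p : s.Spinor)
    (c : ℂ) (V₁ V₂ V₃ : TangentSpace modelS p) :
    DiffForm.d modelS s.tauDTau p ![s.vertical p (c • s.fibre p), V₁, V₂, V₃] =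
      4 * c * s.tauDTau p ![V₁, V₂, V₃] := by
  rw [d_tauDTau_apply, s.tauDTau_apply hE hA]
  simp only [s.d_tau_apply hE hA, deltaPi_vertical, eta_vertical, skew_smul_left]
  have h0 (w : Fin 2 → ℂ) : skew 0 w = 0 := by simp [skew_eq]
  simp only [h0, skew_eq]
  ring

/-- η sees only the base component, and a vertical vector then corrects δπ without changing η. -/
lemma exists_eta_eq_deltaPi_eq {p : s.Spinor} (hp : s.fibre p ≠ 0) (y w : Fin 2 → ℂ) :
    ∃ V : TangentSpace modelS p, s.eta p V = y ∧ s.deltaPi p V = w := by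
  obtain ⟨v, hv⟩ := contract_quat_surjective hp y
  have h : ∃ V : TangentSpace modelS p, s.eta p V = y := by
    refine ⟨((∑ a, v a • s.frame (s.indexAt p.1) a p.1 : TangentSpace (𝓡 4) p.1),
      (0 : Fin 2 → ℂ)), ?_⟩
    rw [← hv, eta_eq]
    congr 1
    funext a
    rw [components, coframe_sum]
    refine (Finset.sum_congr rfl fun b _ => ?_).trans (Finset.sum_ite_eq Finset.univ a v) |>.trans
      (if_pos (Finset.mem_univ a))
    rw [map_smul, s.coframe_frame (s.mem_baseSet_at p.1)]
    split_ifs with hab <;> simp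
  obtain ⟨V, hV⟩ := h
  refine ⟨V + s.vertical p (w - s.deltaPi p V), ?_, ?_⟩
  · rw [eta_add, eta_vertical, add_zero, hV]
  · rw [map_add, deltaPi_vertical, add_sub_cancel]

lemma exists_skew_eq {z : Fin 2 → ℂ} (hz : z ≠ 0) (t : ℂ) : ∃ w, skew z w = t := by
  by_cases h0 : z 0 = 0
  · have h1 : z 1 ≠ 0 := fun h1 => hz (funext fun A => by fin_cases A <;> assumption)
    refine ⟨![-t / z 1, 0], ?_⟩
    simp only [skew_eq, h0, cons_val_zero, cons_val_one, mul_zero, zero_sub]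
    field_simp
  · refine ⟨![0, t / z 0], ?_⟩
    simp only [skew_eq, cons_val_zero, cons_val_one, mul_zero, sub_zero]
    field_simp

lemma exists_tauDTau_ne_zero {Λ : ℝ} (hΛ : Λ ≠ 0) (hE : s.IsEinstein Λ)
    (hA : s.IsAntiSelfDual) {p : s.Spinor} (hp : s.fibre p ≠ 0) :
    ∃ V₁ V₂ V₃ : TangentSpace modelS p, s.tauDTau p ![V₁, V₂, V₃] ≠ 0 := by
  obtain ⟨w, hw⟩ := exists_skew_eq hp 1
  obtain ⟨V₁, h₁, h₁'⟩ := s.exists_eta_eq_deltaPi_eq hp 0 w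
  obtain ⟨V₂, h₂, h₂'⟩ := s.exists_eta_eq_deltaPi_eq hp ![1, 0] 0
  obtain ⟨V₃, h₃, h₃'⟩ := s.exists_eta_eq_deltaPi_eq hp ![0, 1] 0
  -- These vectors are dual to τ̃, η⁰, η¹, so the value is Λ.
  refine ⟨V₁, V₂, V₃, ?_⟩
  rw [s.tauDTau_apply hE hA, h₁, h₂, h₃, h₁', h₂', h₃', hw]
  simpa [skew_eq] using hΛ

end SpinStructure

/-! ### Membership in a line of a projective space -/

namespace Projectivization

variable {K V : Type*} [Field K] [AddCommGroup V] [Module K V]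

lemma mem_submodule_iff (l : ℙ K V) (v : V) : v ∈ l.submodule ↔ ∃ c : K, c • l.rep = v := by
  rw [l.submodule_eq, Submodule.mem_span_singleton]

lemma mem_submodule_mk_iff {w : V} (hw : w ≠ 0) (v : V) :
    v ∈ (Projectivization.mk K w hw).submodule ↔ ∃ c : K, c • w = v := by
  rw [submodule_mk, Submodule.mem_span_singleton]

end Projectivization

namespace SpinStructure

open Spin4

variable {X : Type*} [TopologicalSpace X] [ChartedSpace E4 X] [IsManifold (𝓡 4) ∞ X]
  {g : Metric4 X} {ι : Type*} (s : SpinStructure g ι)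

/-! #### Smoothness of the projection to `ℙ(𝕊')` and of its local sections -/

lemma toProj_of_ne_zero {p : s.Spinor} (hp : s.fibre p ≠ 0) :
    s.toProj p = ⟨p.1, Projectivization.mk ℂ p.2 hp⟩ :=
  dif_pos hp

lemma coord_ne_zero_iff (i : ι) (p : s.Spinor) : s.coord i p ≠ 0 ↔ s.fibre p ≠ 0 := by
  constructor
  · intro h h0
    apply h
    have : s.coord i p = s.spinorChange (s.indexAt p.1) i p.1 *ᵥ s.fibre p := rfl
    rw [this, h0, mulVec_zero]
  · exact fun h => rhoMinus_mulVec_ne_zero _ h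

lemma coord_fibre (p : s.Spinor) : s.coord (s.indexAt p.1) p = s.fibre p := s.coord_indexAt p

lemma lineCoord_toProj (i : ι) {p : s.Spinor} (hp : s.fibre p ≠ 0) :
    ∃ c : ℂ, c ≠ 0 ∧ s.lineCoord i (s.toProj p) = c • s.coord i p := by
  rw [s.toProj_of_ne_zero hp]
  obtain ⟨c, hc⟩ := Projectivization.exists_smul_eq_mk_rep ℂ (p.2 : s.core.Fiber p.1) hp
  refine ⟨c, c.ne_zero, ?_⟩
  change s.spinorChange (s.indexAt p.1) i p.1 *ᵥ
    ((Projectivization.mk ℂ (p.2 : s.core.Fiber p.1) hp).rep : Fin 2 → ℂ) = _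
  rw [← hc]
  exact mulVec_smul _ (c : ℂ) (p.2 : Fin 2 → ℂ)

lemma extChartAt_projSpinor (q r : s.ProjSpinor) :
    extChartAt modelP q r = (extChartAt (𝓡 4) q.pt r.pt,
      s.lineCoord (s.indexAt q.pt) r (s.affineIdx q).rev /
        s.lineCoord (s.indexAt q.pt) r (s.affineIdx q)) := rfl

lemma mem_extChartAt_projSpinor (q r : s.ProjSpinor) : r ∈ (extChartAt modelP q).source ↔
    r.pt ∈ (extChartAt (𝓡 4) q.pt).source ∧ r.pt ∈ s.baseSet (s.indexAt q.pt) ∧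
      s.lineCoord (s.indexAt q.pt) r (s.affineIdx q) ≠ 0 := by
  rw [extChartAt_source, extChartAt_source]
  exact and_assoc

lemma contMDiffAt_pt (q : s.ProjSpinor) :
    ContMDiffAt modelP (𝓡 4) ∞ (fun r : s.ProjSpinor => r.pt) q := by
  have h1 : ContMDiffAt modelP 𝓘(ℝ, E4) ∞ (fun r => (extChartAt modelP q r).1) q :=
    (contDiff_fst.contMDiff.contMDiffAt).comp q contMDiffAt_extChartAt
  have h2 : ContMDiffAt 𝓘(ℝ, E4) (𝓡 4) ∞ (extChartAt (𝓡 4) q.pt).symm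
      (extChartAt modelP q q).1 :=
    (contMDiffOn_extChartAt_symm q.pt).contMDiffAt
      (extChartAt_target_mem_nhds (I := 𝓡 4) q.pt :)
  refine (h2.comp q h1).congr_of_eventuallyEq ?_
  filter_upwards [extChartAt_source_mem_nhds (I := modelP) q] with r hr
  exact ((extChartAt (𝓡 4) q.pt).left_inv ((s.mem_extChartAt_projSpinor q r).1 hr).1).symm

/-- In charts the projection is (x, z) ↦ (x, z_{a'}/z_a). The arbitrary representative of a line
enters only through such ratios. -/
lemma contMDiffAt_toProj {p : s.Spinor} (hp : s.fibre p ≠ 0) :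
    ContMDiffAt modelS modelP ∞ s.toProj p := by
  set q := s.toProj p with hq
  have hpt : q.pt = p.1 := by rw [hq, s.toProj_of_ne_zero hp]
  set i := s.indexAt q.pt with hi
  set a := s.affineIdx q with ha
  have hpi : p.1 ∈ s.baseSet i := by
    rw [← hpt]
    exact s.mem_baseSet_at q.pt
  have hpa : s.coord i p a ≠ 0 := by
    obtain ⟨c, hc, h⟩ := s.lineCoord_toProj i hp
    have h1 := s.lineCoord_affineIdx_ne_zero q
    intro h0
    apply h1
    change s.lineCoord i (s.toProj p) a = 0
    rw [h, Pi.smul_apply, h0, smul_zero]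
  have hc := s.contMDiffAt_coord hpi
  have hF : ContMDiffAt modelS 𝓘(ℝ, E4 × ℂ) ∞ (fun r : s.Spinor =>
      (extChartAt (𝓡 4) q.pt r.1, s.coord i r a.rev / s.coord i r a)) p := by
    refine ContMDiffAt.prodMk_space ?_ ?_
    · refine ContMDiffAt.comp (I' := 𝓡 4) p (contMDiffAt_extChartAt' ?_) (s.contMDiffAt_proj p)
      rw [← hpt]
      exact mem_chart_source E4 q.pt
    · have hd : ContDiffAt ℝ ∞ (fun z : Fin 2 → ℂ => z a.rev / z a) (s.coord i p) := by
        simp only [div_eq_mul_inv]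
        exact ContDiffAt.mul (by fun_prop) (ContDiffAt.inv (by fun_prop) hpa)
      exact hd.contMDiffAt.comp p hc
  have hev : ∀ᶠ r in 𝓝 p, s.toProj r ∈ (extChartAt modelP q).source ∧ extChartAt modelP q
      (s.toProj r) = (extChartAt (𝓡 4) q.pt r.1, s.coord i r a.rev / s.coord i r a) := by
    have hca : ∀ᶠ r in 𝓝 p, s.coord i r a ≠ 0 :=
      ((continuous_apply a).continuousAt.comp hc.continuousAt).eventually_ne hpa
    have hch : ∀ᶠ r in 𝓝 p, r.1 ∈ (extChartAt (𝓡 4) q.pt).source := by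
      refine (s.contMDiffAt_proj p).continuousAt.eventually ?_
      change ∀ᶠ x in 𝓝 p.1, x ∈ (extChartAt (𝓡 4) q.pt).source
      rw [← hpt]
      exact extChartAt_source_mem_nhds q.pt
    filter_upwards [hca, hch, s.eventually_mem_baseSet hpi] with r h1 h2 h3
    have hr : s.fibre r ≠ 0 := (s.coord_ne_zero_iff i r).1 fun h => h1 (by rw [h]; rfl)
    obtain ⟨c, hc, h⟩ := s.lineCoord_toProj i hr
    have hrpt : (s.toProj r).pt = r.1 := by rw [s.toProj_of_ne_zero hr]
    rw [mem_extChartAt_projSpinor, extChartAt_projSpinor, hrpt, ← hi, ← ha, h]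
    refine ⟨⟨h2, h3, mul_ne_zero hc h1⟩, Prod.ext rfl ?_⟩
    exact mul_div_mul_left _ _ hc
  have h0 := hev.self_of_nhds
  refine ContMDiffAt.congr_of_eventuallyEq (f := (extChartAt modelP q).symm ∘ fun r : s.Spinor =>
      (extChartAt (𝓡 4) q.pt r.1, s.coord i r a.rev / s.coord i r a)) ?_ ?_
  · refine ContMDiffAt.comp p ?_ hF
    rw [← h0.2]
    exact (contMDiffOn_extChartAt_symm q).contMDiffAt (extChartAt_target_mem_nhds q)
  · filter_upwards [hev] with r hr
    rw [Function.comp_apply, ← hr.2, (extChartAt modelP q).left_inv hr.1]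

/-- The local section of the tautological bundle whose `a`-th coordinate in the trivialisation `i`
is `1`. -/
def affineSection (i : ι) (a : Fin 2) (q : s.ProjSpinor) : s.taut q :=
  ⟨(s.lineCoord i q a)⁻¹ • q.line.rep, (Projectivization.mem_submodule_iff q.line _).2 ⟨_, rfl⟩⟩

lemma coord_affineLift (i : ι) (a : Fin 2) (q : s.ProjSpinor) :
    s.coord i (s.affineLift i a q) = (s.lineCoord i q a)⁻¹ • s.lineCoord i q :=
  mulVec_smul _ (s.lineCoord i q a)⁻¹ (q.line.rep : Fin 2 → ℂ)

/-- In the chart at q the fibre coordinates of this section are `affineVec a` of the affine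
coordinate. -/
lemma contMDiffAt_affineLift (q : s.ProjSpinor) : ContMDiffAt modelP modelS ∞
    (s.affineLift (s.indexAt q.pt) (s.affineIdx q)) q := by
  set i := s.indexAt q.pt with hi
  set a := s.affineIdx q with ha
  refine (s.contMDiffAt_iff_coord (f := s.affineLift i a) (s.mem_baseSet_at q.pt)).2
    ⟨s.contMDiffAt_pt q, ?_⟩
  have h1 : ContMDiffAt modelP 𝓘(ℝ, ℂ) ∞ (fun r => (extChartAt modelP q r).2) q :=
    (contDiff_snd.contMDiff.contMDiffAt).comp q contMDiffAt_extChartAt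
  have h2 : ContDiff ℝ ∞ (affineVec a) := by
    refine contDiff_pi.2 fun b => ?_
    by_cases h : b = a
    · simpa [affineVec, h] using contDiff_const
    · simpa [affineVec, h] using contDiff_fun_id
  refine (h2.contMDiff.contMDiffAt.comp q h1).congr_of_eventuallyEq ?_
  filter_upwards [extChartAt_source_mem_nhds (I := modelP) q] with r hr
  have hr0 : s.lineCoord i r a ≠ 0 := ((s.mem_extChartAt_projSpinor q r).1 hr).2.2
  rw [coord_affineLift, Function.comp_apply, extChartAt_projSpinor]
  funext b
  by_cases hb : b = a
  · subst hb
    simpa [affineVec] using inv_mul_cancel₀ hr0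
  · have : b = a.rev := by
      revert hb
      generalize a = a'
      revert a' b
      decide
    subst this
    simp only [affineVec, if_neg hb, Pi.smul_apply, smul_eq_mul]
    rw [mul_comm, div_eq_mul_inv]

lemma toProj_sectionMap (σ : ∀ q : s.ProjSpinor, s.taut q) {q : s.ProjSpinor} (hq : σ q ≠ 0) :
    s.toProj (s.sectionMap σ q) = q := by
  have h0 : s.fibre (s.sectionMap σ q) ≠ 0 := fun h => hq (Subtype.ext h)
  rw [s.toProj_of_ne_zero h0]
  obtain ⟨x, l⟩ := q
  refine congrArg (ProjSpinor.mk x) ?_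
  obtain ⟨c, hc⟩ := (Projectivization.mem_submodule_iff l _).1 (σ ⟨x, l⟩).2
  conv_rhs => rw [← l.mk_rep]
  exact (Projectivization.mk_eq_mk_iff' ℂ _ _ _ _).2 ⟨c, hc⟩

/-- The spinor over `q` given by an element of the tautological line. -/
def tautPoint {q : s.ProjSpinor} (v : s.taut q) : s.Spinor := ⟨q.pt, (v : s.core.Fiber q.pt)⟩

lemma fibre_tautPoint_ne_zero {q : s.ProjSpinor} {v : s.taut q} (hv : v ≠ 0) :
    s.fibre (s.tautPoint v) ≠ 0 := fun h => hv (Subtype.ext h)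

lemma toProj_tautPoint {q : s.ProjSpinor} {v : s.taut q} (hv : v ≠ 0) :
    s.toProj (s.tautPoint v) = q := by
  classical
  have h := s.toProj_sectionMap (Function.update (fun _ => 0) q v) (q := q)
    (by rwa [Function.update_self])
  rwa [sectionMap, Function.update_self] at h

lemma coord_sectionMap_toProj (i : ι) (σ : ∀ q : s.ProjSpinor, s.taut q) {p : s.Spinor}
    (hp : s.fibre p ≠ 0) :
    ∃ c : ℂ, s.coord i (s.sectionMap σ (s.toProj p)) = c • s.coord i p := by
  rw [s.toProj_of_ne_zero hp]
  obtain ⟨c, hc⟩ := (Projectivization.mem_submodule_mk_iff (V := s.core.Fiber p.1) hp _).1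
    (σ ⟨p.1, Projectivization.mk ℂ p.2 hp⟩).2
  refine ⟨c, ?_⟩
  change s.spinorChange (s.indexAt p.1) i p.1 *ᵥ
    ((σ ⟨p.1, Projectivization.mk ℂ p.2 hp⟩ : s.core.Fiber p.1) : Fin 2 → ℂ) = _
  rw [← hc]
  exact mulVec_smul _ (c : ℂ) (p.2 : Fin 2 → ℂ)

/-- The differential of a section of the tautological bundle, in terms of lifts of tangent
vectors of `ℙ(𝕊')` to another point of the same fibre. -/
lemma mfderiv_sectionMap_toProj {σ : ∀ q : s.ProjSpinor, s.taut q} {q : s.ProjSpinor}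
    (hσ : MDifferentiableAt modelP modelS (s.sectionMap σ) q) {v : s.taut q} (hv : v ≠ 0) {c₀ : ℂ}
    (hc₀ : σ q = c₀ • v) (V : TangentSpace modelS (s.tautPoint v)) :
    ∃ l : ℂ, (mfderiv modelP modelS (s.sectionMap σ) q
      (mfderiv modelS modelP s.toProj (s.tautPoint v) V) : E4 × (Fin 2 → ℂ)) =
      (s.dBase (s.tautPoint v) V, c₀ • s.dFibre (s.tautPoint v) V + l • s.fibre (s.tautPoint v)) := by
  let p := s.tautPoint v
  have hp : s.fibre p ≠ 0 := s.fibre_tautPoint_ne_zero hv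
  have hpq : s.toProj p = q := s.toProj_tautPoint hv
  have hdp : MDifferentiableAt modelS modelP s.toProj p :=
    (s.contMDiffAt_toProj hp).mdifferentiableAt (by simp)
  have hσ' : MDifferentiableAt modelP modelS (s.sectionMap σ) (s.toProj p) := by rwa [hpq]
  -- This composite is a dilation π ↦ c(π)π with variable factor, so its differential is c dz +
  -- (dc)π on the fibre part.
  set h : s.Spinor → s.Spinor := s.sectionMap σ ∘ s.toProj with hh
  have hdh : MDifferentiableAt modelS modelS h p := hσ'.comp p hdp
  have hhp : h p = s.sectionMap σ q := by rw [hh, Function.comp_apply, hpq]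
  have hcomp : (mfderiv modelP modelS (s.sectionMap σ) q
      (mfderiv modelS modelP s.toProj p V) : E4 × (Fin 2 → ℂ)) = mfderiv modelS modelS h p V := by
    rw [hh, mfderiv_comp p hσ' hdp, hpq]
    rfl
  suffices ∃ l : ℂ, (mfderiv modelS modelS h p V : E4 × (Fin 2 → ℂ)) =
      (s.dBase p V, c₀ • s.dFibre p V + l • s.fibre p) from
    this.imp fun l hl => hcomp.trans hl
  have hev : ∀ᶠ r in 𝓝 p, s.fibre r ≠ 0 := by
    have h1 : ∀ᶠ r in 𝓝 p, s.coord (s.indexAt p.1) r ≠ 0 :=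
      (s.contMDiffAt_coord (s.mem_baseSet_at p.1)).continuousAt.eventually_ne (by
        rwa [coord_fibre])
    filter_upwards [h1] with r hr
    exact (s.coord_ne_zero_iff _ r).1 hr
  set i := s.indexAt p.1 with hi
  have hpi : p.1 ∈ s.baseSet i := s.mem_baseSet_at p.1
  have hhi : (h p).1 ∈ s.baseSet i := by rw [hhp]; exact hpi
  have hpt (r : s.Spinor) (hr : s.fibre r ≠ 0) : (h r).1 = r.1 := by
    change (s.toProj r).pt = r.1
    rw [s.toProj_of_ne_zero hr]
  have e1 : s.dBase (h p) (mfderiv modelS modelS h p V) = s.dBase p V := by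
    have hc : MDifferentiableAt modelS (𝓡 4) (fun r : s.Spinor => r.1) (h p) :=
      (s.contMDiffAt_proj _).mdifferentiableAt (by simp)
    have h2 := mfderiv_comp p hc hdh
    have h3 : (fun r : s.Spinor => r.1) ∘ h =ᶠ[𝓝 p] fun r => r.1 := by
      filter_upwards [hev] with r hr
      exact hpt r hr
    rw [h3.mfderiv_eq] at h2
    exact (congrArg (fun L : (E4 × (Fin 2 → ℂ)) →L[ℝ] E4 => L V) h2).symm
  have hci : MDifferentiableAt modelS 𝓘(ℝ, Fin 2 → ℂ) (s.coord i) (h p) :=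
    (s.contMDiffAt_coord hhi).mdifferentiableAt (by simp)
  have e2 : s.dFibre (h p) (mfderiv modelS modelS h p V) =
      mfderiv modelS 𝓘(ℝ, Fin 2 → ℂ) (s.coord i ∘ h) p V := by
    rw [mfderiv_comp p hci hdh]
    have h2 : s.indexAt (h p).1 = i := by rw [hhp]; rfl
    rw [dFibre, h2]
    rfl
  have e3 : (mfderiv modelS modelS h p V : E4 × (Fin 2 → ℂ)) =
      (s.dBase (h p) (mfderiv modelS modelS h p V), s.dFibre (h p) (mfderiv modelS modelS h p V)) :=
    Prod.ext (s.dBase_apply (h p) _).symm (s.dFibre_apply (h p) _).symm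
  rw [e3, e1, e2]
  obtain ⟨b, hb⟩ : ∃ b, s.fibre p b ≠ 0 := by
    by_contra! h
    exact hp (funext h)
  have hl0 : chartLine modelS p V 0 = p := chartLine_zero modelS p V
  have hd1 (A : Fin 2) : HasDerivAt (fun t => s.coord i (chartLine modelS p V t) A)
      (s.dFibre p V A) 0 :=
    hasDerivAt_pi.1 (hasDerivAt_chartLine modelS
      ((s.contMDiffAt_coord hpi).mdifferentiableAt (by simp)) V) A
  have hd2 (A : Fin 2) : HasDerivAt (fun t => s.coord i (h (chartLine modelS p V t)) A)
      ((mfderiv modelS 𝓘(ℝ, Fin 2 → ℂ) (s.coord i ∘ h) p V : Fin 2 → ℂ) A) 0 :=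
    hasDerivAt_pi.1 (hasDerivAt_chartLine modelS (hci.comp p hdh) V) A
  have hb0 : s.coord i (chartLine modelS p V 0) b ≠ 0 := by
    rw [hl0, hi, coord_fibre]
    exact hb
  -- The factor c is recovered as a ratio of b-th coordinates, where z_b ≠ 0; its derivative D is
  -- the required l.
  obtain ⟨D, hdc⟩ : ∃ D, HasDerivAt (fun t => s.coord i (h (chartLine modelS p V t)) b /
      s.coord i (chartLine modelS p V t) b) D 0 := ⟨_, (hd2 b).fun_div (hd1 b) hb0⟩
  have hc0 : s.coord i (h p) = c₀ • s.fibre p := by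
    rw [hhp]
    have h1 : s.coord (s.indexAt (s.sectionMap σ q).1) (s.sectionMap σ q) =
        s.fibre (s.sectionMap σ q) := s.coord_fibre _
    refine h1.trans ?_
    change ((σ q : s.core.Fiber q.pt) : Fin 2 → ℂ) = _
    rw [hc₀]
    rfl
  have key (A : Fin 2) : (mfderiv modelS 𝓘(ℝ, Fin 2 → ℂ) (s.coord i ∘ h) p V : Fin 2 → ℂ) A =
      c₀ * s.dFibre p V A + D * s.fibre p A := by
    refine (hd2 A).unique ((hdc.fun_mul (hd1 A)).congr_of_eventuallyEq ?_) |>.trans ?_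
    · filter_upwards [eventually_chartLine modelS p V hev, (hd1 b).continuousAt.eventually_ne hb0]
        with t ht htb
      obtain ⟨c, hc⟩ := s.coord_sectionMap_toProj i σ ht
      change s.coord i (s.sectionMap σ (s.toProj _)) A =
        s.coord i (s.sectionMap σ (s.toProj _)) b / _ * _
      rw [hc, Pi.smul_apply, Pi.smul_apply, smul_eq_mul, smul_eq_mul, mul_div_assoc,
        div_self htb, mul_one]
    · have hcb : s.coord i (chartLine modelS p V 0) = s.fibre p := by rw [hl0, hi, coord_fibre]
      rw [hcb, hl0, hc0]
      have : (c₀ • s.fibre p) b / s.fibre p b = c₀ := by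
        rw [Pi.smul_apply, smul_eq_mul, mul_div_assoc, div_self hb, mul_one]
      rw [this, add_comm]
  exact ⟨D, congrArg (Prod.mk _) (funext key)⟩

end SpinStructure

namespace SpinStructure

open Spin4

variable {X : Type*} [TopologicalSpace X] [ChartedSpace E4 X] [IsManifold (𝓡 4) ∞ X]
  {g : Metric4 X} {ι : Type*} (s : SpinStructure g ι)

/-! #### Dilations of the fibres of `𝕊'` -/

/-- The vector (V₁, cV₂ + lz) is the image of V under the differential of a dilation with variable
factor, equal to c at the point and with derivative l along V. -/
lemma deltaPi_smul (x : X) (z : Fin 2 → ℂ) (c l : ℂ) (V : E4 × (Fin 2 → ℂ)) :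
    s.deltaPi ⟨x, c • z⟩ (V.1, c • V.2 + l • z) =
      c • s.deltaPi ⟨x, z⟩ V + l • z := by
  rw [s.deltaPi_eq ⟨x, c • z⟩, s.deltaPi_eq ⟨x, z⟩]
  have h := mulVec_smul (s.spinConnAt (s.indexAt x) x V.1) c z
  refine (congrArg (c • V.2 + l • z + ·) h).trans ?_
  rw [smul_add]
  abel

lemma eta_smul (x : X) (z : Fin 2 → ℂ) (c : ℂ) (V : E4 × (Fin 2 → ℂ)) (w : Fin 2 → ℂ) :
    s.eta ⟨x, c • z⟩ (V.1, w) = c • s.eta ⟨x, z⟩ V := by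
  rw [s.eta_eq ⟨x, c • z⟩, s.eta_eq ⟨x, z⟩]
  exact contract_smul c z _

/-- τ̃ scales by c² and each of the two η by c; the l terms disappear because ε(π, π) = 0. -/
lemma tauDTau_smul {Λ : ℝ} (hE : s.IsEinstein Λ) (hA : s.IsAntiSelfDual) (x : X)
    (z : Fin 2 → ℂ) (c l₁ l₂ l₃ : ℂ) (V₁ V₂ V₃ : E4 × (Fin 2 → ℂ)) :
    s.tauDTau ⟨x, c • z⟩ ![(V₁.1, c • V₁.2 + l₁ • z), (V₂.1, c • V₂.2 + l₂ • z),
      (V₃.1, c • V₃.2 + l₃ • z)] = c ^ 4 * s.tauDTau ⟨x, z⟩ ![V₁, V₂, V₃] := by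
  refine (s.tauDTau_apply hE hA ⟨x, c • z⟩ _ _ _).trans ?_
  refine Eq.trans ?_ (congrArg (c ^ 4 * ·) (s.tauDTau_apply hE hA ⟨x, z⟩ V₁ V₂ V₃).symm)
  rw [s.eta_smul, s.eta_smul, s.eta_smul, s.deltaPi_smul, s.deltaPi_smul, s.deltaPi_smul]
  change _ * (skew (c • z) _ * _ - skew (c • z) _ * _ + skew (c • z) _ * _) = c ^ 4 *
    (_ * (skew z _ * _ - skew z _ * _ + skew z _ * _))
  have h (a b c : Fin 2 → ℂ) : skew a (b + c) = skew a b + skew a c := by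
    simp only [skew_eq, Pi.add_apply]; ring
  simp only [h, skew_smul_left, skew_smul_right, skew_self]
  ring

/-- 𝕀 is invariant under dilations and multiplies lπ by i. Hence `projAcs` is compatible with every
local section, not only with the one in its definition. -/
lemma acs_smul (x : X) (z : Fin 2 → ℂ) {c : ℂ} (hc : c ≠ 0) (l : ℂ) (V W : E4 × (Fin 2 → ℂ))
    (h : s.acs ⟨x, z⟩ V = W) :
    s.acs ⟨x, c • z⟩ (V.1, c • V.2 + l • z) = (W.1, c • W.2 + (Complex.I * l) • z) := by
  have hb : s.baseAcs x (c • z) = s.baseAcs x z := by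
    rw [baseAcs, baseAcs, acsMatrix_smul hc]
  apply s.tangent_ext
  · refine (s.dBase_acs ⟨x, c • z⟩ _).trans ?_
    refine Eq.trans ?_ (s.dBase_apply ⟨x, c • z⟩ _).symm
    change s.baseAcs x (c • z) _ = _
    rw [hb, s.dBase_apply, ← h]
    refine Eq.trans ?_ ((s.dBase_apply ⟨x, z⟩ (s.acs ⟨x, z⟩ V)).symm.trans
      (s.dBase_acs ⟨x, z⟩ V)).symm
    exact congrArg (s.baseAcs x z) (s.dBase_apply ⟨x, z⟩ V).symm
  · refine (s.deltaPi_acs ⟨x, c • z⟩ _).trans ?_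
    rw [s.deltaPi_smul, s.deltaPi_smul, ← h]
    rw [smul_add, smul_smul, smul_smul]
    refine congrArg (· + (Complex.I * l) • z) ?_
    refine Eq.trans ?_ (congrArg (c • ·) (s.deltaPi_acs ⟨x, z⟩ V)).symm
    rw [smul_smul, mul_comm]

/-! #### Pullbacks of `τ̃ ∧ dτ̃` by sections of the tautological bundle -/

/-- The differential of the projection `𝕊' ∖ 0 → ℙ(𝕊')` at a nonzero element of the line `q`. -/
def dProj {q : s.ProjSpinor} (v : s.taut q) : (E4 × (Fin 2 → ℂ)) →L[ℝ] TangentSpace modelP q :=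
  mfderiv modelS modelP s.toProj (s.tautPoint v)

/-- The differential of a section of the tautological bundle. -/
def dSection (σ : ∀ q : s.ProjSpinor, s.taut q) (q : s.ProjSpinor) :
    TangentSpace modelP q →L[ℝ] (E4 × (Fin 2 → ℂ)) :=
  mfderiv modelP modelS (s.sectionMap σ) q

/-- The coordinates of an element of a line. -/
def tautVec {q : s.ProjSpinor} (v : s.taut q) : Fin 2 → ℂ := (v : s.core.Fiber q.pt)

lemma dSection_dProj {σ : ∀ q : s.ProjSpinor, s.taut q} {q : s.ProjSpinor}
    (hσ : MDifferentiableAt modelP modelS (s.sectionMap σ) q) {v : s.taut q} (hv : v ≠ 0) {c : ℂ}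
    (hc : σ q = c • v) (V : E4 × (Fin 2 → ℂ)) :
    ∃ l : ℂ, s.dSection σ q (s.dProj v V) = (V.1, c • V.2 + l • s.tautVec v) :=
  (s.mfderiv_sectionMap_toProj hσ hv hc V).imp fun l h => h.trans
    (congrArg₂ (fun (a : E4) (b : Fin 2 → ℂ) => (a, c • b + l • s.tautVec v))
      (s.dBase_apply (s.tautPoint v) V) (s.dFibre_apply (s.tautPoint v) V))

lemma dProj_dSection {σ : ∀ q : s.ProjSpinor, s.taut q} {q : s.ProjSpinor}
    (hσ : MDifferentiableAt modelP modelS (s.sectionMap σ) q) (h0 : ∀ᶠ r in 𝓝 q, σ r ≠ 0)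
    (w : TangentSpace modelP q) : s.dProj (σ q) (s.dSection σ q w) = w := by
  have hq : σ q ≠ 0 := h0.self_of_nhds
  have hp : MDifferentiableAt modelS modelP s.toProj (s.sectionMap σ q) :=
    (s.contMDiffAt_toProj (s.fibre_tautPoint_ne_zero hq)).mdifferentiableAt (by simp)
  have h1 : s.toProj ∘ s.sectionMap σ =ᶠ[𝓝 q] id := by
    filter_upwards [h0] with r hr
    exact s.toProj_sectionMap σ hr
  have h2 : (mfderiv modelP modelP (s.toProj ∘ s.sectionMap σ) q : (E4 × ℂ) →L[ℝ] (E4 × ℂ)) =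
      ContinuousLinearMap.id ℝ (E4 × ℂ) := by
    refine (h1.mfderiv_eq (I := modelP) (I' := modelP) : ).trans ?_
    exact mfderiv_id
  have h3 := mfderiv_comp q hp hσ
  exact congrArg (fun L : (E4 × ℂ) →L[ℝ] (E4 × ℂ) => L w) (h3.symm.trans h2)

/-- The pullback of `τ̃ ∧ dτ̃` by a section of the tautological bundle. -/
def pullTau (σ : ∀ q : s.ProjSpinor, s.taut q) (q : s.ProjSpinor) :
    TangentSpace modelP q [⋀^Fin 3]→L[ℝ] ℂ :=
  (s.tauDTau (s.sectionMap σ q)).compContinuousLinearMap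
    (mfderiv modelP modelS (s.sectionMap σ) q)

/-- `τ̃ ∧ dτ̃` at an element of a line, as a form on the model space. -/
def tautForm {q : s.ProjSpinor} (v : s.taut q) : (E4 × (Fin 2 → ℂ)) [⋀^Fin 3]→L[ℝ] ℂ :=
  s.tauDTau (s.tautPoint v)

/-- The complex structure `𝕀` at an element of a line, on the model space. -/
def tautAcs {q : s.ProjSpinor} (v : s.taut q) :
    (E4 × (Fin 2 → ℂ)) →L[ℝ] (E4 × (Fin 2 → ℂ)) :=
  s.acs (s.tautPoint v)

lemma pullTau_apply (σ : ∀ q : s.ProjSpinor, s.taut q) (q : s.ProjSpinor)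
    (v : Fin 3 → TangentSpace modelP q) : s.pullTau σ q v =
      s.tautForm (σ q) (fun i => s.dSection σ q (v i)) := rfl

lemma tautForm_smul {Λ : ℝ} (hE : s.IsEinstein Λ) (hA : s.IsAntiSelfDual) {q : s.ProjSpinor}
    (v : s.taut q) (c : ℂ) (l : Fin 3 → ℂ) (V : Fin 3 → E4 × (Fin 2 → ℂ)) :
    s.tautForm (c • v) (fun i => ((V i).1, c • (V i).2 + l i • s.tautVec v)) =
      c ^ 4 * s.tautForm v V := by
  have h := s.tauDTau_smul hE hA q.pt (s.tautVec v) c (l 0) (l 1) (l 2) (V 0) (V 1) (V 2)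
  have h1 : V = ![V 0, V 1, V 2] := by
    funext i
    fin_cases i <;> rfl
  rw [h1]
  refine Eq.trans (congrArg (s.tautForm (c • v)) (funext fun i => ?_)) h
  fin_cases i <;> rfl

/-- The descent statement: the derivative of σ enters only through the coefficients l, which τ̃ ∧
dτ̃ ignores, and the value of σ only through c⁴. -/
lemma pullTau_dProj {Λ : ℝ} (hE : s.IsEinstein Λ) (hA : s.IsAntiSelfDual)
    {σ : ∀ q : s.ProjSpinor, s.taut q} {q : s.ProjSpinor}
    (hσ : MDifferentiableAt modelP modelS (s.sectionMap σ) q) {v : s.taut q} (hv : v ≠ 0) {c : ℂ}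
    (hc : σ q = c • v) (V : Fin 3 → E4 × (Fin 2 → ℂ)) :
    s.pullTau σ q (fun i => s.dProj v (V i)) = c ^ 4 * s.tautForm v V := by
  rw [pullTau_apply]
  choose l hl using fun i => s.dSection_dProj hσ hv hc (V i)
  simp only [hl]
  rw [hc]
  exact s.tautForm_smul hE hA v c l V

lemma pullTau_eq_smul {Λ : ℝ} (hE : s.IsEinstein Λ) (hA : s.IsAntiSelfDual)
    {σ σ' : ∀ q : s.ProjSpinor, s.taut q} {q : s.ProjSpinor}
    (hσ : MDifferentiableAt modelP modelS (s.sectionMap σ) q)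
    (hσ' : MDifferentiableAt modelP modelS (s.sectionMap σ') q)
    (h0 : ∀ᶠ r in 𝓝 q, σ r ≠ 0) {c : ℂ} (hc : σ' q = c • σ q) :
    s.pullTau σ' q = c ^ 4 • s.pullTau σ q := by
  ext w
  have h := s.pullTau_dProj hE hA hσ' h0.self_of_nhds hc (fun i => s.dSection σ q (w i))
  simp only [s.dProj_dSection hσ h0] at h
  exact h

lemma pullTau_ne_zero {Λ : ℝ} (hΛ : Λ ≠ 0) (hE : s.IsEinstein Λ) (hA : s.IsAntiSelfDual)
    {σ : ∀ q : s.ProjSpinor, s.taut q} {q : s.ProjSpinor}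
    (hσ : MDifferentiableAt modelP modelS (s.sectionMap σ) q) (hq : σ q ≠ 0) :
    s.pullTau σ q ≠ 0 := by
  intro h
  obtain ⟨V₁, V₂, V₃, hV⟩ := s.exists_tauDTau_ne_zero hΛ hE hA (s.fibre_tautPoint_ne_zero hq)
  apply hV
  have h1 := s.pullTau_dProj hE hA hσ hq (one_smul ℂ _).symm ![V₁, V₂, V₃]
  rw [h, one_pow, one_mul] at h1
  exact h1.symm

lemma tautAcs_smul {q : s.ProjSpinor} (v : s.taut q) {c : ℂ} (hc : c ≠ 0) (l : ℂ)
    (V : E4 × (Fin 2 → ℂ)) :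
    s.tautAcs (c • v) (V.1, c • V.2 + l • s.tautVec v) =
      ((s.tautAcs v V).1, c • (s.tautAcs v V).2 + (Complex.I * l) • s.tautVec v) :=
  s.acs_smul q.pt (s.tautVec v) hc l V _ rfl

end SpinStructure

namespace SpinStructure

open Spin4

variable {X : Type*} [TopologicalSpace X] [ChartedSpace E4 X] [IsManifold (𝓡 4) ∞ X]
  {g : Metric4 X} {ι : Type*} (s : SpinStructure g ι)

/-! #### The complex structure of `ℙ(𝕊')` and the Cauchy-Riemann operators -/

/-- The affine section near `q` used in the definition of `projAcs`. -/
def localSection (q : s.ProjSpinor) : ∀ r : s.ProjSpinor, s.taut r :=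
  s.affineSection (s.indexAt q.pt) (s.affineIdx q)

lemma contMDiffAt_localSection (q : s.ProjSpinor) :
    ContMDiffAt modelP modelS ∞ (s.sectionMap (s.localSection q)) q :=
  s.contMDiffAt_affineLift q

lemma localSection_ne_zero (q : s.ProjSpinor) : ∀ᶠ r in 𝓝 q, s.localSection q r ≠ 0 := by
  filter_upwards [extChartAt_source_mem_nhds (I := modelP) q] with r hr
  have hr0 := ((s.mem_extChartAt_projSpinor q r).1 hr).2.2
  intro h
  exact smul_ne_zero (inv_ne_zero hr0) r.line.rep_nonzero (congrArg Subtype.val h)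

lemma projAcs_apply (q : s.ProjSpinor) (w : TangentSpace modelP q) :
    s.projAcs q w = s.dProj (s.localSection q q)
      (s.tautAcs (s.localSection q q) (s.dSection (s.localSection q) q w)) := rfl

lemma exists_eq_smul {q : s.ProjSpinor} {v : s.taut q} (hv : v ≠ 0) (w : s.taut q) :
    ∃ c : ℂ, w = c • v := by
  obtain ⟨a, ha⟩ := (Projectivization.mem_submodule_iff q.line _).1 v.2
  obtain ⟨b, hb⟩ := (Projectivization.mem_submodule_iff q.line _).1 w.2
  have ha0 : a ≠ 0 := by
    rintro rfl
    exact hv (Subtype.ext (ha.symm.trans (zero_smul _ _)))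
  refine ⟨b / a, Subtype.ext ?_⟩
  refine hb.symm.trans (Eq.trans ?_ (congrArg ((b / a) • ·) ha))
  rw [smul_smul, div_mul_cancel₀ b ha0]

/-- The kernel of dp consists of the multiples of π, and dp intertwines the complex structures; so
dσ is complex linear up to such a multiple. -/
lemma dSection_projAcs {σ : ∀ q : s.ProjSpinor, s.taut q} {q : s.ProjSpinor}
    (hσ : MDifferentiableAt modelP modelS (s.sectionMap σ) q) (hq : σ q ≠ 0)
    (w : TangentSpace modelP q) :
    ∃ l : ℂ, s.dSection σ q (s.projAcs q w) =
      s.tautAcs (σ q) (s.dSection σ q w) + ((0 : E4), l • s.tautVec (σ q)) := by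
  have h0 := s.localSection_ne_zero q
  have he := h0.self_of_nhds
  have hd := (s.contMDiffAt_localSection q).mdifferentiableAt (by simp)
  obtain ⟨c, hc⟩ := s.exists_eq_smul he (σ q)
  have hc0 : c ≠ 0 := by
    rintro rfl
    exact hq (hc.trans (zero_smul _ _))
  have hw := s.dProj_dSection hd h0 w
  rw [projAcs_apply]
  set V := s.dSection (s.localSection q) q w
  obtain ⟨l, hl⟩ := s.dSection_dProj hσ he hc (s.tautAcs (s.localSection q q) V)
  obtain ⟨l', hl'⟩ := s.dSection_dProj hσ he hc V
  rw [hw] at hl'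
  -- The errors l and l' are measured along the reference spinor, of which σ(q) is c times; hence
  -- the division by c.
  refine ⟨(l - Complex.I * l') / c, ?_⟩
  rw [hl, hl', hc, s.tautAcs_smul _ hc0]
  have hv : s.tautVec (c • s.localSection q q) = c • s.tautVec (s.localSection q q) := rfl
  rw [hv, smul_smul, div_mul_cancel₀ _ hc0]
  refine Prod.ext (add_zero _).symm ?_
  rw [Prod.snd_add, add_assoc, ← add_smul, add_sub_cancel]

/-- The case c = 1 of `tautForm_smul`: vectors lπ contract to zero with τ̃ ∧ dτ̃. -/
lemma tautForm_update_add {Λ : ℝ} (hE : s.IsEinstein Λ) (hA : s.IsAntiSelfDual)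
    {q : s.ProjSpinor} (v : s.taut q) (W : Fin 3 → E4 × (Fin 2 → ℂ)) (j : Fin 3)
    (Y : E4 × (Fin 2 → ℂ)) (l : ℂ) :
    s.tautForm v (Function.update W j (Y + ((0 : E4), l • s.tautVec v))) =
      s.tautForm v (Function.update W j Y) := by
  have h := s.tautForm_smul hE hA v 1 (Pi.single j l) (Function.update W j Y)
  rw [one_smul, one_pow, one_mul] at h
  rw [← h]
  congr 1
  funext i
  by_cases hi : i = j
  · subst hi
    simp only [Function.update_self, Pi.single_eq_same, one_smul]
    exact Prod.ext (add_zero _) rfl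
  · simp [Function.update_of_ne hi, Pi.single_eq_of_ne hi]

lemma dSection_update (σ : ∀ q : s.ProjSpinor, s.taut q) (q : s.ProjSpinor) {k : ℕ}
    (v : Fin k → TangentSpace modelP q) (j : Fin k) (w : TangentSpace modelP q) :
    (fun i => s.dSection σ q (Function.update v j w i)) =
      Function.update (fun i => s.dSection σ q (v i)) j (s.dSection σ q w) := by
  funext i
  by_cases hi : i = j
  · subst hi
    rw [Function.update_self, Function.update_self]
  · rw [Function.update_of_ne hi, Function.update_of_ne hi]

lemma isTypeK0_pullTau {Λ : ℝ} (hE : s.IsEinstein Λ) (hA : s.IsAntiSelfDual)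
    {σ : ∀ q : s.ProjSpinor, s.taut q} {q : s.ProjSpinor}
    (hσ : MDifferentiableAt modelP modelS (s.sectionMap σ) q) (hq : σ q ≠ 0) :
    DiffForm.IsTypeK0 (s.projAcs q) (s.pullTau σ q) := by
  intro v j
  rw [pullTau_apply, pullTau_apply, dSection_update]
  obtain ⟨l, hl⟩ := s.dSection_projAcs hσ hq (v j)
  rw [hl, s.tautForm_update_add hE hA]
  exact s.isTypeK0_tauDTau hE hA (s.fibre_tautPoint_ne_zero hq) (fun i => s.dSection σ q (v i)) j

/-- `d(τ̃ ∧ dτ̃)` at an element of a line, as a form on the model space. -/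
def dTautForm {q : s.ProjSpinor} (v : s.taut q) : (E4 × (Fin 2 → ℂ)) [⋀^Fin 4]→L[ℝ] ℂ :=
  DiffForm.d modelS s.tauDTau (s.tautPoint v)

lemma dTautForm_isTypeK0 {Λ : ℝ} (hE : s.IsEinstein Λ) (hA : s.IsAntiSelfDual)
    {q : s.ProjSpinor} {v : s.taut q} (hv : v ≠ 0) :
    DiffForm.IsTypeK0 (s.tautAcs v) (s.dTautForm v) :=
  s.isTypeK0_d_tauDTau hE hA (s.fibre_tautPoint_ne_zero hv)

lemma dTautForm_vertical {Λ : ℝ} (hE : s.IsEinstein Λ) (hA : s.IsAntiSelfDual)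
    {q : s.ProjSpinor} (v : s.taut q) (l : ℂ) (V : Fin 4 → E4 × (Fin 2 → ℂ)) :
    s.dTautForm v (Function.update V 0 ((0 : E4), l • s.tautVec v)) =
      4 * l * s.tautForm v ![V 1, V 2, V 3] := by
  refine Eq.trans (congrArg (s.dTautForm v) (funext fun i => ?_))
    (s.d_tauDTau_vertical hE hA (s.tautPoint v) l (V 1) (V 2) (V 3))
  fin_cases i <;> rfl

/-- The exterior derivative of the pullback of `τ̃ ∧ dτ̃` by a section of the tautological bundle
is of type `(4, 0)` exactly where the section is holomorphic. -/
lemma isTypeK0_d_pullTau_iff {Λ : ℝ} (hΛ : Λ ≠ 0) (hE : s.IsEinstein Λ) (hA : s.IsAntiSelfDual)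
    {σ : ∀ q : s.ProjSpinor, s.taut q} {q : s.ProjSpinor}
    (hσ : ContMDiffAt modelP modelS ∞ (s.sectionMap σ) q) (hq : σ q ≠ 0)
    {α : ∀ r : s.ProjSpinor, TangentSpace modelP r [⋀^Fin 3]→L[ℝ] ℂ}
    (hα : ∀ᶠ r in 𝓝 q, α r = s.pullTau σ r) :
    DiffForm.IsTypeK0 (s.projAcs q) (DiffForm.d modelP α q) ↔ s.TautDbarZeroAt σ q := by
  have hd := hσ.mdifferentiableAt (by simp)
  have e (v : Fin 4 → TangentSpace modelP q) : DiffForm.d modelP α q v =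
      s.dTautForm (σ q) (fun i => s.dSection σ q (v i)) :=
    congrArg (fun β : (E4 × ℂ) [⋀^Fin 4]→L[ℝ] ℂ => β v)
      (DiffForm.d_pullback hσ (s.smoothAt_tauDTau _) hα)
  have hT := s.dTautForm_isTypeK0 hE hA hq
  constructor
  · intro h w
    change s.dSection σ q (s.projAcs q w) = s.tautAcs (σ q) (s.dSection σ q w)
    obtain ⟨l, hl⟩ := s.dSection_projAcs hd hq w
    -- If l ≠ 0, inserting `projAcs q w` in the first slot of dα gives the (4,0) value plus 4l σ*(τ̃
    -- ∧ dτ̃). The excess must vanish, contrary to `pullTau_ne_zero`.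
    suffices l = 0 by
      rw [hl, this, zero_smul]
      exact add_zero (s.tautAcs (σ q) (s.dSection σ q w))
    by_contra hl0
    apply s.pullTau_ne_zero hΛ hE hA hd hq
    ext v
    have h1 := h ![w, v 0, v 1, v 2] 0
    rw [e, e, dSection_update] at h1
    have h2 := hT (fun i => s.dSection σ q ((![w, v 0, v 1, v 2] : Fin 4 → _) i)) 0
    have h3 := s.dTautForm_vertical hE hA (σ q) l
      (fun i => s.dSection σ q ((![w, v 0, v 1, v 2] : Fin 4 → _) i))
    have h4 : s.dSection σ q (s.projAcs q ((![w, v 0, v 1, v 2] : Fin 4 → _) 0)) =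
      s.tautAcs (σ q) (s.dSection σ q w) + ((0 : E4), l • s.tautVec (σ q)) := hl
    rw [h4] at h1
    rw [ContinuousAlternatingMap.map_update_add] at h1
    have h5 : 4 * l * s.tautForm (σ q) ![s.dSection σ q (v 0), s.dSection σ q (v 1),
        s.dSection σ q (v 2)] = 0 := by
      refine h3.symm.trans ?_
      exact add_left_cancel (h1.trans (h2.symm.trans (add_zero _).symm))
    have h6 := (mul_eq_zero.1 h5).resolve_left (mul_ne_zero (by norm_num) hl0)
    rw [pullTau_apply]
    refine Eq.trans (congrArg _ (funext fun i => ?_)) h6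
    fin_cases i <;> rfl
  -- Conversely, pullback by a complex linear dσ preserves type (4,0).
  · intro h v j
    have hl : s.dSection σ q (s.projAcs q (v j)) = s.tautAcs (σ q) (s.dSection σ q (v j)) := h (v j)
    rw [e, e, dSection_update, hl]
    exact hT (fun i => s.dSection σ q (v i)) j

lemma smoothAt_pullTau {σ : ∀ q : s.ProjSpinor, s.taut q} {q : s.ProjSpinor}
    (hσ : ContMDiffAt modelP modelS ∞ (s.sectionMap σ) q)
    {α : ∀ r : s.ProjSpinor, TangentSpace modelP r [⋀^Fin 3]→L[ℝ] ℂ}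
    (hα : ∀ᶠ r in 𝓝 q, α r = s.pullTau σ r) : DiffForm.SmoothAt modelP α q :=
  DiffForm.smoothAt_pullback hσ (s.smoothAt_tauDTau _) hα

end SpinStructure

/-! ### Forms of type (3,0) on a complex 3-space, and tensor powers of a line -/

namespace DiffForm

variable {V : Type*} [NormedAddCommGroup V] [NormedSpace ℝ V]

/-- A form of type `(3, 0)` as a complex alternating form, in complex linear coordinates. -/
def IsTypeK0.toAlternatingMap {J : V →L[ℝ] V} (Φ : V ≃ₗ[ℝ] (Fin 3 → ℂ))
    (hΦ : ∀ v, Φ (J v) = Complex.I • Φ v) {α : V [⋀^Fin 3]→L[ℝ] ℂ} (hα : IsTypeK0 J α) :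
    (Fin 3 → ℂ) [⋀^Fin 3]→ₗ[ℂ] ℂ where
  toFun w := α (fun i => Φ.symm (w i))
  map_update_add' {inst} w i x y := by
    obtain rfl : inst = instDecidableEqFin 3 := Subsingleton.elim _ _
    have e (z : Fin 3 → ℂ) : (fun j => Φ.symm (Function.update w i z j)) =
        Function.update (fun j => Φ.symm (w j)) i (Φ.symm z) :=
      funext fun j => (Function.apply_update (fun _ => Φ.symm) w i z j)
    rw [e, e, e, map_add, α.map_update_add]
  map_update_smul' {inst} w i c x := by
    obtain rfl : inst = instDecidableEqFin 3 := Subsingleton.elim _ _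
    have e (z : Fin 3 → ℂ) : (fun j => Φ.symm (Function.update w i z j)) =
        Function.update (fun j => Φ.symm (w j)) i (Φ.symm z) :=
      funext fun j => (Function.apply_update (fun _ => Φ.symm) w i z j)
    -- Multiplication by i corresponds to J, so real linearity and the type condition together give
    -- complex linearity.
    have hc : Φ.symm (c • x) = c.re • Φ.symm x + c.im • J (Φ.symm x) := by
      apply Φ.injective
      rw [Φ.apply_symm_apply, map_add, Φ.map_smul c.re, Φ.map_smul c.im, hΦ, Φ.apply_symm_apply]
      ext b
      simp only [Pi.smul_apply, Pi.add_apply, smul_eq_mul, Complex.real_smul]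
      conv_lhs => rw [← Complex.re_add_im c]
      ring
    have h := hα (Function.update (fun j => Φ.symm (w j)) i (Φ.symm x)) i
    rw [Function.update_self, Function.update_idem] at h
    rw [e, e, hc, α.map_update_add, α.map_update_smul, α.map_update_smul, h]
    simp only [smul_eq_mul, Complex.real_smul]
    conv_rhs => rw [← Complex.re_add_im c]
    ring
  map_eq_zero_of_eq' w i j h hij := α.map_eq_zero_of_eq _ (congrArg Φ.symm h) hij

/-- On a complex vector space of dimension `3`, the forms of type `(3, 0)` are a line. -/
lemma IsTypeK0.exists_eq_smul {J : V →L[ℝ] V} (Φ : V ≃ₗ[ℝ] (Fin 3 → ℂ))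
    (hΦ : ∀ v, Φ (J v) = Complex.I • Φ v) {α β : V [⋀^Fin 3]→L[ℝ] ℂ} (hα : IsTypeK0 J α)
    (hβ : IsTypeK0 J β) (h0 : α ≠ 0) : ∃ c : ℂ, β = c • α := by
  -- In the coordinates Φ every such form is a multiple of the determinant.
  have key {γ : V [⋀^Fin 3]→L[ℝ] ℂ} (hγ : IsTypeK0 J γ) (v : Fin 3 → V) :
      γ v = hγ.toAlternatingMap Φ hΦ (Pi.basisFun ℂ (Fin 3)) *
        (Pi.basisFun ℂ (Fin 3)).det (fun i => Φ (v i)) := by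
    have h := (hγ.toAlternatingMap Φ hΦ).eq_smul_basis_det (Pi.basisFun ℂ (Fin 3))
    have h1 := congrArg (fun f : (Fin 3 → ℂ) [⋀^Fin 3]→ₗ[ℂ] ℂ => f (fun i => Φ (v i))) h
    refine Eq.trans ?_ h1
    exact congrArg γ (funext fun i => (Φ.symm_apply_apply (v i)).symm)
  have hA : hα.toAlternatingMap Φ hΦ (Pi.basisFun ℂ (Fin 3)) ≠ 0 := by
    intro h
    apply h0
    ext v
    rw [key hα, h, zero_mul]
    rfl
  refine ⟨hβ.toAlternatingMap Φ hΦ (Pi.basisFun ℂ (Fin 3)) /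
    hα.toAlternatingMap Φ hΦ (Pi.basisFun ℂ (Fin 3)), ?_⟩
  ext v
  rw [ContinuousAlternatingMap.smul_apply, key hα, key hβ, smul_eq_mul, ← mul_assoc,
    div_mul_cancel₀ _ hA]

end DiffForm

/-- In the tensor power of a line spanned by `e`, the value of the power of a linear form which
maps `e` to `1` is the coordinate. -/
lemma PiTensorProduct.eq_lift_smul_tprod {K L : Type*} [Field K] [AddCommGroup L] [Module K L]
    {n : ℕ} (f : L →ₗ[K] K) (e : L) (he : ∀ v, v = f v • e) (x : ⨂[K]^n L) :
    x = PiTensorProduct.lift ((MultilinearMap.mkPiAlgebra K (Fin n) K).compLinearMap fun _ => f) x •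
      PiTensorProduct.tprod K fun _ : Fin n => e := by
  induction x using PiTensorProduct.induction_on with
  | smul_tprod r v =>
    rw [map_smul, PiTensorProduct.lift.tprod, smul_assoc]
    congr 1
    have hv : v = fun i => f (v i) • e := funext fun i => he (v i)
    conv_lhs => rw [hv]
    exact (PiTensorProduct.tprod K).map_smul_univ (fun i => f (v i)) fun _ => e
  | add x y hx hy =>
    rw [map_add, add_smul, ← hx, ← hy]

namespace SpinStructure

open Spin4

variable {X : Type*} [TopologicalSpace X] [ChartedSpace E4 X] [IsManifold (𝓡 4) ∞ X]
  {g : Metric4 X} {ι : Type*} (s : SpinStructure g ι)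

/-! #### Complex coordinates of the tangent spaces of `ℙ(𝕊')` -/

lemma eta_real_smul (p : s.Spinor) (r : ℝ) (V : TangentSpace modelS p) :
    s.eta p (r • V) = r • s.eta p V := by
  have h (a : Fin 4) : s.components p.1 (s.dBase p (r • V)) a =
      r * s.components p.1 (s.dBase p V) a := by
    rw [components, map_smul, map_smul]
    rfl
  have h1 : quat (s.components p.1 (s.dBase p (r • V))) =
      (r : ℂ) • quat (s.components p.1 (s.dBase p V)) := by
    simp only [quat, h, Complex.ofReal_mul, mul_smul, Finset.smul_sum]
  exact (congrArg (· *ᵥ (eps *ᵥ s.fibre p)) h1).trans (smul_mulVec _ _ _)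

/-- The forms `τ̃` and `η` as complex coordinates of tangent vectors of `𝕊'` modulo the Euler vector
field. -/
def tauEta (p : s.Spinor) : TangentSpace modelS p →ₗ[ℝ] (Fin 3 → ℂ) where
  toFun V := ![skew (s.fibre p) (s.deltaPi p V), s.eta p V 0, s.eta p V 1]
  map_add' V W := by
    rw [eta_add, map_add]
    ext i
    fin_cases i
    · simp [skew_eq]
      ring
    · rfl
    · rfl
  map_smul' r V := by
    rw [eta_real_smul, map_smul]
    ext i
    fin_cases i
    · simp [skew_eq]
      ring
    · rfl
    · rfl

lemma tauEta_vertical (p : s.Spinor) (l : ℂ) :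
    s.tauEta p (s.vertical p (l • s.fibre p)) = 0 := by
  change ![_, _, _] = _
  rw [eta_vertical, deltaPi_vertical, skew_smul_right, skew_self, mul_zero]
  ext i
  fin_cases i <;> rfl

lemma tauEta_acs {p : s.Spinor} (hp : s.fibre p ≠ 0) (V : TangentSpace modelS p) :
    s.tauEta p (s.acs p V) = Complex.I • s.tauEta p V := by
  change ![_, _, _] = Complex.I • ![_, _, _]
  rw [s.eta_acs hp, s.deltaPi_acs, skew_smul_right]
  ext i
  fin_cases i <;> rfl

lemma tauEta_surjective {p : s.Spinor} (hp : s.fibre p ≠ 0) :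
    Function.Surjective (s.tauEta p) := by
  intro t
  obtain ⟨w, hw⟩ := exists_skew_eq hp (t 0)
  obtain ⟨V, h₁, h₂⟩ := s.exists_eta_eq_deltaPi_eq hp ![t 1, t 2] w
  refine ⟨V, ?_⟩
  change ![_, _, _] = t
  rw [h₁, h₂, hw]
  ext i
  fin_cases i <;> rfl

/-- Complex linear coordinates of the tangent space of `ℙ(𝕊')`. -/
lemma exists_complexCoordinates (q : s.ProjSpinor) :
    ∃ Φ : TangentSpace modelP q ≃ₗ[ℝ] (Fin 3 → ℂ),
      ∀ v, Φ (s.projAcs q v) = Complex.I • Φ v := by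
  have h0 := s.localSection_ne_zero q
  have he := h0.self_of_nhds
  have hd := (s.contMDiffAt_localSection q).mdifferentiableAt (by simp)
  have hp : s.fibre (s.tautPoint (s.localSection q q)) ≠ 0 := s.fibre_tautPoint_ne_zero he
  let T : (E4 × (Fin 2 → ℂ)) →ₗ[ℝ] (Fin 3 → ℂ) := s.tauEta (s.tautPoint (s.localSection q q))
  have hv (V : E4 × (Fin 2 → ℂ)) (l : ℂ) :
      T (V + ((0 : E4), l • s.tautVec (s.localSection q q))) = T V := by
    rw [map_add]
    exact (congrArg (T V + ·) (s.tauEta_vertical _ l)).trans (add_zero _)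
  let F : (E4 × ℂ) →ₗ[ℝ] (Fin 3 → ℂ) := T ∘ₗ (s.dSection (s.localSection q) q).toLinearMap
  -- `tauEta` is onto and ignores lπ, and dσ ∘ dp is the identity up to lπ, so precomposing with dσ
  -- keeps it onto; both spaces have real dimension 6, so F is bijective.
  have hF : Function.Surjective F := by
    intro t
    obtain ⟨V, hV⟩ := s.tauEta_surjective hp t
    refine ⟨s.dProj (s.localSection q q) V, ?_⟩
    obtain ⟨l, hl⟩ := s.dSection_dProj hd he (one_smul ℂ _).symm V
    refine (congrArg T (hl.trans ?_)).trans ((hv V l).trans hV)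
    rw [one_smul]
    exact Prod.ext (add_zero _).symm rfl
  have hfin : Module.finrank ℝ (E4 × ℂ) = Module.finrank ℝ (Fin 3 → ℂ) := by
    simp [Module.finrank_pi_fintype, Complex.finrank_real_complex]
  have hF' : Function.Injective F :=
    (LinearMap.injective_iff_surjective_of_finrank_eq_finrank hfin).2 hF
  refine ⟨LinearEquiv.ofBijective F ⟨hF', hF⟩, fun v => ?_⟩
  change T (s.dSection (s.localSection q) q (s.projAcs q v)) =
    Complex.I • T (s.dSection (s.localSection q) q v)
  obtain ⟨l, hl⟩ := s.dSection_projAcs hd he v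
  rw [hl, hv]
  exact s.tauEta_acs hp _

/-! #### The section `κ` -/

/-- The inclusion of a line in `ℂ²`. -/
def tautIncl (q : s.ProjSpinor) : s.taut q →ₗ[ℂ] (Fin 2 → ℂ) where
  toFun v := s.tautVec v
  map_add' _ _ := rfl
  map_smul' _ _ := rfl

/-- The linear form on the line `q` equal to `1` on the affine section. -/
def lineDual (q : s.ProjSpinor) : s.taut q →ₗ[ℂ] ℂ :=
  (LinearMap.proj (R := ℂ) (φ := fun _ : Fin 2 => ℂ) (s.affineIdx q)) ∘ₗ s.tautIncl q

lemma lineDual_localSection (q : s.ProjSpinor) : s.lineDual q (s.localSection q q) = 1 := by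
  have h1 := s.coord_affineLift (s.indexAt q.pt) (s.affineIdx q) q
  have h2 : s.coord (s.indexAt q.pt) (s.affineLift (s.indexAt q.pt) (s.affineIdx q) q) =
    s.tautVec (s.localSection q q) :=
    s.coord_fibre (s.affineLift (s.indexAt q.pt) (s.affineIdx q) q)
  change s.tautVec (s.localSection q q) (s.affineIdx q) = 1
  rw [← h2, h1, Pi.smul_apply, smul_eq_mul]
  exact inv_mul_cancel₀ (s.lineCoord_affineIdx_ne_zero q)

lemma eq_lineDual_smul {q : s.ProjSpinor} (v : s.taut q) :
    v = s.lineDual q v • s.localSection q q := by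
  obtain ⟨c, hc⟩ := s.exists_eq_smul (s.localSection_ne_zero q).self_of_nhds v
  rw [hc, map_smul, lineDual_localSection, smul_eq_mul, mul_one]

/-- The form `τ̃ ∧ dτ̃` pulled back by the affine section, an element of the canonical bundle. -/
def canonicalForm {Λ : ℝ} (hE : s.IsEinstein Λ) (hA : s.IsAntiSelfDual) (q : s.ProjSpinor) :
    s.canonical q :=
  ⟨s.pullTau (s.localSection q) q,
    s.isTypeK0_pullTau hE hA ((s.contMDiffAt_localSection q).mdifferentiableAt (by simp))
      (s.localSection_ne_zero q).self_of_nhds⟩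

/-- The section `κ` of `L⊗⁻⁴ ⊗ K` to which `τ̃ ∧ dτ̃` descends. -/
def kappa {Λ : ℝ} (hE : s.IsEinstein Λ) (hA : s.IsAntiSelfDual) (q : s.ProjSpinor) :
    Module.Dual ℂ (⨂[ℂ]^4 (s.taut q)) ⊗[ℂ] s.canonical q :=
  PiTensorProduct.lift ((MultilinearMap.mkPiAlgebra ℂ (Fin 4) ℂ).compLinearMap
    fun _ => s.lineDual q) ⊗ₜ s.canonicalForm hE hA q

lemma toHom_kappa {Λ : ℝ} (hE : s.IsEinstein Λ) (hA : s.IsAntiSelfDual) (q : s.ProjSpinor)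
    (x : ⨂[ℂ]^4 (s.taut q)) : s.toHom (s.kappa hE hA q) x =
      PiTensorProduct.lift ((MultilinearMap.mkPiAlgebra ℂ (Fin 4) ℂ).compLinearMap
        fun _ => s.lineDual q) x • s.canonicalForm hE hA q :=
  dualTensorHom_apply _ _ _

lemma quartic_kappa {Λ : ℝ} (hE : s.IsEinstein Λ) (hA : s.IsAntiSelfDual) {q : s.ProjSpinor}
    (v : s.taut q) : s.quartic (s.toHom (s.kappa hE hA q)) v =
      s.lineDual q v ^ 4 • s.canonicalForm hE hA q := by
  rw [quartic, toHom_kappa, PiTensorProduct.lift.tprod]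
  simp

lemma canonicalForm_ne_zero {Λ : ℝ} (hΛ : Λ ≠ 0) (hE : s.IsEinstein Λ) (hA : s.IsAntiSelfDual)
    (q : s.ProjSpinor) : s.canonicalForm hE hA q ≠ 0 := fun h =>
  s.pullTau_ne_zero hΛ hE hA ((s.contMDiffAt_localSection q).mdifferentiableAt (by simp))
    (s.localSection_ne_zero q).self_of_nhds (congrArg Subtype.val h)

lemma kappa_ne_zero {Λ : ℝ} (hΛ : Λ ≠ 0) (hE : s.IsEinstein Λ) (hA : s.IsAntiSelfDual)
    (q : s.ProjSpinor) : s.kappa hE hA q ≠ 0 := by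
  intro h
  have h1 := s.quartic_kappa hE hA (s.localSection q q)
  rw [h, lineDual_localSection, one_pow, one_smul] at h1
  refine s.canonicalForm_ne_zero hΛ hE hA q (h1.symm.trans ?_)
  rw [toHom, map_zero]
  rfl

/-- The affine section at q is λ⁻¹v with λ the value of `lineDual` at v, so the factor λ⁴ in κ
cancels the λ⁻⁴ of `pullTau_dProj`. -/
lemma descendsTo_kappa {Λ : ℝ} (hE : s.IsEinstein Λ) (hA : s.IsAntiSelfDual) :
    s.DescendsTo (s.kappa hE hA) := by
  intro q v hv
  have hd := (s.contMDiffAt_localSection q).mdifferentiableAt (by simp)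
  have hv' := s.eq_lineDual_smul v
  have hl : s.lineDual q v ≠ 0 := by
    intro h
    rw [h, zero_smul] at hv'
    exact hv hv'
  have hc : s.localSection q q = (s.lineDual q v)⁻¹ • v := by
    conv_rhs => rw [hv']
    rw [map_smul, lineDual_localSection, smul_eq_mul, mul_one, smul_smul, inv_mul_cancel₀ hl,
      one_smul]
  refine ContinuousAlternatingMap.ext fun (V : Fin 3 → E4 × (Fin 2 → ℂ)) => ?_
  rw [quartic_kappa]
  change s.tautForm v V = s.lineDual q v ^ 4 • s.pullTau (s.localSection q) q
    (fun i => s.dProj v (V i))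
  rw [s.pullTau_dProj hE hA hd hv hc, smul_eq_mul, ← mul_assoc, ← mul_pow, mul_inv_cancel₀ hl,
    one_pow, one_mul]

/-- The affine section chosen for κ varies with q, perhaps discontinuously. This formula removes the
choice, so smoothness and ∂̄ of κ(σ⊗⁴) can be read off from the pullback. -/
lemma quartic_kappa_section {Λ : ℝ} (hE : s.IsEinstein Λ) (hA : s.IsAntiSelfDual)
    {σ : ∀ q : s.ProjSpinor, s.taut q} {q : s.ProjSpinor}
    (hσ : MDifferentiableAt modelP modelS (s.sectionMap σ) q) :
    (s.quartic (s.toHom (s.kappa hE hA q)) (σ q) : TangentSpace modelP q [⋀^Fin 3]→L[ℝ] ℂ) =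
      s.pullTau σ q := by
  rw [quartic_kappa]
  exact (s.pullTau_eq_smul hE hA ((s.contMDiffAt_localSection q).mdifferentiableAt (by simp)) hσ
    (s.localSection_ne_zero q) (s.eq_lineDual_smul (σ q))).symm

/-- Both sides are complex lines, and the generator of the first goes to the nonzero
`canonicalForm`. -/
lemma bijective_toHom_kappa {Λ : ℝ} (hΛ : Λ ≠ 0) (hE : s.IsEinstein Λ) (hA : s.IsAntiSelfDual)
    (q : s.ProjSpinor) : Function.Bijective (s.toHom (s.kappa hE hA q)) := by
  have h0 := s.canonicalForm_ne_zero hΛ hE hA q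
  have hx := PiTensorProduct.eq_lift_smul_tprod (n := 4) (s.lineDual q) (s.localSection q q)
    s.eq_lineDual_smul
  constructor
  · rw [injective_iff_map_eq_zero]
    intro x h
    rw [toHom_kappa] at h
    rw [hx x, (smul_eq_zero.1 h).resolve_right h0, zero_smul]
  · intro β
    obtain ⟨Φ, hΦ⟩ := s.exists_complexCoordinates q
    obtain ⟨c, hc⟩ := DiffForm.IsTypeK0.exists_eq_smul (V := E4 × ℂ) (J := s.projAcs q) Φ hΦ
      (s.canonicalForm hE hA q).2 β.2 (fun h => h0 (Subtype.ext h))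
    refine ⟨c • PiTensorProduct.tprod ℂ fun _ : Fin 4 => s.localSection q q, ?_⟩
    have h1 := s.quartic_kappa hE hA (s.localSection q q)
    rw [lineDual_localSection, one_pow, one_smul] at h1
    rw [map_smul]
    exact (congrArg (c • ·) h1).trans (Subtype.ext hc.symm)

lemma isHolomorphicIso_kappa {Λ : ℝ} (hΛ : Λ ≠ 0) (hE : s.IsEinstein Λ)
    (hA : s.IsAntiSelfDual) : s.IsHolomorphicIso fun q => s.toHom (s.kappa hE hA q) := by
  have key {U : Set s.ProjSpinor} {σ : ∀ q : s.ProjSpinor, s.taut q} (hU : IsOpen U)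
      (hσ : ContMDiffOn modelP modelS ∞ (s.sectionMap σ) U) {q : s.ProjSpinor} (hq : q ∈ U) :
      ∀ᶠ r in 𝓝 q, (s.quartic (s.toHom (s.kappa hE hA r)) (σ r) :
        TangentSpace modelP r [⋀^Fin 3]→L[ℝ] ℂ) = s.pullTau σ r := by
    filter_upwards [hU.mem_nhds hq] with r hr
    exact s.quartic_kappa_section hE hA
      ((hσ.contMDiffAt (hU.mem_nhds hr)).mdifferentiableAt (by simp))
  exact
    { bijective := s.bijective_toHom_kappa hΛ hE hA
      smooth := fun U σ hU _ hσ q hq =>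
        s.smoothAt_pullTau (hσ.contMDiffAt (hU.mem_nhds hq)) (key hU hσ hq)
      dbar_iff := fun U σ hU h0 hσ q hq =>
        s.isTypeK0_d_pullTau_iff hΛ hE hA (hσ.contMDiffAt (hU.mem_nhds hq)) (h0 q hq)
          (key hU hσ hq) }

end SpinStructure

end

theorem proposition3p6 {X : Type*} [TopologicalSpace X] [ChartedSpace E4 X]
    [IsManifold (𝓡 4) ∞ X] {g : Metric4 X} {ι : Type*} (s : SpinStructure g ι) {Λ : ℝ}
    (hΛ : Λ ≠ 0) (hE : s.IsEinstein Λ) (hA : s.IsAntiSelfDual) :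
    ∃ κ : ∀ q : s.ProjSpinor, Module.Dual ℂ (⨂[ℂ]^4 (s.taut q)) ⊗[ℂ] s.canonical q,
      (∀ q, κ q ≠ 0) ∧ s.DescendsTo κ ∧ s.IsHolomorphicIso (fun q => s.toHom (κ q)) :=
  ⟨s.kappa hE hA, s.kappa_ne_zero hΛ hE hA, s.descendsTo_kappa hE hA,
    s.isHolomorphicIso_kappa hΛ hE hA⟩
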